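/- **Conventions.** Circuits are over a fixed discrete universal gate set (NOT, $H$, $T$, CNOT, Toffoli); some wires may be initialised to $|0\rangle$ and some may be traced out at the end. The size of a circuit is its number of gates and oracle queries plus its number of input and output qubits (initialised and traced-out ones included). A QPT algorithm is a family $\{A_\lambda\}_{\lambda\in\mathbb N}$ of circuits of size polynomial in $\lambda$. A non-uniform QPT distinguisher is such a family with one output bit, together with advice density matrices $\rho_\lambda$ on polynomially many qubits. It has classical access to an oracle when each query register is measured in the computational basis, after which the oracle's answer is returned in a fresh register. $\mathscr H_n$ is the Haar measure on $n$-qubit pure states. A function is negligible if it decays faster than every inverse polynomial. **Definitions.** Let $d,n:\mathbb N\to\mathbb N$, with $d$ polynomially bounded. - A $(d,\lambda)$-post-quantum PRF is a family $F:\{0,1\}^\lambda\times\{0,1\}^{d(\lambda)}\to\{0,1\}^{\lambda}$ computable in deterministic polynomial time such that for every non-uniform QPT distinguisher $(A_\lambda,\rho_\lambda)$ there is a negligible $\varepsilon$ with, for all $\lambda$, $$\Big|\Pr_{k\leftarrow\{0,1\}^\lambda}[A_\lambda^{F(k,\cdot)}(\rho_\lambda)=1]-\Pr_{f}[A_\lambda^{f}(\rho_\lambda)=1]\Big|\le\varepsilon(\lambda),$$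 where $f:\{0,1\}^{d(\lambda)}\to\{0,1\}^{\lambda}$ is a uniformly random function and the access to the oracle is classical. - An $n$-PRS generator is a QPT algorithm $g$ such that for all $\lambda$ and $k\in\{0,1\}^\lambda$ the output $g_\lambda(k)$ is a pure $n(\lambda)$-qubit state, and for every polynomial $t$ and every non-uniform QPT distinguisher $(A_\lambda,\rho_\lambda)$ there is a negligible $\varepsilon$ with, for all $\lambda$, $$\Big|\Pr_{k\leftarrow\{0,1\}^\lambda}[A_\lambda(g_\lambda(k)^{\otimes t(\lambda)},\rho_\lambda)=1]-\Pr_{|\vartheta\rangle\leftarrow\mathscr H_{n(\lambda)}}[A_\lambda(|\vartheta\rangle^{\otimes t(\lambda)},\rho_\lambda)=1]\Big|\le\varepsilon(\lambda).$$ - A $(d,n)$-APRFS generator (adaptively secure pseudorandom function-like state generator, for classical queries) is a QPT algorithm $G$ that maps $k\in\{0,1\}^\lambda$ and $x\in\{0,1\}^{d(\lambda)}$ to an $n(\lambda)$-qubit state $G_\lambda(k,x)$, such that for every non-uniform QPT distinguisher $(A_\lambda,\rho_\lambda)$ there is a negligible $\varepsilon$ with, for all $\lambda$, $$\Big|\Pr_{k\leftarrow\{0,1\}^\lambda}[A_\lambda^{G_\lambda(k,\cdot)}(\rho_\lambda)=1]-\Pr_{\mathcal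 O_{\sf Haar}}[A_\lambda^{\mathcal O_{\sf Haar}}(\rho_\lambda)=1]\Big|\le\varepsilon(\lambda),$$ where $\mathcal O_{\sf Haar}$ answers every query $x$ with $|\vartheta_x\rangle$, the states $|\vartheta_y\rangle\leftarrow\mathscr H_{n(\lambda)}$, $y\in\{0,1\}^{d(\lambda)}$, are drawn independently once and for all, and the (adaptive) access to the oracles is classical. **Lemma.** Let $F$ be a $(d,\lambda)$-post-quantum PRF and let $g$ be an $n$-PRS generator. Then $G_\lambda(k,x)=g_\lambda(F(k,x))$ is a $(d,n)$-APRFS generator; in particular $G$ is a QPT algorithm. -/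

import Mathlib

open MeasureTheory Matrix
open scoped ComplexOrder

noncomputable section

namespace PRFS

/-! ### Asymptotics -/

/-- `f` is bounded by a polynomial in the security parameter. -/
def PolyBounded (f : ℕ → ℕ) : Prop :=
  ∃ p : Polynomial ℕ, ∀ lam, f lam ≤ p.eval lam

/-- A negligible function: it decays faster than every inverse polynomial. -/
def Negligible (ε : ℕ → ℝ) : Prop :=
  Asymptotics.SuperpolynomialDecay Filter.atTop (fun lam : ℕ => (lam : ℝ)) ε

/-- The two sequences of probabilities differ by at most a negligible function. -/
def Indistinguishable (p q : ℕ → ℝ) : Prop :=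
  ∃ ε : ℕ → ℝ, Negligible ε ∧ ∀ lam, |p lam - q lam| ≤ ε lam

/-- Expectation of `f` over a uniformly random element of a finite type. -/
def uniformAvg {α : Type} [Fintype α] (f : α → ℝ) : ℝ :=
  (∑ a, f a) / Fintype.card α

/-! ### Operators on registers of qubits

The qubits of a register are labelled by a finite type `ι`; bit strings `ι → Bool` label the
computational basis, and operators are matrices in that basis. -/

/-- Operators on the register of qubits labelled by `ι`. -/
abbrev Op (ι : Type) : Type := Matrix (ι → Bool) (ι → Bool) ℂ

/-- Density matrices. -/
def IsDensity {ι : Type} [Fintype ι] [DecidableEq ι] (ρ : Op ι) : Prop :=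
  ρ.PosSemidef ∧ ρ.trace = 1

/-- The rank-one projection `|x⟩⟨x|` on a computational basis state. -/
def basisState {ι : Type} [Fintype ι] [DecidableEq ι] (x : ι → Bool) : Op ι :=
  Matrix.single x x 1

/-- The operator `|ψ⟩⟨ψ|`. -/
def pureState {ι : Type} [Fintype ι] (ψ : EuclideanSpace ℂ (ι → Bool)) : Op ι :=
  Matrix.of fun u v => ψ u * star (ψ v)

/-- The tensor power `ρ^{⊗ t}`; qubit `j` of the copy number `i` is labelled `(i, j)`. -/
def tensorPow {ι : Type} (t : ℕ) (ρ : Op ι) : Op (Fin t × ι) :=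
  Matrix.of fun u v => ∏ i, ρ (fun j => u (i, j)) (fun j => v (i, j))

/-- The tensor product `ρ ⊗ σ`. -/
def tensor {ι κ : Type} (ρ : Op ι) (σ : Op κ) : Op (ι ⊕ κ) :=
  Matrix.of fun u v => ρ (fun i => u (.inl i)) (fun i => v (.inl i)) *
    σ (fun j => u (.inr j)) (fun j => v (.inr j))

/-- The bit strings `a` and `b` agree on all wires outside the range of `e`. -/
abbrev AgreeOff {α ι : Type} (e : α ↪ ι) (a b : ι → Bool) : Prop :=
  ∀ i, (∀ j, e j ≠ i) → a i = b i

/-- Put the operator `ρ` on the wires in the range of `e`, and initialise every other wire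
to `|0⟩`. -/
def load {α ι : Type} [Fintype α] [Fintype ι] [DecidableEq ι] (e : α ↪ ι) (ρ : Op α) : Op ι :=
  Matrix.of fun u v =>
    if AgreeOff e u (fun _ => false) ∧ AgreeOff e v (fun _ => false) then ρ (u ∘ e) (v ∘ e) else 0

/-- Keep the wires in the range of `e` and trace out all the others. -/
def keep {β ι : Type} [Fintype β] [Fintype ι] [DecidableEq ι] (e : β ↪ ι) (ρ : Op ι) : Op β :=
  Matrix.of fun u v =>
    ∑ a : ι → Bool, ∑ b : ι → Bool, if a ∘ e = u ∧ b ∘ e = v ∧ AgreeOff e a b then ρ a b else 0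

/-! ### Gates -/

/-- A discrete universal gate set: NOT, Hadamard, `T`, CNOT and Toffoli gates, applied to wires
labelled by `ι`. -/
inductive Gate (ι : Type) : Type
  | not (i : ι)
  | hadamard (i : ι)
  | phase (i : ι)
  | cnot (c t : ι) (hct : c ≠ t)
  | toffoli (a b t : ι) (hab : a ≠ b) (hat : a ≠ t) (hbt : b ≠ t)

/-- The permutation matrix that sends `|v⟩` to `|f v⟩`. -/
def basisMap {ι : Type} [Fintype ι] [DecidableEq ι] (f : (ι → Bool) → (ι → Bool)) : Op ι :=
  Matrix.of fun u v => if u = f v then 1 else 0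

/-- The unitary matrix of a gate. -/
def Gate.unitary {ι : Type} [Fintype ι] [DecidableEq ι] : Gate ι → Op ι
  | .not i => basisMap fun v => Function.update v i (!v i)
  | .hadamard i => Matrix.of fun u v =>
      if ∀ j, j ≠ i → u j = v j then
        (if u i && v i then -1 else 1) / (Real.sqrt 2 : ℂ)
      else 0
  | .phase i => Matrix.diagonal fun v =>
      if v i then Complex.exp (Complex.I * (Real.pi / 4 : ℝ)) else 1
  | .cnot c t _ => basisMap fun v => Function.update v t (xor (v t) (v c))
  | .toffoli a b t _ _ _ => basisMap fun v => Function.update v t (xor (v t) (v a && v b))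

/-- The action `ρ ↦ U ρ U†` of a gate on density matrices. -/
def Gate.apply {ι : Type} [Fintype ι] [DecidableEq ι] (g : Gate ι) (ρ : Op ι) : Op ι :=
  g.unitary * ρ * g.unitaryᴴ

/-- Instructions of a circuit with classical access to an oracle that takes `d` bits and returns
`n` qubits: a gate, or a query with query register `x` and answer register `y`. -/
inductive OracleGate (d n : ℕ) (ι : Type) : Type
  | gate (g : Gate ι)
  | query (x : Fin d ↪ ι) (y : Fin n ↪ ι) (hxy : ∀ i j, x i ≠ y j)

/-- A classical query: the query register `x` is measured in the computational basis with some
outcome `s`, and the answer register `y` is replaced by a fresh register in the state `O s`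
(whatever the wires of `y` held before is traced out). -/
def answerQuery {d n : ℕ} {ι : Type} [Fintype ι] [DecidableEq ι]
    (O : (Fin d → Bool) → Op (Fin n)) (x : Fin d ↪ ι) (y : Fin n ↪ ι) (ρ : Op ι) : Op ι :=
  Matrix.of fun u v =>
    if u ∘ x = v ∘ x then
      O (u ∘ x) (u ∘ y) (v ∘ y) *
        ∑ a : ι → Bool, ∑ b : ι → Bool,
          if a ∘ y = b ∘ y ∧ AgreeOff y a u ∧ AgreeOff y b v then ρ a b else 0
    else 0

/-- The action of an instruction, when the queries are answered by the oracle `O`. -/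
def OracleGate.apply {d n : ℕ} {ι : Type} [Fintype ι] [DecidableEq ι]
    (O : (Fin d → Bool) → Op (Fin n)) : OracleGate d n ι → Op ι → Op ι
  | .gate g, ρ => g.apply ρ
  | .query x y _, ρ => answerQuery O x y ρ

/-! ### Generalized circuits -/

/-- A generalized circuit with instructions from `I`, from qubits labelled by `α` to qubits
labelled by `β`: the input is placed on the wires `inp`, all other wires are initialised to zero,
and at the end all wires outside `out` are traced out. -/
structure Circuit (I : Type → Type) (α β : Type) where
  width : ℕ
  inp : α ↪ Fin width
  ops : List (I (Fin width))
  out : β ↪ Fin width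

/-- The number of instructions, plus the number of input qubits (the zero-initialised ones
included), plus the number of output qubits (the traced out ones included). -/
def Circuit.size {I : Type → Type} {α β : Type} (C : Circuit I α β) : ℕ :=
  C.ops.length + C.width + C.width

/-- The channel computed by a circuit without oracle. -/
def Circuit.run {α β : Type} [Fintype α] [Fintype β] (C : Circuit Gate α β) (ρ : Op α) : Op β :=
  keep C.out (C.ops.foldl (fun σ g => g.apply σ) (load C.inp ρ))

/-- The channel computed by an oracle circuit with classical access to the oracle `O`. -/
def Circuit.runWith {d n : ℕ} {α β : Type} [Fintype α] [Fintype β]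
    (C : Circuit (OracleGate d n) α β) (O : (Fin d → Bool) → Op (Fin n)) (ρ : Op α) : Op β :=
  keep C.out (C.ops.foldl (fun σ g => g.apply O σ) (load C.inp ρ))

/-- The probability that measuring the single output qubit gives `1`. -/
def prOne (σ : Op (Fin 1)) : ℝ := (σ (fun _ => true) (fun _ => true)).re

/-! ### Haar random states -/

/-- The set of unit vectors in the space of `n` qubits. -/
abbrev PureStates (n : ℕ) : Type := Metric.sphere (0 : EuclideanSpace ℂ (Fin n → Bool)) 1

/-- The Haar measure on `n`-qubit pure states: the uniform probability measure on the unit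
sphere of `ℂ^(2^n)`. -/
def haarState (n : ℕ) : Measure (PureStates n) :=
  ((volume : Measure (EuclideanSpace ℂ (Fin n → Bool))).toSphere Set.univ)⁻¹ •
    (volume : Measure (EuclideanSpace ℂ (Fin n → Bool))).toSphere

/-- Independent Haar random `n`-qubit states, one for each `d`-bit string. -/
def haarFamily (d n : ℕ) : Measure ((Fin d → Bool) → PureStates n) :=
  Measure.pi fun _ => haarState n

/-! ### Post-quantum pseudorandom functions -/

/-- The input `(k, x)` of a keyed function as a string: the bits of `k`, tagged `inl`, followed by
the bits of `x`, tagged `inr`. -/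
def encodeInput (d : ℕ → ℕ) :
    (Σ lam : ℕ, (Fin lam → Bool) × (Fin (d lam) → Bool)) → List (Bool ⊕ Bool)
  | ⟨_, k, x⟩ => (List.ofFn k).map Sum.inl ++ (List.ofFn x).map Sum.inr

/-- `F` is computed by a deterministic polynomial-time Turing machine. -/
def IsPolyTime (d m : ℕ → ℕ)
    (F : ∀ lam, (Fin lam → Bool) → (Fin (d lam) → Bool) → (Fin (m lam) → Bool)) : Prop :=
  Nonempty (Turing.TM2ComputableInPolyTime (encodeInput d) (id : List Bool → List Bool)
    fun i => List.ofFn (F i.1 i.2.1 i.2.2))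

/-- `(d, m)`-post-quantum secure pseudorandom functions, with `lam`-bit keys. -/
structure IsPostQuantumPRF (d m : ℕ → ℕ)
    (F : ∀ lam, (Fin lam → Bool) → (Fin (d lam) → Bool) → (Fin (m lam) → Bool)) : Prop where
  polyTime : IsPolyTime d m F
  /-- No non-uniform polynomial-size family of circuits with quantum advice and with classical
  oracle access distinguishes `F k` from a uniformly random function. -/
  secure : ∀ (a : ℕ → ℕ) (A : ∀ lam, Circuit (OracleGate (d lam) (m lam)) (Fin (a lam)) (Fin 1))
    (ρ : ∀ lam, Op (Fin (a lam))),
    PolyBounded (fun lam => (A lam).size) → (∀ lam, IsDensity (ρ lam)) →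
    Indistinguishable
      (fun lam => uniformAvg fun k : Fin lam → Bool =>
        prOne ((A lam).runWith (fun x => basisState (F lam k x)) (ρ lam)))
      (fun lam => uniformAvg fun f : (Fin (d lam) → Bool) → (Fin (m lam) → Bool) =>
        prOne ((A lam).runWith (fun x => basisState (f x)) (ρ lam)))

/-! ### Pseudorandom states and adaptively secure pseudorandom function-like states -/

/-- `n`-qubit pseudorandom state generators. -/
structure IsPRS (n : ℕ → ℕ) (g : ∀ lam, (Fin lam → Bool) → Op (Fin (n lam))) : Prop where
  /-- `g` is a QPT algorithm. -/
  qpt : ∃ C : ∀ lam, Circuit Gate (Fin lam) (Fin (n lam)),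
    PolyBounded (fun lam => (C lam).size) ∧ ∀ lam k, (C lam).run (basisState k) = g lam k
  /-- The outputs are pure states. -/
  stateGeneration : ∀ lam k, ∃ ψ : PureStates (n lam), g lam k = pureState ψ.1
  /-- No non-uniform polynomial-size family of circuits with quantum advice distinguishes
  polynomially many copies of `g k` from as many copies of a Haar random state. -/
  pseudorandom : ∀ (t : Polynomial ℕ) (a : ℕ → ℕ)
    (A : ∀ lam, Circuit Gate ((Fin (t.eval lam) × Fin (n lam)) ⊕ Fin (a lam)) (Fin 1))
    (ρ : ∀ lam, Op (Fin (a lam))),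
    PolyBounded (fun lam => (A lam).size) → (∀ lam, IsDensity (ρ lam)) →
    Indistinguishable
      (fun lam => uniformAvg fun k : Fin lam → Bool =>
        prOne ((A lam).run (tensor (tensorPow (t.eval lam) (g lam k)) (ρ lam))))
      (fun lam => ∫ θ : PureStates (n lam),
        prOne ((A lam).run (tensor (tensorPow (t.eval lam) (pureState θ.1)) (ρ lam)))
          ∂(haarState (n lam)))

/-- `(d, n)`-adaptively secure pseudorandom function-like state generators (against adversaries
with classical queries). -/
structure IsAPRFS (d n : ℕ → ℕ)
    (G : ∀ lam, (Fin lam → Bool) → (Fin (d lam) → Bool) → Op (Fin (n lam))) : Prop where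
  /-- `G` is a QPT algorithm. -/
  qpt : ∃ C : ∀ lam, Circuit Gate (Fin lam ⊕ Fin (d lam)) (Fin (n lam)),
    PolyBounded (fun lam => (C lam).size) ∧
      ∀ lam k x, (C lam).run (basisState (Sum.elim k x)) = G lam k x
  /-- No non-uniform polynomial-size family of circuits with quantum advice and with classical
  oracle access distinguishes `G k` from a family of independent Haar random states. -/
  secure : ∀ (a : ℕ → ℕ) (A : ∀ lam, Circuit (OracleGate (d lam) (n lam)) (Fin (a lam)) (Fin 1))
    (ρ : ∀ lam, Op (Fin (a lam))),
    PolyBounded (fun lam => (A lam).size) → (∀ lam, IsDensity (ρ lam)) →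
    Indistinguishable
      (fun lam => uniformAvg fun k : Fin lam → Bool =>
        prOne ((A lam).runWith (fun x => G lam k x) (ρ lam)))
      (fun lam => ∫ θ : (Fin (d lam) → Bool) → PureStates (n lam),
        prOne ((A lam).runWith (fun x => pureState (θ x).1) (ρ lam)) ∂(haarFamily (d lam) (n lam)))

end PRFS

end

/-! Security is shown by two replacements. The circuit of `g` can be run on the answer of a
classical oracle, so an adversary that queries states becomes one that queries a function
(`simulateCircuit`), and PRF security lets a uniformly random function `f` take the place of `F k`
(`indistinguishable_randomFunction`). The answers `g (f x)` are then independent samples of `g k`,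
one for each string `x`, and they have to be traded for independent Haar states
(`indistinguishable_haarFamily`).

There may be exponentially many strings, but an adversary with at most `t` instructions meets at
most `t` samples. Queries are measured, hence can be recorded, and a query may be answered by the
sample whose number is that of the first equal record. As the samples are independent and
identically distributed, giving a new query an unused sample instead of the one attached to its
string does not change expectations (`integral_lazyEval`). A circuit without oracle can do this when
it receives `t` copies of each of `t` samples (`collectCircuit`). Its acceptance probability is
linear in the input, so only the mean input matters, and by independence this is the `t`-fold tensor
power of the moment operator, the mean of `t` copies of one sample (`integral_runWith`). Exchanging
the moment of `g k` for the Haar moment in one factor at a time gives a telescoping sum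
(`exists_hybrid`). Its largest term is the advantage of a distinguisher against `g` that holds the
other factors as advice. The moments need no efficient preparation and the best index may depend on
the security parameter, because circuits and advice are non-uniform.

That the composition is QPT requires circuits for `F`, which is given by a stack machine. After one
step, the label, the internal state and each stack cell are determined by boundedly many such data
before the step. Hence polynomially many Toffoli gates answer every question about the configuration
after polynomially many steps (`available_step`, `exists_circuit_of_polyTime`).

Circuit manipulations rest on one locality principle, the field `block_act` of `Sem`: an instruction
acts separately on each block obtained by fixing the row and column bits of the wires it does not
mention. It therefore commutes with initialising, discarding or ignoring those wires, which is what
composition of circuits needs (`Circuit.eval_comp`). -/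

noncomputable section

namespace PRFS

/-! ### Bit strings, patches and blocks -/

section Patch

variable {α β γ ι κ : Type}

@[simp] lemma extend_comp_emb (e : α ↪ ι) (u : α → Bool) (a : ι → Bool) :
    Function.extend e u a ∘ e = u :=
  funext fun i => e.injective.extend_apply u a i

@[simp] lemma extend_emb_apply (e : α ↪ ι) (u : α → Bool) (a : ι → Bool) (i : α) :
    Function.extend e u a (e i) = u i :=
  e.injective.extend_apply u a i

lemma extend_off (e : α ↪ ι) (u : α → Bool) (a : ι → Bool) {i : ι} (h : ∀ j, e j ≠ i) :
    Function.extend e u a i = a i :=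
  Function.extend_apply' _ _ _ (by rintro ⟨j, hj⟩; exact h j hj)

/-- The bits on the range of `e` and those off it determine a string. This is the criterion by which
overwritten strings are identified below. -/
lemma eq_extend_iff (e : α ↪ ι) (u : α → Bool) (a w : ι → Bool) :
    w = Function.extend e u a ↔ w ∘ e = u ∧ AgreeOff e w a := by
  constructor
  · rintro rfl
    exact ⟨extend_comp_emb e u a, fun i hi => extend_off e u a hi⟩
  · rintro ⟨rfl, h⟩
    funext i
    by_cases hi : ∃ j, e j = i
    · obtain ⟨j, rfl⟩ := hi
      simp
    · push Not at hi
      rw [h i hi, extend_off e _ _ hi]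

lemma agreeOff_extend (e : α ↪ ι) (u : α → Bool) (a : ι → Bool) :
    AgreeOff e (Function.extend e u a) a :=
  ((eq_extend_iff e u a _).1 rfl).2

lemma AgreeOff.symm {e : α ↪ ι} {a b : ι → Bool} (h : AgreeOff e a b) : AgreeOff e b a :=
  fun i hi => (h i hi).symm

lemma AgreeOff.trans {e : α ↪ ι} {a b c : ι → Bool} (h : AgreeOff e a b) (h' : AgreeOff e b c) :
    AgreeOff e a c :=
  fun i hi => (h i hi).trans (h' i hi)

lemma agreeOff_extend_left (e : α ↪ ι) (u : α → Bool) (a b : ι → Bool) :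
    AgreeOff e (Function.extend e u a) b ↔ AgreeOff e a b :=
  ⟨fun h => (agreeOff_extend e u a).symm.trans h, fun h => (agreeOff_extend e u a).trans h⟩

@[simp] lemma extend_comp_self (e : α ↪ ι) (a : ι → Bool) : Function.extend e (a ∘ e) a = a :=
  ((eq_extend_iff e _ a a).2 ⟨rfl, fun _ _ => rfl⟩).symm

lemma extend_congr (e : α ↪ ι) (u : α → Bool) {a b : ι → Bool} (h : AgreeOff e a b) :
    Function.extend e u a = Function.extend e u b :=
  (eq_extend_iff e u b _).2 ⟨extend_comp_emb e u a, (agreeOff_extend_left e u a b).2 h⟩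

lemma extend_trans (f : α ↪ ι) (e : ι ↪ κ) (z : α → Bool) (u : ι → Bool) (a : κ → Bool) :
    Function.extend (f.trans e) z (Function.extend e u a) =
      Function.extend e (Function.extend f z u) a := by
  symm
  rw [eq_extend_iff]
  constructor
  · funext i; simp
  · intro i hi
    by_cases h : ∃ j, e j = i
    · obtain ⟨j, rfl⟩ := h
      simp only [extend_emb_apply]
      exact extend_off f z u fun k hk => hi k (by simp [hk])
    · push Not at h
      rw [extend_off e _ _ h, extend_off e _ _ h]

lemma extend_inr (u : β → Bool) (a : α ⊕ β → Bool) :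
    Function.extend (Function.Embedding.inr : β ↪ α ⊕ β) u a = Sum.elim (a ∘ Sum.inl) u := by
  symm
  rw [eq_extend_iff]
  refine ⟨rfl, ?_⟩
  rintro (i | i) hi
  · rfl
  · exact absurd rfl (hi i)

lemma sum_agreeOff [Fintype α] [DecidableEq α] [Fintype ι] [DecidableEq ι] {M : Type*} [AddCommMonoid M]
    (e : α ↪ ι) (a : ι → Bool) (f : (ι → Bool) → M) :
    (∑ w, if AgreeOff e w a then f w else 0) = ∑ u : α → Bool, f (Function.extend e u a) := by
  classical
  rw [← Finset.sum_filter]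
  refine Finset.sum_nbij' (fun w => w ∘ e) (fun u => Function.extend e u a) ?_ ?_ ?_ ?_ ?_
  · simp
  · intro u _
    simpa using agreeOff_extend e u a
  · intro w hw
    exact ((eq_extend_iff e _ a w).2 ⟨rfl, by simpa using hw⟩).symm
  · intro u _; simp
  · intro w hw
    rw [← (eq_extend_iff e _ a w).2 ⟨rfl, by simpa using hw⟩]

/-- The block of `ρ` in which the wires outside the range of `e` carry `a` and `b`. -/
def block (e : ι ↪ κ) (a b : κ → Bool) : Op κ →ₗ[ℂ] Op ι where
  toFun ρ := ρ.submatrix (fun u => Function.extend e u a) (fun v => Function.extend e v b)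
  map_add' _ _ := rfl
  map_smul' _ _ := rfl

lemma block_apply (e : ι ↪ κ) (a b : κ → Bool) (ρ : Op κ) (u v : ι → Bool) :
    block e a b ρ u v = ρ (Function.extend e u a) (Function.extend e v b) := rfl

/-- Every entry `(a, b)` lies in the block with outer strings `a` and `b`, so the blocks separate
operators. -/
lemma ext_block (e : ι ↪ κ) {ρ σ : Op κ} (h : ∀ a b, block e a b ρ = block e a b σ) : ρ = σ := by
  ext a b
  have := congr_fun₂ (h a b) (a ∘ e) (b ∘ e)
  simpa [block_apply] using this

lemma block_load [Fintype ι] [Fintype κ] [DecidableEq κ] (e : ι ↪ κ) (a b : κ → Bool) (ρ : Op ι) :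
    block e a b (load e ρ) =
      (if AgreeOff e a (fun _ => false) ∧ AgreeOff e b (fun _ => false) then (1 : ℂ) else 0) • ρ := by
  ext u v
  have h1 := agreeOff_extend_left e u a (fun _ => false)
  have h2 := agreeOff_extend_left e v b (fun _ => false)
  simp only [block_apply, load, of_apply, h1, h2, extend_comp_emb, Matrix.smul_apply,
    smul_eq_mul, ite_mul, one_mul, zero_mul]

lemma block_tensor (a b : α ⊕ β → Bool) (τ : Op α) (ρ : Op β) :
    block (Function.Embedding.inr : β ↪ α ⊕ β) a b (tensor τ ρ) =
      τ (a ∘ Sum.inl) (b ∘ Sum.inl) • ρ := by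
  ext u v
  simp [block_apply, extend_inr, tensor, Function.comp_def]

lemma keep_apply [Fintype β] [Fintype ι] [DecidableEq ι] (e : β ↪ ι) (ρ : Op ι)
    (u v : β → Bool) :
    keep e ρ u v = ∑ a : ι → Bool, if a ∘ e = u then ρ a (Function.extend e v a) else 0 := by
  simp only [keep, of_apply]
  refine Finset.sum_congr rfl fun a _ => ?_
  by_cases h : a ∘ e = u
  · simp only [h, true_and, if_true]
    rw [Finset.sum_eq_single (Function.extend e v a)]
    · rw [if_pos]
      exact ⟨extend_comp_emb e v a, (agreeOff_extend e v a).symm⟩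
    · intro b _ hb
      rw [if_neg]
      rintro ⟨h1, h2⟩
      exact hb ((eq_extend_iff e v a b).2 ⟨h1, h2.symm⟩)
    · simp
  · simp [h]

/-- Once the wires are split into the kept ones and a complement `γ`, the agreement condition in
`keep` says that both indices share their `γ` part, and the usual partial trace appears. -/
lemma keep_eq_sum_equiv [Fintype β] [Fintype ι] [DecidableEq ι] [Fintype γ] [DecidableEq γ]
    (e : β ↪ ι) (E : β ⊕ γ ≃ ι) (hE : ∀ b, E (.inl b) = e b) (ρ : Op ι) (u v : β → Bool) :
    keep e ρ u v = ∑ z : γ → Bool, ρ (Sum.elim u z ∘ E.symm) (Sum.elim v z ∘ E.symm) := by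
  classical
  have hE' : ∀ b, E.symm (e b) = .inl b := fun b => by rw [← hE, E.symm_apply_apply]
  rw [keep_apply, ← Finset.sum_filter]
  have key : ∀ a : ι → Bool, Function.extend e v a = Sum.elim v (fun c => a (E (.inr c))) ∘ E.symm := by
    intro a
    symm
    rw [eq_extend_iff]
    constructor
    · funext b
      simp [← hE]
    · intro i hi
      obtain ⟨j, rfl⟩ := E.surjective i
      rcases j with j | j
      · exact absurd (hE j).symm (hi j)
      · simp
  refine Finset.sum_nbij' (fun a c => a (E (.inr c))) (fun z => Sum.elim u z ∘ E.symm) ?_ ?_ ?_ ?_ ?_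
  · simp
  · intro z _
    simp only [Finset.mem_filter, Finset.mem_univ, true_and]
    funext b
    simp [← hE]
  · intro a ha
    simp only [Finset.mem_filter, Finset.mem_univ, true_and] at ha
    funext i
    obtain ⟨j, rfl⟩ := E.surjective i
    rcases j with j | j
    · simp [← ha, hE, hE']
    · simp
  · intro z _; funext c; simp
  · intro a ha
    simp only [Finset.mem_filter, Finset.mem_univ, true_and] at ha
    have : Sum.elim u (fun c => a (E (.inr c))) ∘ E.symm = a := by
      funext i
      obtain ⟨j, rfl⟩ := E.surjective i
      rcases j with j | j
      · simp [← ha, hE, hE']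
      · simp
    rw [key, this]

lemma exists_compl [Fintype ι] (e : α ↪ ι) :
    ∃ (γ : Type) (_ : Fintype γ) (_ : DecidableEq γ) (E : α ⊕ γ ≃ ι), ∀ a, E (.inl a) = e a := by
  classical
  refine ⟨((Set.range e)ᶜ : Set ι), inferInstance, inferInstance,
    ((Equiv.ofInjective e e.injective).sumCongr (Equiv.refl _)).trans
      (Equiv.Set.sumCompl (Set.range e)), fun a => ?_⟩
  simp

/-- Rename the wires of a register. -/
def rename (E : α ≃ β) : Op α →ₗ[ℂ] Op β where
  toFun ρ := ρ.submatrix (fun u => u ∘ E) (fun v => v ∘ E)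
  map_add' _ _ := rfl
  map_smul' _ _ := rfl

lemma rename_apply (E : α ≃ β) (ρ : Op α) (u v : β → Bool) :
    rename E ρ u v = ρ (u ∘ E) (v ∘ E) := rfl

lemma keep_equiv [Fintype β] [Fintype ι] [DecidableEq ι] (E : β ≃ ι) (ρ : Op ι) :
    keep E.toEmbedding ρ = rename E.symm ρ := by
  ext u v
  rw [keep_eq_sum_equiv (γ := Empty) E.toEmbedding ((Equiv.sumEmpty _ _).trans E) (fun _ => rfl)]
  simp only [Finset.univ_unique, Finset.sum_singleton]
  rw [rename_apply]
  congr 1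

lemma load_equiv [Fintype β] [Fintype ι] [DecidableEq ι] (E : β ≃ ι) (ρ : Op β) :
    load E.toEmbedding ρ = rename E ρ := by
  ext u v
  have h : ∀ u : ι → Bool, AgreeOff E.toEmbedding u (fun _ => false) :=
    fun u i hi => absurd (E.apply_symm_apply i) (hi _)
  rw [load, of_apply, if_pos ⟨h u, h v⟩, rename_apply]
  rfl

lemma load_trans [Fintype α] [Fintype β] [DecidableEq β] [Fintype ι] [DecidableEq ι]
    (f : α ↪ β) (e : β ↪ ι) (ρ : Op α) : load (f.trans e) ρ = load e (load f ρ) := by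
  have h : ∀ u : ι → Bool, AgreeOff (f.trans e) u (fun _ => false) ↔
      AgreeOff e u (fun _ => false) ∧ AgreeOff f (u ∘ e) (fun _ => false) := by
    intro u
    constructor
    · intro hu
      refine ⟨fun i hi => hu i fun j => hi (f j), fun i hi => hu (e i) fun j hj => ?_⟩
      exact hi j (e.injective hj)
    · rintro ⟨h1, h2⟩ i hi
      by_cases h : ∃ j, e j = i
      · obtain ⟨j, rfl⟩ := h
        exact h2 j fun k hk => hi k (by simp [hk])
      · push Not at h
        exact h1 i h
  ext u v
  simp only [load, of_apply, h]
  split_ifs <;> first | rfl | (exfalso; tauto)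

/-- A Fubini argument: the complement of the composed embedding is the disjoint union of the two
complements. -/
lemma keep_trans [Fintype α] [Fintype β] [DecidableEq β] [Fintype ι] [DecidableEq ι]
    (f : α ↪ β) (e : β ↪ ι) (ρ : Op ι) : keep (f.trans e) ρ = keep f (keep e ρ) := by
  obtain ⟨C, _, _, E, hE⟩ := exists_compl f
  obtain ⟨D, _, _, E', hE'⟩ := exists_compl e
  ext u v
  rw [keep_eq_sum_equiv f E hE]
  simp only [keep_eq_sum_equiv e E' hE']
  rw [keep_eq_sum_equiv (f.trans e)
    ((Equiv.sumAssoc α C D).symm.trans ((E.sumCongr (Equiv.refl D)).trans E'))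
    (by intro b; simp [hE, hE'])]
  rw [← Fintype.sum_prod_type' (f := fun (z : C → Bool) (w : D → Bool) =>
    ρ (Sum.elim (Sum.elim u z ∘ E.symm) w ∘ E'.symm) (Sum.elim (Sum.elim v z ∘ E.symm) w ∘ E'.symm))]
  refine Fintype.sum_equiv (Equiv.sumArrowEquivProdArrow C D Bool) _ _ fun z => ?_
  have : ∀ u : α → Bool, Sum.elim u z ∘
      ((Equiv.sumAssoc α C D).symm.trans ((E.sumCongr (Equiv.refl D)).trans E')).symm =
      Sum.elim (Sum.elim u (z ∘ Sum.inl) ∘ E.symm) (z ∘ Sum.inr) ∘ E'.symm := by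
    intro u
    funext i
    obtain ⟨j, rfl⟩ := E'.surjective i
    rcases j with j | j
    · obtain ⟨k, rfl⟩ := E.surjective j
      rcases k with k | k <;> simp
    · simp
  rw [this, this]
  rfl

@[simp] lemma keep_load [Fintype α] [Fintype ι] [DecidableEq ι] (e : α ↪ ι) (ρ : Op α) :
    keep e (load e ρ) = ρ := by
  ext u v
  rw [keep_apply, Finset.sum_eq_single (Function.extend e u (fun _ => false))]
  · have h1 := agreeOff_extend e u (fun _ => false)
    have h2 : AgreeOff e (Function.extend e v (Function.extend e u fun _ => false))
      (fun _ => false) := (agreeOff_extend e v _).trans h1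
    rw [if_pos (extend_comp_emb _ _ _), load, of_apply, if_pos ⟨h1, h2⟩]
    simp
  · intro a _ ha
    split_ifs with h
    · rw [load, of_apply, if_neg]
      rintro ⟨h1, -⟩
      exact ha ((eq_extend_iff e u _ a).2 ⟨h, h1⟩)
    · rfl
  · simp

/-- A diagonal block depends only on the bits of `a` off the range of `e`; demanding zeros on the
range picks one representative for each choice of these bits. In this form, anything that acts
blockwise and linearly commutes with the partial trace. -/
lemma keep_eq_sum_block [Fintype β] [Fintype ι] [DecidableEq ι] (e : β ↪ ι) (ρ : Op ι) :
    keep e ρ = ∑ a : ι → Bool, (if a ∘ e = fun _ => false then (1 : ℂ) else 0) • block e a a ρ := by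
  obtain ⟨C, _, _, E, hE⟩ := exists_compl e
  have hE' : ∀ b, E.symm (e b) = .inl b := fun b => by rw [← hE, E.symm_apply_apply]
  ext u v
  rw [keep_eq_sum_equiv e E hE, Matrix.sum_apply]
  simp only [Matrix.smul_apply, smul_eq_mul, ite_mul, one_mul, zero_mul]
  rw [← Finset.sum_filter]
  have key : ∀ (a : ι → Bool) (v : β → Bool),
      Function.extend e v a = Sum.elim v (fun c => a (E (.inr c))) ∘ E.symm := by
    intro a v
    symm
    rw [eq_extend_iff]
    constructor
    · funext b
      simp [← hE]
    · intro i hi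
      obtain ⟨j, rfl⟩ := E.surjective i
      rcases j with j | j
      · exact absurd (hE j).symm (hi j)
      · simp
  symm
  refine Finset.sum_nbij' (fun a c => a (E (.inr c)))
    (fun z => Sum.elim (fun _ => false) z ∘ E.symm) ?_ ?_ ?_ ?_ ?_
  · simp
  · intro z _
    simp only [Finset.mem_filter, Finset.mem_univ, true_and]
    funext b
    simp [← hE]
  · intro a ha
    simp only [Finset.mem_filter, Finset.mem_univ, true_and] at ha
    funext i
    obtain ⟨j, rfl⟩ := E.surjective i
    rcases j with j | j
    · simpa [hE, hE'] using (congr_fun ha j).symm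
    · simp
  · intro z _; funext c; simp
  · intro a _
    rw [block_apply, key, key]

end Patch

/-! ### Instruction sets -/

/-- A family of instruction sets, acting linearly on registers, such that an instruction only acts
on the wires it mentions. -/
structure Sem (Ω : Type) (I : Type → Type) where
  map : ∀ {ι κ : Type}, (ι ↪ κ) → I ι → I κ
  act : Ω → ∀ {ι : Type} [Fintype ι] [DecidableEq ι], I ι → (Op ι →ₗ[ℂ] Op ι)
  block_act : ∀ (o : Ω) {ι κ : Type} [Fintype ι] [DecidableEq ι] [Fintype κ] [DecidableEq κ]
    (e : ι ↪ κ) (g : I ι) (a b : κ → Bool) (ρ : Op κ),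
    block e a b (act o (map e g) ρ) = act o g (block e a b ρ)

namespace Sem

variable {Ω : Type} {I : Type → Type} (S : Sem Ω I)
variable {ι κ : Type} [Fintype ι] [DecidableEq ι] [Fintype κ] [DecidableEq κ]

/-- The blocks of `load e ρ` are scalar multiples of `ρ`, and an instruction acts linearly on each
block. The rules for `keep` and `tensor` below follow from `block_act` in the same way. -/
lemma act_load (o : Ω) (e : ι ↪ κ) (g : I ι) (ρ : Op ι) :
    S.act o (S.map e g) (load e ρ) = load e (S.act o g ρ) := by
  refine ext_block e fun a b => ?_
  rw [S.block_act, block_load, block_load, map_smul]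

lemma act_keep (o : Ω) (e : ι ↪ κ) (g : I ι) (ρ : Op κ) :
    keep e (S.act o (S.map e g) ρ) = S.act o g (keep e ρ) := by
  simp only [keep_eq_sum_block, S.block_act, map_sum, map_smul]

lemma act_tensor (o : Ω) (g : I κ) (τ : Op ι) (ρ : Op κ) :
    S.act o (S.map Function.Embedding.inr g) (tensor τ ρ) = tensor τ (S.act o g ρ) := by
  refine ext_block Function.Embedding.inr fun a b => ?_
  rw [S.block_act, block_tensor, block_tensor, map_smul]

/-- Run a list of instructions. -/
def fold (o : Ω) : List (I ι) → (Op ι →ₗ[ℂ] Op ι)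
  | [] => LinearMap.id
  | g :: l => fold o l ∘ₗ S.act o g

@[simp] lemma fold_nil (o : Ω) : S.fold o ([] : List (I ι)) = LinearMap.id := rfl

@[simp] lemma fold_cons (o : Ω) (g : I ι) (l : List (I ι)) (ρ : Op ι) :
    S.fold o (g :: l) ρ = S.fold o l (S.act o g ρ) := rfl

lemma fold_append (o : Ω) (l l' : List (I ι)) (ρ : Op ι) :
    S.fold o (l ++ l') ρ = S.fold o l' (S.fold o l ρ) := by
  induction l generalizing ρ with
  | nil => rfl
  | cons g l ih => simp [ih]

lemma foldl_eq_fold (o : Ω) (l : List (I ι)) (ρ : Op ι) :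
    l.foldl (fun σ g => S.act o g σ) ρ = S.fold o l ρ := by
  induction l generalizing ρ with
  | nil => rfl
  | cons g l ih => simp [ih]

lemma fold_load (o : Ω) (e : ι ↪ κ) (l : List (I ι)) (ρ : Op ι) :
    S.fold o (l.map (S.map e)) (load e ρ) = load e (S.fold o l ρ) := by
  induction l generalizing ρ with
  | nil => rfl
  | cons g l ih => simp [ih, act_load]

lemma fold_keep (o : Ω) (e : ι ↪ κ) (l : List (I ι)) (ρ : Op κ) :
    keep e (S.fold o (l.map (S.map e)) ρ) = S.fold o l (keep e ρ) := by
  induction l generalizing ρ with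
  | nil => rfl
  | cons g l ih => simp [ih, act_keep]

lemma fold_tensor (o : Ω) (l : List (I κ)) (τ : Op ι) (ρ : Op κ) :
    S.fold o (l.map (S.map Function.Embedding.inr)) (tensor τ ρ) = tensor τ (S.fold o l ρ) := by
  induction l generalizing ρ with
  | nil => rfl
  | cons g l ih => simp [ih, act_tensor]

end Sem

/-! ### Gates and queries as instruction sets -/

/-- Apply a gate to renamed wires. -/
def Gate.map {ι κ : Type} (e : ι ↪ κ) : Gate ι → Gate κ
  | .not i => .not (e i)
  | .hadamard i => .hadamard (e i)
  | .phase i => .phase (e i)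
  | .cnot c t h => .cnot (e c) (e t) (e.injective.ne h)
  | .toffoli a b t h h' h'' =>
      .toffoli (e a) (e b) (e t) (e.injective.ne h) (e.injective.ne h') (e.injective.ne h'')

section GateSem

variable {ι κ : Type} [Fintype ι] [DecidableEq ι] [Fintype κ] [DecidableEq κ]

lemma basisMap_extend (e : ι ↪ κ) (F : (ι → Bool) → ι → Bool) (F' : (κ → Bool) → κ → Bool)
    (h : ∀ w, F' w = Function.extend e (F (w ∘ e)) w) (u : ι → Bool) (a w : κ → Bool) :
    basisMap F' (Function.extend e u a) w = if AgreeOff e w a then basisMap F u (w ∘ e) else 0 := by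
  have : Function.extend e u a = F' w ↔ AgreeOff e w a ∧ u = F (w ∘ e) := by
    rw [h, eq_extend_iff, extend_comp_emb, agreeOff_extend_left]
    exact ⟨fun h => ⟨h.2.symm, h.1⟩, fun h => ⟨h.2, h.1.symm⟩⟩
  simp only [basisMap, of_apply, this]
  split_ifs <;> first | rfl | (exfalso; tauto)

omit [Fintype ι] [Fintype κ] in
lemma update_eq_extend (e : ι ↪ κ) (i : ι) (b : Bool) (w : κ → Bool) :
    Function.update w (e i) b = Function.extend e (Function.update (w ∘ e) i b) w := by
  rw [eq_extend_iff]
  constructor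
  · funext j
    by_cases h : j = i
    · subst h; simp
    · simp [h]
  · intro j hj
    exact Function.update_of_ne (hj i).symm _ _

lemma Gate.unitary_map_extend (e : ι ↪ κ) (g : Gate ι) (u : ι → Bool) (a w : κ → Bool) :
    (g.map e).unitary (Function.extend e u a) w =
      if AgreeOff e w a then g.unitary u (w ∘ e) else 0 := by
  cases g with
  | not i => exact basisMap_extend e _ _ (fun w => update_eq_extend e i _ w) u a w
  | cnot c t h => exact basisMap_extend e _ _ (fun w => update_eq_extend e t _ w) u a w
  | toffoli a' b t h h' h'' => exact basisMap_extend e _ _ (fun w => update_eq_extend e t _ w) u a w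
  | hadamard i =>
    have : (∀ j, j ≠ e i → Function.extend e u a j = w j) ↔
        AgreeOff e w a ∧ ∀ j, j ≠ i → u j = (w ∘ e) j := by
      constructor
      · intro h
        refine ⟨fun j hj => ?_, fun j hj => ?_⟩
        · rw [← h j (hj i).symm, extend_off e u a hj]
        · simpa using h (e j) (e.injective.ne hj)
      · rintro ⟨h1, h2⟩ j hj
        by_cases hk : ∃ k, e k = j
        · obtain ⟨k, rfl⟩ := hk
          simpa using h2 k (fun h => hj (by rw [h]))
        · push Not at hk
          rw [extend_off e u a hk, h1 j hk]
    simp only [Gate.map, Gate.unitary, of_apply, this, extend_emb_apply]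
    split_ifs <;> first | rfl | (exfalso; tauto)
  | phase i =>
    have : Function.extend e u a = w ↔ AgreeOff e w a ∧ u = w ∘ e := by
      rw [eq_comm, eq_extend_iff]
      exact ⟨fun h => ⟨h.2, h.1.symm⟩, fun h => ⟨h.2.symm, h.1⟩⟩
    simp only [Gate.map, Gate.unitary, diagonal_apply, this, extend_emb_apply]
    split_ifs <;> first | rfl | (exfalso; tauto)

/-- The action of a gate, as a linear map. -/
def Gate.act (g : Gate ι) : Op ι →ₗ[ℂ] Op ι where
  toFun := g.apply
  map_add' ρ σ := by simp [Gate.apply, mul_add, add_mul]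
  map_smul' c ρ := by simp [Gate.apply]

lemma Gate.apply_apply (g : Gate ι) (ρ : Op ι) (u v : ι → Bool) :
    g.apply ρ u v = ∑ w, ∑ w', g.unitary u w * ρ w w' * star (g.unitary v w') := by
  simp only [Gate.apply, Matrix.mul_apply, conjTranspose_apply, Finset.sum_mul]
  rw [Finset.sum_comm]

/-- The unitary of the renamed gate is that of `g` tensored with the identity on the other wires.
Both sums in the conjugation therefore collapse to strings that agree with `a` and `b` off the range
of `e`. -/
lemma Gate.block_apply (e : ι ↪ κ) (g : Gate ι) (a b : κ → Bool) (ρ : Op κ) :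
    block e a b ((g.map e).apply ρ) = g.apply (block e a b ρ) := by
  ext u v
  rw [PRFS.block_apply, Gate.apply_apply, Gate.apply_apply]
  simp only [Gate.unitary_map_extend, apply_ite star, star_zero, ite_mul, zero_mul, mul_ite,
    mul_zero]
  have : ∀ w, (∑ w' : κ → Bool, if AgreeOff e w' b then
      if AgreeOff e w a then g.unitary u (w ∘ e) * ρ w w' * star (g.unitary v (w' ∘ e)) else 0 else 0)
      = if AgreeOff e w a then ∑ v' : ι → Bool, g.unitary u (w ∘ e) * ρ w (Function.extend e v' b) *
        star (g.unitary v v') else 0 := by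
    intro w
    rw [sum_agreeOff e b (fun w' =>
      if AgreeOff e w a then g.unitary u (w ∘ e) * ρ w w' * star (g.unitary v (w' ∘ e)) else 0)]
    split_ifs <;> simp only [extend_comp_emb, Finset.sum_const_zero]
  simp only [this]
  rw [sum_agreeOff e a fun w => ∑ v' : ι → Bool, g.unitary u (w ∘ e) *
    ρ w (Function.extend e v' b) * star (g.unitary v v')]
  simp only [extend_comp_emb, PRFS.block_apply]

/-- Gates as an instruction set. -/
def gateSem : Sem Unit Gate where
  map := Gate.map
  act _ _ _ _ := Gate.act
  block_act _ _ _ _ _ _ _ := Gate.block_apply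

/-- Apply an instruction to renamed wires. -/
def OracleGate.map {d n : ℕ} (e : ι ↪ κ) : OracleGate d n ι → OracleGate d n κ
  | .gate g => .gate (g.map e)
  | .query x y h => .query (x.trans e) (y.trans e) fun i j => e.injective.ne (h i j)

/-- The two strings summed over in `answerQuery` have prescribed bits off `y` and a common
restriction `z` to `y`, so a single sum over `z` survives. -/
lemma answerQuery_apply {d n : ℕ} (O : (Fin d → Bool) → Op (Fin n)) (x : Fin d ↪ ι) (y : Fin n ↪ ι)
    (ρ : Op ι) (u v : ι → Bool) :
    answerQuery O x y ρ u v = if u ∘ x = v ∘ x then O (u ∘ x) (u ∘ y) (v ∘ y) *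
      ∑ z : Fin n → Bool, ρ (Function.extend y z u) (Function.extend y z v) else 0 := by
  simp only [answerQuery, of_apply]
  congr 2
  have : ∀ a : ι → Bool, (∑ b : ι → Bool,
      if a ∘ y = b ∘ y ∧ AgreeOff y a u ∧ AgreeOff y b v then ρ a b else 0) =
      if AgreeOff y a u then ρ a (Function.extend y (a ∘ y) v) else 0 := by
    intro a
    rw [Finset.sum_eq_single (Function.extend y (a ∘ y) v)]
    · have h := agreeOff_extend y (a ∘ y) v
      simp only [extend_comp_emb, true_and]
      split_ifs <;> first | rfl | (exfalso; tauto)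
    · intro b _ hb
      rw [if_neg]
      rintro ⟨h1, -, h2⟩
      exact hb ((eq_extend_iff y _ _ _).2 ⟨h1.symm, h2⟩)
    · simp
  refine (Finset.sum_congr rfl fun a _ => ?_).trans
    ((sum_agreeOff y u fun a => ρ a (Function.extend y (a ∘ y) v)).trans ?_)
  · rw [this]
    congr
  · simp only [extend_comp_emb]

/-- The action of an instruction, as a linear map. -/
def OracleGate.act {d n : ℕ} (O : (Fin d → Bool) → Op (Fin n)) (g : OracleGate d n ι) :
    Op ι →ₗ[ℂ] Op ι where
  toFun := g.apply O
  map_add' ρ σ := by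
    cases g with
    | gate g => exact g.act.map_add ρ σ
    | query x y h =>
      ext u v
      simp only [OracleGate.apply, Matrix.add_apply, answerQuery_apply, Finset.sum_add_distrib]
      split_ifs <;> ring
  map_smul' c ρ := by
    cases g with
    | gate g => exact g.act.map_smul c ρ
    | query x y h =>
      ext u v
      simp only [OracleGate.apply, Matrix.smul_apply, answerQuery_apply, smul_eq_mul,
        RingHom.id_apply, ← Finset.mul_sum]
      split_ifs <;> ring

/-- Gates and oracle queries as an instruction set. -/
def oracleSem (d n : ℕ) : Sem ((Fin d → Bool) → Op (Fin n)) (OracleGate d n) where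
  map := OracleGate.map
  act O _ _ _ := OracleGate.act O
  block_act O ι κ _ _ _ _ e g a b ρ := by
    cases g with
    | gate g => exact Gate.block_apply e g a b ρ
    | query x y h =>
      ext u v
      change answerQuery O (x.trans e) (y.trans e) ρ (Function.extend e u a) (Function.extend e v b) =
        answerQuery O x y (block e a b ρ) u v
      simp only [answerQuery_apply, extend_trans, PRFS.block_apply]
      have hx : ∀ (u : ι → Bool) (a : κ → Bool) {m : ℕ} (x : Fin m ↪ ι),
          Function.extend e u a ∘ x.trans e = u ∘ x := by
        intro u a m x; funext i; simp
      simp only [hx]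

end GateSem

/-! ### Tensor products, partial traces and renaming -/

section Tensor

variable {α β γ δ ι : Type}

lemma tensor_apply (ρ : Op α) (σ : Op β) (u v : α ⊕ β → Bool) :
    tensor ρ σ u v = ρ (u ∘ Sum.inl) (v ∘ Sum.inl) * σ (u ∘ Sum.inr) (v ∘ Sum.inr) := rfl

lemma basisState_apply [Fintype α] [DecidableEq α] (x u v : α → Bool) :
    basisState x u v = if x = u ∧ x = v then 1 else 0 := rfl

lemma trace_basisState [Fintype α] [DecidableEq α] (x : α → Bool) :
    (basisState x).trace = 1 := by
  simp [basisState]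

lemma trace_tensor [Fintype α] [DecidableEq α] [Fintype β] [DecidableEq β] (ρ : Op α) (σ : Op β) :
    (tensor ρ σ).trace = ρ.trace * σ.trace := by
  rw [trace, trace, trace, Fintype.sum_mul_sum, ← Fintype.sum_prod_type']
  exact Fintype.sum_equiv (Equiv.sumArrowEquivProdArrow α β Bool) _ _ fun _ => rfl

lemma tensor_sum_left {S : Type*} (s : Finset S) (ρ : S → Op α) (σ : Op β) :
    tensor (∑ i ∈ s, ρ i) σ = ∑ i ∈ s, tensor (ρ i) σ := by
  ext u v
  simp only [tensor_apply, Matrix.sum_apply, Finset.sum_mul]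

lemma tensor_basisState [Fintype α] [DecidableEq α] [Fintype β] [DecidableEq β]
    (x : α → Bool) (y : β → Bool) :
    tensor (basisState x) (basisState y) = basisState (Sum.elim x y) := by
  ext u v
  have h : ∀ u : α ⊕ β → Bool, Sum.elim x y = u ↔ x = u ∘ Sum.inl ∧ y = u ∘ Sum.inr := by
    intro u
    constructor
    · rintro rfl; exact ⟨rfl, rfl⟩
    · rintro ⟨h1, h2⟩; rw [h1, h2, Sum.elim_comp_inl_inr]
  simp only [tensor_apply, basisState_apply, h]
  split_ifs <;> first | (exfalso; tauto) | simp

lemma keep_inl [Fintype α] [DecidableEq α] [Fintype β] [DecidableEq β] (ρ : Op (α ⊕ β))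
    (u v : α → Bool) :
    keep (Function.Embedding.inl : α ↪ α ⊕ β) ρ u v =
      ∑ z : β → Bool, ρ (Sum.elim u z) (Sum.elim v z) :=
  keep_eq_sum_equiv _ (Equiv.refl _) (fun _ => rfl) ρ u v

lemma keep_inl_tensor [Fintype α] [DecidableEq α] [Fintype β] [DecidableEq β] (ρ : Op α)
    (σ : Op β) : keep (Function.Embedding.inl : α ↪ α ⊕ β) (tensor ρ σ) = σ.trace • ρ := by
  ext u v
  rw [keep_inl]
  simp only [tensor_apply, Sum.elim_comp_inl, Sum.elim_comp_inr, ← Finset.mul_sum,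
    Matrix.smul_apply, smul_eq_mul]
  rw [mul_comm]
  rfl

lemma load_inl [Fintype α] [DecidableEq α] [Fintype β] [DecidableEq β] (ρ : Op α) :
    load (Function.Embedding.inl : α ↪ α ⊕ β) ρ = tensor ρ (basisState fun _ => false) := by
  ext u v
  have h : ∀ u : α ⊕ β → Bool, AgreeOff (Function.Embedding.inl : α ↪ α ⊕ β) u (fun _ => false) ↔
      (fun _ => false) = u ∘ Sum.inr := by
    intro u
    constructor
    · intro h
      funext i
      exact (h (.inr i) (by simp)).symm
    · rintro h (i | i) hi
      · exact absurd rfl (hi i)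
      · exact (congr_fun h i).symm
  simp only [load, of_apply, h, tensor_apply, basisState_apply, mul_ite, mul_one, mul_zero]
  rfl

lemma keep_basisState [Fintype α] [DecidableEq α] [Fintype ι] [DecidableEq ι] (e : α ↪ ι)
    (x : ι → Bool) : keep e (basisState x) = basisState (x ∘ e) := by
  ext u v
  rw [keep_apply, Finset.sum_eq_single x]
  · have h : x = Function.extend e v x ↔ x ∘ e = v := by
      rw [eq_extend_iff]
      exact ⟨fun h => h.1, fun h => ⟨h, fun _ _ => rfl⟩⟩
    simp only [basisState_apply, h]
    split_ifs <;> first | rfl | (exfalso; tauto)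
  · intro b _ hb
    rw [basisState_apply, if_neg (c := x = b ∧ _) (fun h => hb h.1.symm), ite_self]
  · simp

lemma keep_sumMap_tensor [Fintype α] [DecidableEq α] [Fintype β] [Fintype ι] [DecidableEq ι]
    (e : β ↪ ι) (τ : Op α) (ρ : Op ι) :
    keep ((Function.Embedding.refl α).sumMap e) (tensor τ ρ) = tensor τ (keep e ρ) := by
  obtain ⟨C, _, _, E, hE⟩ := exists_compl e
  ext u v
  rw [keep_eq_sum_equiv _ ((Equiv.sumAssoc α β C).trans ((Equiv.refl α).sumCongr E))
    (by rintro (b | b) <;> simp [hE])]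
  rw [tensor_apply, keep_eq_sum_equiv e E hE, Finset.mul_sum]
  refine Finset.sum_congr rfl fun z _ => ?_
  rw [tensor_apply]
  have h : ∀ u : α ⊕ β → Bool, Sum.elim u z ∘
      ((Equiv.sumAssoc α β C).trans ((Equiv.refl α).sumCongr E)).symm =
      Sum.elim (u ∘ Sum.inl) (Sum.elim (u ∘ Sum.inr) z ∘ E.symm) := by
    intro u
    funext i
    rcases i with i | i
    · simp
    · obtain ⟨j, rfl⟩ := E.surjective i
      rcases j with j | j <;> simp
  rw [h, h]
  rfl

lemma load_sumMap_tensor [Fintype α] [DecidableEq α] [Fintype β] [Fintype ι] [DecidableEq ι]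
    (e : β ↪ ι) (τ : Op α) (ρ : Op β) :
    load ((Function.Embedding.refl α).sumMap e) (tensor τ ρ) = tensor τ (load e ρ) := by
  ext u v
  have h : ∀ u : α ⊕ ι → Bool,
      AgreeOff ((Function.Embedding.refl α).sumMap e) u (fun _ => false) ↔
      AgreeOff e (u ∘ Sum.inr) (fun _ => false) := by
    intro u
    constructor
    · intro hu i hi
      refine hu (.inr i) ?_
      rintro (j | j)
      · simp
      · simpa using hi j
    · rintro hu (i | i) hi
      · exact absurd rfl (hi (.inl i))
      · exact hu i fun j hj => hi (.inr j) (by simp [hj])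
  simp only [load, of_apply, h, tensor_apply, mul_ite, mul_zero]
  rfl

/-- The linear version of `load`. -/
def loadₗ [Fintype α] [Fintype ι] [DecidableEq ι] (e : α ↪ ι) : Op α →ₗ[ℂ] Op ι where
  toFun := load e
  map_add' ρ σ := by
    ext u v
    simp only [load, of_apply, Matrix.add_apply]
    split_ifs <;> simp
  map_smul' c ρ := by
    ext u v
    simp only [load, of_apply, Matrix.smul_apply, smul_eq_mul, RingHom.id_apply, mul_ite, mul_zero]

/-- The linear version of `keep`. -/
def keepₗ [Fintype β] [Fintype ι] [DecidableEq ι] (e : β ↪ ι) : Op ι →ₗ[ℂ] Op β where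
  toFun := keep e
  map_add' ρ σ := by
    ext u v
    simp only [keep_apply, Matrix.add_apply, ← Finset.sum_add_distrib]
    refine Finset.sum_congr rfl fun a _ => ?_
    split_ifs <;> simp
  map_smul' c ρ := by
    ext u v
    simp only [keep_apply, Matrix.smul_apply, smul_eq_mul, RingHom.id_apply, Finset.mul_sum,
      mul_ite, mul_zero]

/-- Exchange the two registers. -/
lemma rename_sumComm (ρ : Op α) (σ : Op β) :
    rename (Equiv.sumComm α β) (tensor ρ σ) = tensor σ ρ := by
  ext u v
  exact mul_comm _ _

lemma keep_sumMap_refl_tensor [Fintype α] [DecidableEq α] [Fintype β] [Fintype ι] [DecidableEq ι]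
    (e : β ↪ ι) (ρ : Op ι) (τ : Op α) :
    keep (e.sumMap (Function.Embedding.refl α)) (tensor ρ τ) = tensor (keep e ρ) τ := by
  classical
  have h : ∀ {α β : Type} [Fintype α] [DecidableEq α] [Fintype β] [DecidableEq β]
      (X : Op (α ⊕ β)), rename (Equiv.sumComm α β) X = keep (Equiv.sumComm β α).toEmbedding X :=
    fun X => (keep_equiv (Equiv.sumComm _ _) X).symm
  rw [← rename_sumComm, ← rename_sumComm τ, ← keep_sumMap_tensor, h, h, ← keep_trans, ← keep_trans]
  congr 1
  ext i
  rcases i with i | i <;> rfl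

lemma keep_sumMap_sumMap_tensor [Fintype α] [DecidableEq α] [Fintype γ] [DecidableEq γ]
    [Fintype β] [DecidableEq β] [Fintype ι] [DecidableEq ι] (e : β ↪ ι) (f : α ↪ γ)
    (ρ : Op ι) (τ : Op γ) :
    keep (e.sumMap f) (tensor ρ τ) = tensor (keep e ρ) (keep f τ) := by
  rw [← keep_sumMap_refl_tensor, ← keep_sumMap_tensor, ← keep_trans]
  congr 1
  ext i
  rcases i with i | i <;> rfl

lemma rename_sumAssoc (ρ : Op α) (σ : Op β) (τ : Op γ) :
    rename (Equiv.sumAssoc α β γ) (tensor (tensor ρ σ) τ) = tensor ρ (tensor σ τ) := by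
  ext u v
  exact mul_assoc _ _ _

lemma rename_sumAssoc_symm (ρ : Op α) (σ : Op β) (τ : Op γ) :
    rename (Equiv.sumAssoc α β γ).symm (tensor ρ (tensor σ τ)) = tensor (tensor ρ σ) τ := by
  ext u v
  exact (mul_assoc _ _ _).symm

lemma rename_sumCongr (E : α ≃ γ) (E' : β ≃ δ) (ρ : Op α) (σ : Op β) :
    rename (E.sumCongr E') (tensor ρ σ) = tensor (rename E ρ) (rename E' σ) := by
  ext u v
  rfl

lemma rename_trans (E : α ≃ β) (E' : β ≃ γ) (ρ : Op α) :
    rename (E.trans E') ρ = rename E' (rename E ρ) := rfl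

@[simp] lemma rename_refl (ρ : Op α) : rename (Equiv.refl α) ρ = ρ := rfl

lemma trace_rename [Fintype α] [DecidableEq α] [Fintype β] [DecidableEq β] (E : α ≃ β) (ρ : Op α) :
    (rename E ρ).trace = ρ.trace :=
  Fintype.sum_equiv (E.symm.arrowCongr (Equiv.refl Bool)) _ _ fun _ => rfl

end Tensor

/-! ### Building circuits -/

namespace Circuit

variable {Ω : Type} {I : Type → Type} (S : Sem Ω I)
variable {α β γ δ : Type} [Fintype α] [Fintype β] [Fintype γ] [Fintype δ]

/-- The channel computed by a circuit. -/
def eval (o : Ω) (C : Circuit I α β) : Op α →ₗ[ℂ] Op β :=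
  keepₗ C.out ∘ₗ S.fold o C.ops ∘ₗ loadₗ C.inp

lemma eval_apply (o : Ω) (C : Circuit I α β) (ρ : Op α) :
    C.eval S o ρ = keep C.out (S.fold o C.ops (load C.inp ρ)) := rfl

lemma run_eq_eval (C : Circuit Gate α β) (ρ : Op α) : C.run ρ = C.eval gateSem () ρ := by
  rw [eval_apply, ← Sem.foldl_eq_fold]
  rfl

lemma runWith_eq_eval {d n : ℕ} (C : Circuit (OracleGate d n) α β)
    (O : (Fin d → Bool) → Op (Fin n)) (ρ : Op α) : C.runWith O ρ = C.eval (oracleSem d n) O ρ := by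
  rw [eval_apply, ← Sem.foldl_eq_fold]
  rfl

/-- A circuit on arbitrarily labelled wires. -/
def ofWires (κ : Type) [Fintype κ] (inp : α ↪ κ) (ops : List (I κ)) (out : β ↪ κ) :
    Circuit I α β where
  width := Fintype.card κ
  inp := inp.trans (Fintype.equivFin κ).toEmbedding
  ops := ops.map (S.map (Fintype.equivFin κ).toEmbedding)
  out := out.trans (Fintype.equivFin κ).toEmbedding

lemma eval_ofWires (o : Ω) (κ : Type) [Fintype κ] [DecidableEq κ] (inp : α ↪ κ) (ops : List (I κ))
    (out : β ↪ κ) (ρ : Op α) :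
    (ofWires S κ inp ops out).eval S o ρ = keep out (S.fold o ops (load inp ρ)) := by
  change keep (out.trans (Fintype.equivFin κ).toEmbedding)
    (S.fold o (ops.map (S.map (Fintype.equivFin κ).toEmbedding))
      (load (inp.trans (Fintype.equivFin κ).toEmbedding) ρ)) = _
  rw [load_trans, keep_trans, S.fold_load, keep_load]

omit [Fintype α] [Fintype β] in
lemma size_ofWires (κ : Type) [Fintype κ] (inp : α ↪ κ) (ops : List (I κ)) (out : β ↪ κ) :
    (ofWires S κ inp ops out).size = ops.length + 2 * Fintype.card κ := by
  simp [size, ofWires]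
  ring

/-- The circuit without gates that renames and discards wires. -/
def discard (out : β ↪ α) : Circuit I α β :=
  ofWires S α (Function.Embedding.refl α) [] out

lemma eval_discard [DecidableEq α] (o : Ω) (out : β ↪ α) (ρ : Op α) :
    (discard S out).eval S o ρ = keep out ρ := by
  rw [discard, eval_ofWires, Sem.fold_nil, LinearMap.id_apply]
  congr 1
  exact load_equiv (Equiv.refl α) ρ

omit [Fintype β] in
lemma size_discard (out : β ↪ α) : (discard S out).size = 2 * Fintype.card α := by
  simp [discard, size_ofWires]

/-- Rename and initialise the input wires. -/
def withInput (inp : γ ↪ α) (C : Circuit I α β) : Circuit I γ β :=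
  { C with inp := inp.trans C.inp }

lemma eval_withInput [DecidableEq α] (o : Ω) (inp : γ ↪ α) (C : Circuit I α β) (ρ : Op γ) :
    (C.withInput inp).eval S o ρ = C.eval S o (load inp ρ) := by
  simp only [eval_apply, withInput, load_trans]

omit [Fintype α] [Fintype β] [Fintype γ] in
@[simp] lemma size_withInput (inp : γ ↪ α) (C : Circuit I α β) :
    (C.withInput inp).size = C.size := rfl

/-- Rename and discard output wires. -/
def withOutput (out : γ ↪ β) (C : Circuit I α β) : Circuit I α γ :=
  { C with out := out.trans C.out }

lemma eval_withOutput [DecidableEq β] (o : Ω) (out : γ ↪ β) (C : Circuit I α β) (ρ : Op α) :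
    (C.withOutput out).eval S o ρ = keep out (C.eval S o ρ) := by
  simp only [eval_apply, withOutput, keep_trans]

omit [Fintype α] [Fintype β] [Fintype γ] in
@[simp] lemma size_withOutput (out : γ ↪ β) (C : Circuit I α β) :
    (C.withOutput out).size = C.size := rfl

/-- Run `C` on the right register and leave the left one alone. -/
def onRight (γ : Type) [Fintype γ] (C : Circuit I α β) : Circuit I (γ ⊕ α) (γ ⊕ β) :=
  ofWires S (γ ⊕ Fin C.width) ((Function.Embedding.refl γ).sumMap C.inp)
    (C.ops.map (S.map Function.Embedding.inr)) ((Function.Embedding.refl γ).sumMap C.out)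

lemma eval_onRight [DecidableEq γ] (o : Ω) (C : Circuit I α β) (τ : Op γ) (ρ : Op α) :
    (C.onRight S γ).eval S o (tensor τ ρ) = tensor τ (C.eval S o ρ) := by
  rw [onRight, eval_ofWires, load_sumMap_tensor, S.fold_tensor, keep_sumMap_tensor, eval_apply]

omit [Fintype α] [Fintype β] in
lemma size_onRight (C : Circuit I α β) :
    (C.onRight S γ).size = C.size + 2 * Fintype.card γ := by
  rw [onRight, size_ofWires]
  simp [size]
  ring

/-- Run `C` on the left register and leave the right one alone. -/
def onLeft (γ : Type) [Fintype γ] (C : Circuit I α β) : Circuit I (α ⊕ γ) (β ⊕ γ) :=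
  ((C.onRight S γ).withInput (Equiv.sumComm α γ).toEmbedding).withOutput
    (Equiv.sumComm β γ).toEmbedding

lemma eval_onLeft [DecidableEq α] [DecidableEq β] [DecidableEq γ] (o : Ω) (C : Circuit I α β)
    (ρ : Op α) (τ : Op γ) :
    (C.onLeft S γ).eval S o (tensor ρ τ) = tensor (C.eval S o ρ) τ := by
  rw [onLeft, eval_withOutput, eval_withInput, load_equiv, rename_sumComm, eval_onRight, keep_equiv]
  exact rename_sumComm _ _

omit [Fintype α] [Fintype β] in
lemma size_onLeft (C : Circuit I α β) :
    (C.onLeft S γ).size = C.size + 2 * Fintype.card γ :=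
  size_onRight S C

/-- The complement of the input wires. -/
abbrev Ancilla (C : Circuit I α β) : Type := {i : Fin C.width // i ∉ Set.range C.inp}

open Classical in
/-- The wires of a circuit are its inputs and its ancillas. -/
def wiresEquiv (C : Circuit I α β) : α ⊕ C.Ancilla ≃ Fin C.width :=
  ((Equiv.ofInjective C.inp C.inp.injective).sumCongr (Equiv.refl _)).trans
    (Equiv.Set.sumCompl (Set.range C.inp))

omit [Fintype β] in
lemma wiresEquiv_inl (C : Circuit I α β) (a : α) : C.wiresEquiv (.inl a) = C.inp a := rfl

/-- The wires of the second circuit inside the composition. -/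
def compWires (C : Circuit I α β) (D : Circuit I β γ) : Fin D.width ↪ Fin C.width ⊕ D.Ancilla :=
  D.wiresEquiv.symm.toEmbedding.trans (C.out.sumMap (Function.Embedding.refl _))

open Classical in
/-- The composition of two circuits. -/
def comp (C : Circuit I α β) (D : Circuit I β γ) : Circuit I α γ :=
  ofWires S (Fin C.width ⊕ D.Ancilla) (C.inp.trans Function.Embedding.inl)
    (C.ops.map (S.map Function.Embedding.inl) ++ D.ops.map (S.map (compWires C D)))
    (D.out.trans (compWires C D))

/-- In the composite, the wires dropped by `C` are traced out only at the end and the ancillas of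
`D` are present from the start. Neither matters: the instructions of `D` commute with the partial
trace, and those of `C` commute with the initialisation. -/
lemma eval_comp [DecidableEq β] (o : Ω) (C : Circuit I α β) (D : Circuit I β γ) (ρ : Op α) :
    (comp S C D).eval S o ρ = D.eval S o (C.eval S o ρ) := by
  classical
  rw [comp, eval_ofWires, S.fold_append, load_trans, S.fold_load, keep_trans, S.fold_keep,
    eval_apply, eval_apply]
  generalize S.fold o C.ops (load C.inp ρ) = σ
  congr 2
  rw [load_inl, compWires, keep_trans, keep_equiv]
  rw [keep_sumMap_refl_tensor]
  have h2 : D.inp = Function.Embedding.inl.trans D.wiresEquiv.toEmbedding := by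
    ext a
    simp [wiresEquiv_inl]
  have h3 : load D.inp (keep C.out σ) =
      load D.wiresEquiv.toEmbedding (load Function.Embedding.inl (keep C.out σ)) := by
    rw [← load_trans]
    congr 1
  rw [h3, load_inl, load_equiv]
  rfl

omit [Fintype α] [Fintype γ] in
-- The output wires of `C` serve as input wires of `D`, so only the ancillas of `D` are new and
-- sizes add up without overhead.
lemma size_comp (C : Circuit I α β) (D : Circuit I β γ) :
    (comp S C D).size ≤ C.size + D.size := by
  classical
  rw [comp, size_ofWires]
  have : Fintype.card D.Ancilla ≤ D.width :=
    (Fintype.card_subtype_le _).trans_eq (Fintype.card_fin _)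
  rw [Fintype.card_sum, Fintype.card_fin]
  simp only [size, List.length_append, List.length_map]
  omega

/-- Turn a circuit of gates into a circuit over another instruction set. -/
def lift {J : Type → Type} (f : ∀ {ι : Type}, I ι → J ι) (C : Circuit I α β) : Circuit J α β where
  width := C.width
  inp := C.inp
  ops := C.ops.map f
  out := C.out

lemma eval_lift_gate {d n : ℕ} (O : (Fin d → Bool) → Op (Fin n)) (C : Circuit Gate α β) (ρ : Op α) :
    (C.lift (J := OracleGate d n) OracleGate.gate).eval (oracleSem d n) O ρ =
      C.eval gateSem () ρ := by
  change keep C.out ((oracleSem d n).fold O (C.ops.map OracleGate.gate) (load C.inp ρ)) =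
    keep C.out (gateSem.fold () C.ops (load C.inp ρ))
  generalize load C.inp ρ = σ
  congr 1
  induction C.ops generalizing σ with
  | nil => rfl
  | cons g l ih => exact ih _

omit [Fintype α] [Fintype β] in
@[simp] lemma size_lift {J : Type → Type} (f : ∀ {ι : Type}, I ι → J ι) (C : Circuit I α β) :
    (C.lift f).size = C.size := by
  simp [size, lift]

omit [Fintype α] in
lemma card_out_le (C : Circuit I α β) : Fintype.card β ≤ C.size := by
  have := Fintype.card_le_of_embedding C.out
  rw [Fintype.card_fin] at this
  simp only [size]
  omega

omit [Fintype β] in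
lemma card_inp_le (C : Circuit I α β) : Fintype.card α ≤ C.size := by
  have := Fintype.card_le_of_embedding C.inp
  rw [Fintype.card_fin] at this
  simp only [size]
  omega

end Circuit

/-! ### Queries -/

section Query

variable {ι ν χ : Type} [Fintype ι] [DecidableEq ι] [Fintype ν] [DecidableEq ν]

/-- The unnormalised state after measuring the register `x` with outcome `s`. -/
def proj (x : χ ↪ ι) [Fintype χ] (s : χ → Bool) : Op ι →ₗ[ℂ] Op ι where
  toFun ρ := Matrix.of fun u v => if u ∘ x = s ∧ v ∘ x = s then ρ u v else 0
  map_add' ρ σ := by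
    ext u v
    simp only [of_apply, Matrix.add_apply]
    split_ifs <;> simp
  map_smul' c ρ := by
    ext u v
    simp only [of_apply, Matrix.smul_apply, smul_eq_mul, RingHom.id_apply, mul_ite, mul_zero]

omit [Fintype ι] [DecidableEq ι] in
lemma proj_apply (x : χ ↪ ι) [Fintype χ] (s : χ → Bool) (ρ : Op ι) (u v : ι → Bool) :
    proj x s ρ u v = if u ∘ x = s ∧ v ∘ x = s then ρ u v else 0 := rfl

/-- Replace the register `y` by a fresh register in the state `τ`. -/
def replace (y : ν ↪ ι) (τ : Op ν) : Op ι →ₗ[ℂ] Op ι where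
  toFun ρ := Matrix.of fun u v => τ (u ∘ y) (v ∘ y) *
    ∑ z : ν → Bool, ρ (Function.extend y z u) (Function.extend y z v)
  map_add' ρ σ := by
    ext u v
    simp only [of_apply, Matrix.add_apply, Finset.sum_add_distrib, mul_add]
  map_smul' c ρ := by
    ext u v
    simp only [of_apply, Matrix.smul_apply, smul_eq_mul, RingHom.id_apply, ← Finset.mul_sum]
    ring

omit [Fintype ι] [DecidableEq ι] in
lemma replace_apply (y : ν ↪ ι) (τ : Op ν) (ρ : Op ι) (u v : ι → Bool) :
    replace y τ ρ u v = τ (u ∘ y) (v ∘ y) *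
      ∑ z : ν → Bool, ρ (Function.extend y z u) (Function.extend y z v) := rfl

omit [Fintype ι] [DecidableEq ι] in
-- The second replacement traces out what the first one inserted, which leaves the factor
-- `τ'.trace`.
lemma replace_replace (y : ν ↪ ι) (τ τ' : Op ν) (h : τ'.trace = 1) (ρ : Op ι) :
    replace y τ (replace y τ' ρ) = replace y τ ρ := by
  ext u v
  have h2 : ∀ (z z' : ν → Bool) (u : ι → Bool),
      Function.extend y z' (Function.extend y z u) = Function.extend y z' u :=
    fun z z' u => extend_congr y z' (agreeOff_extend y z u)
  simp only [replace_apply, extend_comp_emb, h2, ← Finset.sum_mul]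
  rw [show ∑ z : ν → Bool, τ' z z = 1 from h, one_mul]

/-- One term for each measurement outcome. Disjointness of the registers enters because the
projection must see the same query bits after `y` has been overwritten. -/
lemma answerQuery_eq_sum {d n : ℕ} (O : (Fin d → Bool) → Op (Fin n)) (x : Fin d ↪ ι)
    (y : Fin n ↪ ι) (hxy : ∀ i j, x i ≠ y j) (ρ : Op ι) :
    answerQuery O x y ρ = ∑ s, replace y (O s) (proj x s ρ) := by
  ext u v
  have hx : ∀ (z : Fin n → Bool) (u : ι → Bool), Function.extend y z u ∘ x = u ∘ x := by
    intro z u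
    funext i
    exact extend_off y z u fun j => (hxy i j).symm
  rw [answerQuery_apply, Matrix.sum_apply]
  simp only [replace_apply, proj_apply, hx]
  rw [Finset.sum_eq_single (u ∘ x)]
  · by_cases h : u ∘ x = v ∘ x
    · simp only [h, and_self, if_true]
    · simp [h, Ne.symm h]
  · intro s _ hs
    simp [Ne.symm hs]
  · simp

/-- Exchange the register `y` of the left part with the right part. -/
def swapFun (y : ν ↪ ι) : ι ⊕ ν → ι ⊕ ν :=
  Sum.elim (Function.extend y Sum.inr Sum.inl) fun j => Sum.inl (y j)

omit [Fintype ι] [DecidableEq ι] [Fintype ν] [DecidableEq ν] in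
lemma swapFun_involutive (y : ν ↪ ι) : Function.Involutive (swapFun y) := by
  rintro (i | j)
  · by_cases h : ∃ j, y j = i
    · obtain ⟨j, rfl⟩ := h
      simp [swapFun, y.injective.extend_apply]
    · simp [swapFun, Function.extend_apply' _ _ _ h]
  · simp [swapFun, y.injective.extend_apply]

/-- Exchange the register `y` of the left part with the right part. -/
def swapWires (y : ν ↪ ι) : ι ⊕ ν ≃ ι ⊕ ν := (swapFun_involutive y).toPerm

omit [Fintype ι] [DecidableEq ι] [Fintype ν] [DecidableEq ν] in
lemma elim_comp_swapFun (y : ν ↪ ι) (u : ι → Bool) (z : ν → Bool) :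
    Sum.elim u z ∘ swapFun y = Sum.elim (Function.extend y z u) (u ∘ y) := by
  funext i
  rcases i with i | j
  · by_cases h : ∃ j, y j = i
    · obtain ⟨j, rfl⟩ := h
      simp [swapFun, y.injective.extend_apply]
    · simp [swapFun, Function.extend_apply' _ _ _ h]
  · simp [swapFun]

/-- The left part, with the register `y` taken from the right part. -/
def answerWires (y : ν ↪ ι) : ι ↪ ι ⊕ ν :=
  Function.Embedding.inl.trans (swapWires y).toEmbedding

/-- Exchanging `y` with the new register and discarding the latter leaves `τ` in `y` and traces out
the old content of `y`. -/
lemma keep_answerWires (y : ν ↪ ι) (ρ : Op ι) (τ : Op ν) :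
    keep (answerWires y) (tensor ρ τ) = replace y τ ρ := by
  ext u v
  rw [keep_eq_sum_equiv (answerWires y) (swapWires y) (fun _ => rfl)]
  have h : ∀ (u : ι → Bool) (z : ν → Bool), Sum.elim u z ∘ (swapWires y).symm =
    Sum.elim (Function.extend y z u) (u ∘ y) := elim_comp_swapFun y
  simp only [h, tensor_apply, Sum.elim_comp_inl, Sum.elim_comp_inr, ← Finset.sum_mul]
  rw [mul_comm]
  rfl

end Query

/-! ### Answering queries with a generator applied to the answers of another oracle -/

section Simulation

variable {d m n w : ℕ}

/-- Query the oracle with a fresh answer register. -/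
def queryFresh (m : ℕ) (x : Fin d ↪ Fin w) :
    Circuit (OracleGate d m) (Fin w) (Fin w ⊕ Fin m) :=
  Circuit.ofWires (oracleSem d m) (Fin w ⊕ Fin m) Function.Embedding.inl
    [.query (x.trans Function.Embedding.inl) Function.Embedding.inr (by simp)]
    (Function.Embedding.refl _)

lemma eval_queryFresh (x : Fin d ↪ Fin w) (O : (Fin d → Bool) → Op (Fin m)) (ρ : Op (Fin w)) :
    (queryFresh m x).eval (oracleSem d m) O ρ = ∑ s, tensor (proj x s ρ) (O s) := by
  rw [queryFresh, Circuit.eval_ofWires, load_inl]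
  have hk : ∀ X : Op (Fin w ⊕ Fin m), keep (Function.Embedding.refl (Fin w ⊕ Fin m)) X = X :=
    fun X => keep_equiv (Equiv.refl _) X
  rw [hk]
  change answerQuery O (x.trans Function.Embedding.inl) Function.Embedding.inr
    (tensor ρ (basisState fun _ => false)) = _
  ext u v
  rw [answerQuery_apply, Matrix.sum_apply]
  simp only [extend_inr, tensor_apply, proj_apply, Sum.elim_comp_inl, Sum.elim_comp_inr]
  rw [← Finset.mul_sum, show ∑ z : Fin m → Bool, basisState (fun _ => false) z z = (1 : ℂ) from
    trace_basisState _, mul_one]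
  rw [Finset.sum_eq_single (u ∘ x.trans Function.Embedding.inl)]
  · by_cases h : u ∘ x.trans Function.Embedding.inl = v ∘ x.trans Function.Embedding.inl
    · rw [if_pos h, if_pos ⟨rfl, h.symm⟩, mul_comm]
      rfl
    · rw [if_neg h, if_neg (fun h' => h h'.2.symm), zero_mul]
  · intro s _ hs
    rw [if_neg (fun h' => hs h'.1.symm), zero_mul]
  · simp

/-- Simulate an instruction: a query is answered by running `G` on the answer of the oracle. -/
def simulate (G : Circuit Gate (Fin m) (Fin n)) :
    OracleGate d n (Fin w) → Circuit (OracleGate d m) (Fin w) (Fin w)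
  | .gate g => Circuit.ofWires (oracleSem d m) (Fin w) (Function.Embedding.refl _) [.gate g]
      (Function.Embedding.refl _)
  | .query x y _ => Circuit.comp (oracleSem d m) (queryFresh m x)
      (Circuit.comp (oracleSem d m)
        ((G.lift OracleGate.gate).onRight (oracleSem d m) (Fin w))
        (Circuit.discard (oracleSem d m) (answerWires y)))

/-- The oracle returns `m` bits while `y` has `n` wires, so the bits go to a fresh register. In the
branch with outcome `s`, running `G` there produces the state that is finally exchanged with `y`. -/
lemma eval_simulate (G : Circuit Gate (Fin m) (Fin n)) (O : (Fin d → Bool) → Op (Fin m))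
    (g : OracleGate d n (Fin w)) (ρ : Op (Fin w)) :
    (simulate G g).eval (oracleSem d m) O ρ = g.apply (fun s => G.run (O s)) ρ := by
  cases g with
  | gate g =>
    rw [simulate, Circuit.eval_ofWires]
    have hk : ∀ X : Op (Fin w), keep (Function.Embedding.refl (Fin w)) X = X :=
      fun X => keep_equiv (Equiv.refl _) X
    have hl : ∀ X : Op (Fin w), load (Function.Embedding.refl (Fin w)) X = X :=
      fun X => load_equiv (Equiv.refl _) X
    rw [hk, hl]
    rfl
  | query x y hxy =>
    rw [simulate, Circuit.eval_comp, eval_queryFresh, map_sum]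
    simp only [Circuit.eval_comp, Circuit.eval_onRight, Circuit.eval_discard, keep_answerWires,
      Circuit.eval_lift_gate, ← Circuit.run_eq_eval]
    exact (answerQuery_eq_sum _ x y hxy ρ).symm

lemma size_simulate (G : Circuit Gate (Fin m) (Fin n)) (g : OracleGate d n (Fin w)) :
    (simulate G g).size ≤ 1 + 6 * w + 5 * G.size := by
  cases g with
  | gate g =>
    rw [simulate, Circuit.size_ofWires]
    simp only [List.length_singleton, Fintype.card_fin]
    omega
  | query x y hxy =>
    have h1 := G.card_inp_le
    have h2 := G.card_out_le
    rw [Fintype.card_fin] at h1 h2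
    refine (Circuit.size_comp _ _ _).trans ((Nat.add_le_add_left (Circuit.size_comp _ _ _) _).trans ?_)
    rw [queryFresh, Circuit.size_ofWires, Circuit.size_onRight, Circuit.size_discard]
    simp only [List.length_singleton, Fintype.card_sum, Fintype.card_fin, Circuit.size_lift]
    omega

/-- Simulate a list of instructions. -/
def simulateList (G : Circuit Gate (Fin m) (Fin n)) :
    List (OracleGate d n (Fin w)) → Circuit (OracleGate d m) (Fin w) (Fin w)
  | [] => Circuit.discard (oracleSem d m) (Function.Embedding.refl _)
  | g :: l => Circuit.comp (oracleSem d m) (simulate G g) (simulateList G l)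

lemma eval_simulateList (G : Circuit Gate (Fin m) (Fin n)) (O : (Fin d → Bool) → Op (Fin m))
    (l : List (OracleGate d n (Fin w))) (ρ : Op (Fin w)) :
    (simulateList G l).eval (oracleSem d m) O ρ =
      (oracleSem d n).fold (fun s => G.run (O s)) l ρ := by
  induction l generalizing ρ with
  | nil =>
    rw [simulateList, Circuit.eval_discard]
    exact keep_equiv (Equiv.refl _) _
  | cons g l ih =>
    rw [simulateList, Circuit.eval_comp, ih, eval_simulate]
    rfl

lemma size_simulateList (G : Circuit Gate (Fin m) (Fin n)) (l : List (OracleGate d n (Fin w))) :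
    (simulateList G l).size ≤ l.length * (1 + 6 * w + 5 * G.size) + 2 * w := by
  induction l with
  | nil => simp [simulateList, Circuit.size_discard]
  | cons g l ih =>
    refine (Circuit.size_comp _ _ _).trans ((Nat.add_le_add (size_simulate G g) ih).trans ?_)
    rw [List.length_cons]
    ring_nf
    rfl

/-- Turn an adversary that queries states into an adversary that queries a function. -/
def simulateCircuit {a : ℕ} (G : Circuit Gate (Fin m) (Fin n))
    (A : Circuit (OracleGate d n) (Fin a) (Fin 1)) : Circuit (OracleGate d m) (Fin a) (Fin 1) :=
  ((simulateList G A.ops).withInput A.inp).withOutput A.out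

lemma runWith_simulateCircuit {a : ℕ} (G : Circuit Gate (Fin m) (Fin n))
    (A : Circuit (OracleGate d n) (Fin a) (Fin 1)) (O : (Fin d → Bool) → Op (Fin m))
    (ρ : Op (Fin a)) :
    (simulateCircuit G A).runWith O ρ = A.runWith (fun s => G.run (O s)) ρ := by
  rw [Circuit.runWith_eq_eval, Circuit.runWith_eq_eval, simulateCircuit, Circuit.eval_withOutput,
    Circuit.eval_withInput, eval_simulateList, Circuit.eval_apply]

lemma size_simulateCircuit {a : ℕ} (G : Circuit Gate (Fin m) (Fin n))
    (A : Circuit (OracleGate d n) (Fin a) (Fin 1)) :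
    (simulateCircuit G A).size ≤ A.size * (1 + 6 * A.size + 5 * G.size) + 2 * A.size := by
  have h1 : A.ops.length ≤ A.size := by simp only [Circuit.size]; omega
  have h2 : A.width ≤ A.size := by simp only [Circuit.size]; omega
  refine (size_simulateList G A.ops).trans ?_
  gcongr

end Simulation

/-! ### Classical gates -/

section ClassicalGates

variable {ι β : Type} [Fintype ι] [DecidableEq ι] [Fintype β] [DecidableEq β]

/-- An involution is its own inverse, so conjugation is a substitution by the same map in rows and
columns. -/
lemma basisMap_conj (F : (ι → Bool) → ι → Bool) (hF : Function.Involutive F) (ρ : Op ι) :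
    basisMap F * ρ * (basisMap F)ᴴ = ρ.submatrix F F := by
  ext u v
  have h : ∀ u w : ι → Bool, u = F w ↔ w = F u := by
    intro u w
    constructor
    · rintro rfl; exact (hF w).symm
    · rintro rfl; exact (hF u).symm
  simp only [Matrix.mul_apply, conjTranspose_apply, basisMap, of_apply, submatrix_apply, h u, h v]
  simp

lemma Gate.apply_not (i : ι) (ρ : Op ι) : (Gate.not i).apply ρ =
    ρ.submatrix (fun v => Function.update v i (!v i)) (fun v => Function.update v i (!v i)) :=
  basisMap_conj _ (fun v => by simp) ρ

lemma Gate.apply_cnot (c t : ι) (h : c ≠ t) (ρ : Op ι) : (Gate.cnot c t h).apply ρ =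
    ρ.submatrix (fun v => Function.update v t (xor (v t) (v c)))
      (fun v => Function.update v t (xor (v t) (v c))) :=
  basisMap_conj _ (fun v => by simp [Function.update_of_ne h]) ρ

lemma Gate.apply_toffoli (a b t : ι) (hab : a ≠ b) (hat : a ≠ t) (hbt : b ≠ t) (ρ : Op ι) :
    (Gate.toffoli a b t hab hat hbt).apply ρ =
      ρ.submatrix (fun v => Function.update v t (xor (v t) (v a && v b)))
        (fun v => Function.update v t (xor (v t) (v a && v b))) :=
  basisMap_conj _ (fun v => by simp [Function.update_of_ne hat, Function.update_of_ne hbt]) ρ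

lemma basisState_submatrix (F : (ι → Bool) → ι → Bool) (x y : ι → Bool)
    (h : ∀ u, x = F u ↔ y = u) : (basisState x).submatrix F F = basisState y := by
  ext u v
  simp only [submatrix_apply, basisState_apply, h]

lemma keep_refl (ρ : Op ι) : keep (Function.Embedding.refl ι) ρ = ρ :=
  keep_equiv (Equiv.refl _) ρ

lemma load_refl (ρ : Op ι) : load (Function.Embedding.refl ι) ρ = ρ :=
  load_equiv (Equiv.refl _) ρ

/-- The gates that add the wires `e j` to the wires `inr j`, for the `j` in a list. -/
def copyOps (e : β → ι) (l : List β) : List (Gate (ι ⊕ β)) :=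
  l.map fun j => .cnot (Sum.inl (e j)) (Sum.inr j) (by simp)

/-- The effect of `copyOps` on bit strings. -/
def copyFun (e : β → ι) (l : List β) (v : ι ⊕ β → Bool) : ι ⊕ β → Bool :=
  Sum.elim (v ∘ Sum.inl) fun j => xor (v (.inr j)) (decide (j ∈ l) && v (.inl (e j)))

/-- Without repetitions in `l`, every target wire is toggled once, and the sources, being left
wires, never change. -/
lemma fold_copyOps (e : β → ι) (l : List β) (hl : l.Nodup) (ρ : Op (ι ⊕ β)) :
    gateSem.fold () (copyOps e l) ρ = ρ.submatrix (copyFun e l) (copyFun e l) := by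
  induction l generalizing ρ with
  | nil =>
    have : copyFun e ([] : List β) = id := by
      funext v i
      rcases i with i | i <;> simp [copyFun]
    rw [this]
    rfl
  | cons j l ih =>
    rw [List.nodup_cons] at hl
    have h : copyFun e (j :: l) = (fun v : ι ⊕ β → Bool =>
        Function.update v (.inr j) (xor (v (.inr j)) (v (.inl (e j))))) ∘ copyFun e l := by
      funext v i
      rcases i with i | i
      · simp [copyFun]
      · by_cases hi : i = j
        · subst hi
          simp [copyFun, hl.1]
        · simp [copyFun, hi]
    rw [copyOps, List.map_cons, Sem.fold_cons]
    change gateSem.fold () (copyOps e l) (Gate.apply _ ρ) = _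
    rw [ih hl.2, Gate.apply_cnot, submatrix_submatrix, ← h]

/-- Copy the wires `e j` in the computational basis. -/
def copyCircuit (e : β → ι) : Circuit Gate ι (ι ⊕ β) :=
  Circuit.ofWires gateSem (ι ⊕ β) Function.Embedding.inl (copyOps e Finset.univ.toList)
    (Function.Embedding.refl _)

lemma eval_copyCircuit (e : β → ι) (ρ : Op ι) (u v : ι ⊕ β → Bool) :
    (copyCircuit e).eval gateSem () ρ u v =
      if u ∘ Sum.inr = u ∘ Sum.inl ∘ e ∧ v ∘ Sum.inr = v ∘ Sum.inl ∘ e then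
        ρ (u ∘ Sum.inl) (v ∘ Sum.inl) else 0 := by
  rw [copyCircuit, Circuit.eval_ofWires, keep_refl, fold_copyOps _ _ (Finset.nodup_toList _),
    load_inl]
  have h : ∀ u : ι ⊕ β → Bool, (fun _ => false) = copyFun e Finset.univ.toList u ∘ Sum.inr ↔
      u ∘ Sum.inr = u ∘ Sum.inl ∘ e := by
    intro u
    rw [funext_iff, funext_iff]
    refine forall_congr' fun j => ?_
    simp [copyFun]
  simp only [submatrix_apply, tensor_apply, basisState_apply, h, mul_ite, mul_one, mul_zero]
  rfl

lemma eval_copyCircuit_basisState (e : β → ι) (x : ι → Bool) :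
    (copyCircuit e).eval gateSem () (basisState x) = basisState (Sum.elim x (x ∘ e)) := by
  ext u v
  have h : ∀ u : ι ⊕ β → Bool, Sum.elim x (x ∘ e) = u ↔
      x = u ∘ Sum.inl ∧ u ∘ Sum.inr = u ∘ Sum.inl ∘ e := by
    intro u
    constructor
    · rintro rfl; exact ⟨rfl, rfl⟩
    · rintro ⟨rfl, h⟩
      rw [Function.comp_assoc, ← h, Sum.elim_comp_inl_inr]
  rw [eval_copyCircuit]
  simp only [basisState_apply, h]
  split_ifs <;> first | rfl | (exfalso; tauto)

omit [DecidableEq ι] [DecidableEq β] in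
lemma size_copyCircuit (e : β → ι) :
    (copyCircuit e).size = 3 * Fintype.card β + 2 * Fintype.card ι := by
  rw [copyCircuit, Circuit.size_ofWires]
  simp [copyOps]
  ring

/-- Compute a Toffoli gate with arbitrary source wires on a new wire. -/
def freshToffoli (p : Fin 3 → ι) : Circuit Gate ι (ι ⊕ Unit) :=
  Circuit.comp gateSem (copyCircuit p)
    (Circuit.ofWires gateSem (ι ⊕ Fin 3) (Function.Embedding.refl _)
      [.toffoli (.inr 0) (.inr 1) (.inr 2) (by simp) (by simp) (by simp)]
      ((Function.Embedding.refl ι).sumMap ⟨fun _ => (2 : Fin 3), fun _ _ _ => rfl⟩))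

/-- The three sources are first copied to new wires. This allows coincidences among the values of
`p`, which a Toffoli gate itself forbids, and leaves the old wires intact. -/
lemma eval_freshToffoli (p : Fin 3 → ι) (x : ι → Bool) :
    (freshToffoli p).eval gateSem () (basisState x) =
      basisState (Sum.elim x fun _ => xor (x (p 0) && x (p 1)) (x (p 2))) := by
  rw [freshToffoli, Circuit.eval_comp, eval_copyCircuit_basisState, Circuit.eval_ofWires, load_refl]
  change keep _ (Gate.apply _ _) = _
  rw [Gate.apply_toffoli, basisState_submatrix _ _
    (Function.update (Sum.elim x (x ∘ p)) (.inr 2) (xor (x (p 2)) (x (p 0) && x (p 1)))),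
    keep_basisState]
  · congr 1
    funext i
    rcases i with i | i
    · exact Function.update_of_ne (by simp) _ _
    · exact (Function.update_self _ _ _).trans (Bool.xor_comm _ _)
  · intro u
    constructor
    · intro h
      have h' : ∀ i, i ≠ Sum.inr 2 → u i = Sum.elim x (x ∘ p) i := by
        intro i hi
        rw [h, Function.update_of_ne hi]
      have h2 := congr_fun h (.inr 2)
      simp only [Sum.elim_inr, Function.comp_apply, Function.update_self] at h2
      funext i
      by_cases hi : i = Sum.inr 2
      · subst hi
        rw [Function.update_self, h2, h' (.inr 0) (by simp), h' (.inr 1) (by simp)]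
        simp only [Sum.elim_inr, Function.comp_apply, Bool.xor_assoc, Bool.xor_self, Bool.xor_false]
      · rw [Function.update_of_ne hi, h' i hi]
    · rintro rfl
      funext i
      by_cases hi : i = Sum.inr 2
      · subst hi
        rw [Function.update_self, Function.update_self, Function.update_of_ne (by simp),
          Function.update_of_ne (by simp)]
        simp only [Sum.elim_inr, Function.comp_apply, Bool.xor_assoc, Bool.xor_self, Bool.xor_false]
      · rw [Function.update_of_ne hi, Function.update_of_ne hi]

omit [DecidableEq ι] in
lemma size_freshToffoli (p : Fin 3 → ι) :
    (freshToffoli p).size ≤ 4 * Fintype.card ι + 16 := by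
  refine (Circuit.size_comp _ _ _).trans ?_
  rw [size_copyCircuit, Circuit.size_ofWires]
  simp only [Fintype.card_fin, List.length_singleton, Fintype.card_sum]
  omega

end ClassicalGates

/-! ### Boolean functions of low complexity -/

/-- `Reach n L L'`: starting from the Boolean functions in `L`, at most `n` Toffoli gates compute
all functions in `L'`. -/
inductive Reach {X : Type} : ℕ → Set (X → Bool) → Set (X → Bool) → Prop
  | refl (L : Set (X → Bool)) : Reach 0 L L
  | wait {n : ℕ} {L L' : Set (X → Bool)} (h : Reach n L L') : Reach (n + 1) L L'
  | step {n : ℕ} {L L' : Set (X → Bool)} (h : Reach n L L') {a b c : X → Bool} (ha : a ∈ L')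
      (hb : b ∈ L') (hc : c ∈ L') : Reach (n + 1) L (insert (fun x => xor (a x && b x) (c x)) L')

namespace Reach

variable {X : Type} {L L' L'' : Set (X → Bool)} {m n : ℕ}

lemma subset (h : Reach n L L') : L ⊆ L' := by
  induction h with
  | refl L => exact subset_rfl
  | wait h ih => exact ih
  | step h _ _ _ ih => exact ih.trans (Set.subset_insert _ _)

lemma mono (h : Reach n L L') (hnm : n ≤ m) : Reach m L L' := by
  induction hnm with
  | refl => exact h
  | step _ ih => exact ih.wait

lemma trans (h : Reach n L L') (h' : Reach m L' L'') : Reach (n + m) L L'' := by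
  induction h' with
  | refl => exact h
  | wait _ ih => exact (ih h).wait
  | step _ ha hb hc ih => exact (ih h).step ha hb hc

/-- A function of `c` computable bits is computable. -/
lemma exists_comp (L : Set (X → Bool)) (hL : ∀ b : Bool, (fun _ => b) ∈ L) :
    ∀ (c : ℕ) (p : Fin c → X → Bool) (_ : ∀ i, p i ∈ L) (φ : (Fin c → Bool) → Bool),
      ∃ L', Reach (2 ^ c - 1) L L' ∧ (fun x => φ fun i => p i x) ∈ L' := by
  intro c
  induction c generalizing L with
  | zero =>
    intro p _ φ
    refine ⟨L, Reach.refl L, ?_⟩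
    convert hL (φ Fin.elim0) using 3
  | succ c ih =>
    intro p hp φ
    obtain ⟨L₁, h₁, m₁⟩ := ih L hL (fun i => p i.succ) (fun i => hp _)
      (fun z => φ (Fin.cons false z))
    obtain ⟨L₂, h₂, m₂⟩ := ih L₁ (fun b => h₁.subset (hL b)) (fun i => p i.succ)
      (fun i => h₁.subset (hp _)) (fun z => xor (φ (Fin.cons true z)) (φ (Fin.cons false z)))
    -- Expansion in the first bit: `φ (b, z) = (b ∧ (φ (1, z) ⊕ φ (0, z))) ⊕ φ (0, z)`, which is the
    -- shape of one Toffoli gate. The cost is `2 (2 ^ c - 1) + 1 = 2 ^ (c + 1) - 1`.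
    have h := (h₁.trans h₂).step (h₂.subset (h₁.subset (hp 0))) m₂ (h₂.subset m₁)
    refine ⟨_, h.mono ?_, ?_⟩
    · have := Nat.one_le_two_pow (n := c)
      rw [pow_succ]
      omega
    · refine Set.mem_insert_iff.2 (Or.inl ?_)
      funext x
      have hx : (fun i => p i x) = Fin.cons (p 0 x) (fun i => p i.succ x) :=
        (Fin.cons_self_tail (fun i => p i x)).symm
      rw [hx]
      cases p 0 x <;> simp

/-- A function determined by `c` computable bits is computable. -/
lemma exists_of_determined (L : Set (X → Bool)) (hL : ∀ b : Bool, (fun _ => b) ∈ L) {J : Type}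
    [Fintype J] (p : J → X → Bool) (hp : ∀ i, p i ∈ L) (b : X → Bool)
    (hb : ∀ x y, (∀ i, p i x = p i y) → b x = b y) :
    ∃ L', Reach (2 ^ Fintype.card J) L L' ∧ b ∈ L' := by
  classical
  let E := Fintype.equivFin J
  -- `b` factors through the bits `p`. The truth table used here takes the value false on patterns
  -- that no `x` realises.
  obtain ⟨L', h, m⟩ := exists_comp L hL (Fintype.card J) (fun i => p (E.symm i))
    (fun i => hp _) (fun z => decide (∃ x, (∀ i, p i x = z (E i)) ∧ b x = true))
  refine ⟨L', h.mono (Nat.sub_le _ _), ?_⟩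
  convert m using 1
  funext x
  rw [eq_comm]
  by_cases hx : b x = true
  · rw [hx, decide_eq_true_eq]
    exact ⟨x, fun i => by simp, hx⟩
  · rw [Bool.eq_false_of_not_eq_true hx, decide_eq_false_iff_not]
    rintro ⟨y, hy, hby⟩
    exact hx ((hb x y fun i => by simpa using (hy i).symm).trans hby)

/-- Finitely many functions determined by few computable bits are computable. -/
lemma exists_family (L : Set (X → Bool)) (hL : ∀ b : Bool, (fun _ => b) ∈ L) (c : ℕ) {K : Type}
    (b : K → X → Bool)
    (hb : ∀ k, ∃ (J : Type) (_ : Fintype J) (p : J → X → Bool), Fintype.card J ≤ c ∧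
      (∀ i, p i ∈ L) ∧ ∀ x y, (∀ i, p i x = p i y) → b k x = b k y) (s : Finset K) :
    ∃ L', Reach (s.card * 2 ^ c) L L' ∧ ∀ k ∈ s, b k ∈ L' := by
  classical
  induction s using Finset.induction_on with
  | empty => exact ⟨L, (Reach.refl L).mono (Nat.zero_le _), by simp⟩
  | insert k s hk ih =>
    obtain ⟨L', h, hs⟩ := ih
    obtain ⟨J, _, p, hc, hp, hbk⟩ := hb k
    obtain ⟨L'', h', m⟩ := exists_of_determined L' (fun b => h.subset (hL b)) p
      (fun i => h.subset (hp i)) (b k) hbk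
    refine ⟨L'', (h.trans h').mono ?_, ?_⟩
    · rw [Finset.card_insert_of_notMem hk, add_mul, one_mul]
      gcongr
      norm_num
    · intro k' hk'
      rcases Finset.mem_insert.1 hk' with rfl | hk'
      · exact m
      · exact h'.subset (hs k' hk')

end Reach

/-- The constants and the input bits. -/
def baseFunctions (α : Type) : Set ((α → Bool) → Bool) :=
  {b | (∃ c : Bool, b = fun _ => c) ∨ ∃ i : α, b = fun x => x i}

section Compile

variable {α β : Type} [Fintype α] [DecidableEq α] [Fintype β] [DecidableEq β]

/-- Prepare two wires with constant values. -/
def constCircuit (α : Type) [Fintype α] : Circuit Gate α (α ⊕ Bool) :=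
  Circuit.ofWires gateSem (α ⊕ Bool) Function.Embedding.inl [.not (.inr true)]
    (Function.Embedding.refl _)

lemma eval_constCircuit (x : α → Bool) :
    (constCircuit α).eval gateSem () (basisState x) = basisState (Sum.elim x id) := by
  rw [constCircuit, Circuit.eval_ofWires, load_inl, tensor_basisState, keep_refl]
  change Gate.apply _ _ = _
  rw [Gate.apply_not]
  refine basisState_submatrix _ _ _ fun u => ?_
  constructor
  · intro h
    funext i
    have := congr_fun h i
    rcases i with i | (_ | _)
    · simpa using this
    · simpa using this
    · simpa using this
  · rintro rfl
    funext i
    rcases i with i | (_ | _) <;> simp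

/-- Each gate writes to a new wire and nothing is overwritten, so every function computed so far
remains readable on some wire. The separate equation `h₀` keeps the index `L₀` a variable for the
induction. -/
lemma exists_circuit_of_reach_aux {n : ℕ} {L₀ L : Set ((α → Bool) → Bool)}
    (h : Reach n L₀ L) (h₀ : L₀ = baseFunctions α) :
    ∃ (ι : Type) (_ : Fintype ι) (_ : DecidableEq ι) (Y : (α → Bool) → ι → Bool)
      (C : Circuit Gate α ι), Fintype.card ι ≤ Fintype.card α + 2 + n ∧
      C.size ≤ (n + 1) * (4 * (Fintype.card α + 2 + n) + 16) ∧
      (∀ x, C.eval gateSem () (basisState x) = basisState (Y x)) ∧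
      ∀ b ∈ L, ∃ j, ∀ x, Y x j = b x := by
  induction h with
  | refl L =>
    subst h₀
    refine ⟨α ⊕ Bool, inferInstance, inferInstance, fun x => Sum.elim x id, constCircuit α, ?_, ?_,
      eval_constCircuit, ?_⟩
    · simp
    · rw [constCircuit, Circuit.size_ofWires]
      simp only [List.length_singleton, Fintype.card_sum, Fintype.card_bool]
      omega
    · rintro b (⟨c, rfl⟩ | ⟨i, rfl⟩)
      · exact ⟨.inr c, fun _ => rfl⟩
      · exact ⟨.inl i, fun _ => rfl⟩
  | wait _ ih =>
    obtain ⟨ι, _, _, Y, C, h1, h2, h3, h4⟩ := ih h₀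
    exact ⟨ι, inferInstance, inferInstance, Y, C, by omega, h2.trans (by gcongr <;> omega), h3, h4⟩
  | @step n L L' _ a b c ha hb hc ih =>
    obtain ⟨ι, _, _, Y, C, h1, h2, h3, h4⟩ := ih h₀
    obtain ⟨i, hi⟩ := h4 a ha
    obtain ⟨j, hj⟩ := h4 b hb
    obtain ⟨k, hk⟩ := h4 c hc
    refine ⟨ι ⊕ Unit, inferInstance, inferInstance,
      fun x => Sum.elim (Y x) fun _ => xor (Y x i && Y x j) (Y x k),
      Circuit.comp gateSem C (freshToffoli ![i, j, k]), ?_, ?_, ?_, ?_⟩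
    · simp only [Fintype.card_sum, Fintype.card_unit]
      omega
    · refine (Circuit.size_comp _ _ _).trans ((Nat.add_le_add h2 (size_freshToffoli _)).trans ?_)
      calc _ ≤ (n + 1) * (4 * (Fintype.card α + 2 + (n + 1)) + 16) +
            1 * (4 * (Fintype.card α + 2 + (n + 1)) + 16) := by gcongr <;> omega
        _ = _ := by ring
    · intro x
      rw [Circuit.eval_comp, h3, eval_freshToffoli]
      rfl
    · intro f hf
      rcases Set.mem_insert_iff.1 hf with rfl | hf
      · exact ⟨.inr (), fun x => by simp [hi, hj, hk]⟩
      · obtain ⟨l, hl⟩ := h4 f hf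
        exact ⟨.inl l, hl⟩

/-- Functions of low complexity are computed by small circuits. -/
theorem exists_circuit_of_reach {n : ℕ} {L : Set ((α → Bool) → Bool)}
    (h : Reach n (baseFunctions α) L) (f : (α → Bool) → β → Bool)
    (hf : ∀ j, (fun x => f x j) ∈ L) :
    ∃ C : Circuit Gate α β,
      C.size ≤ (n + 1) * (6 * (Fintype.card α + 2 + n) + 16) + 3 * Fintype.card β ∧
      ∀ x, C.eval gateSem () (basisState x) = basisState (f x) := by
  obtain ⟨ι, _, _, Y, C, h1, h2, h3, h4⟩ := exists_circuit_of_reach_aux h rfl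
  choose e he using fun j => h4 _ (hf j)
  -- Several output bits may sit on the same wire, so `e` need not be injective and the outputs are
  -- copied out.
  refine ⟨(Circuit.comp gateSem C (copyCircuit e)).withOutput Function.Embedding.inr, ?_, ?_⟩
  · refine (Circuit.size_comp _ _ _).trans ?_
    rw [size_copyCircuit]
    nlinarith
  · intro x
    rw [Circuit.eval_withOutput, Circuit.eval_comp, h3, eval_copyCircuit_basisState,
      keep_basisState]
    congr 1
    funext j
    exact he j x

end Compile

/-! ### Polynomial bounds -/

namespace PolyBounded

variable {f g : ℕ → ℕ}

lemma mono (hg : PolyBounded g) (h : ∀ lam, f lam ≤ g lam) : PolyBounded f := by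
  obtain ⟨p, hp⟩ := hg
  exact ⟨p, fun lam => (h lam).trans (hp lam)⟩

lemma const (c : ℕ) : PolyBounded fun _ => c := ⟨Polynomial.C c, by simp⟩

lemma id : PolyBounded fun lam => lam := ⟨Polynomial.X, by simp⟩

lemma add (hf : PolyBounded f) (hg : PolyBounded g) : PolyBounded fun lam => f lam + g lam := by
  obtain ⟨p, hp⟩ := hf
  obtain ⟨q, hq⟩ := hg
  exact ⟨p + q, fun lam => by simpa using Nat.add_le_add (hp lam) (hq lam)⟩

lemma mul (hf : PolyBounded f) (hg : PolyBounded g) : PolyBounded fun lam => f lam * g lam := by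
  obtain ⟨p, hp⟩ := hf
  obtain ⟨q, hq⟩ := hg
  exact ⟨p * q, fun lam => by simpa using Nat.mul_le_mul (hp lam) (hq lam)⟩

lemma eval (p : Polynomial ℕ) (hf : PolyBounded f) : PolyBounded fun lam => p.eval (f lam) := by
  induction p using Polynomial.induction_on with
  | C a => simpa using const a
  | add p q hp hq => simpa using hp.add hq
  | monomial n a h =>
    have := h.mul hf
    simpa [pow_succ, mul_assoc] using this

end PolyBounded

/-! ### Locality of stack machines -/

section StackMachine

open Turing

variable {K : Type} [DecidableEq K] {Γ : K → Type} {Λ σ : Type}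

/-- The number of stack operations of a statement. -/
def stmtDepth : TM2.Stmt Γ Λ σ → ℕ
  | .push _ _ q => stmtDepth q + 1
  | .peek _ _ q => stmtDepth q + 1
  | .pop _ _ q => stmtDepth q + 1
  | .load _ q => stmtDepth q
  | .branch _ q₁ q₂ => max (stmtDepth q₁) (stmtDepth q₂)
  | .goto _ => 0
  | .halt => 0

/-- Two stack contents agree near the top and near the position `i`. -/
def AgreeNear (D i : ℕ) (S S' : ∀ k, List (Γ k)) : Prop :=
  ∀ k j, (j < D ∨ (j ≤ i + D ∧ i ≤ j + D)) → (S k)[j]? = (S' k)[j]?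

omit [DecidableEq K] in
lemma AgreeNear.mono {D D' i : ℕ} {S S' : ∀ k, List (Γ k)} (h : AgreeNear D i S S') (hD : D' ≤ D) :
    AgreeNear D' i S S' :=
  fun k j hj => h k j (by omega)

omit [DecidableEq K] in
lemma AgreeNear.head? {D i : ℕ} {S S' : ∀ k, List (Γ k)} (h : AgreeNear (D + 1) i S S') (k : K) :
    (S k).head? = (S' k).head? := by
  rw [List.head?_eq_getElem?, List.head?_eq_getElem?]
  exact h k 0 (by omega)

/-- Positions count from the top of a stack, so a push or pop shifts them by one and uses up one
unit of the radius. The cells near the top are included because they are what peek and pop read. -/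
lemma stepAux_local (q : TM2.Stmt Γ Λ σ) (v : σ) (S S' : ∀ k, List (Γ k)) (i : ℕ)
    (h : AgreeNear (stmtDepth q) i S S') :
    (TM2.stepAux q v S).l = (TM2.stepAux q v S').l ∧
      (TM2.stepAux q v S).var = (TM2.stepAux q v S').var ∧
      ∀ k, ((TM2.stepAux q v S).stk k)[i]? = ((TM2.stepAux q v S').stk k)[i]? := by
  induction q generalizing v S S' with
  | push k f q ih =>
    simp only [TM2.stepAux]
    refine ih _ _ _ fun k' j hj => ?_
    by_cases hk : k' = k
    · subst hk
      rw [Function.update_self, Function.update_self]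
      cases j with
      | zero => simp
      | succ j =>
        rw [List.getElem?_cons_succ, List.getElem?_cons_succ]
        exact h _ _ (by simp only [stmtDepth]; omega)
    · rw [Function.update_of_ne hk, Function.update_of_ne hk]
      exact h _ _ (by simp only [stmtDepth]; omega)
  | peek k f q ih =>
    simp only [TM2.stepAux]
    rw [AgreeNear.head? h k]
    exact ih _ _ _ (h.mono (Nat.le_succ _))
  | pop k f q ih =>
    simp only [TM2.stepAux]
    rw [AgreeNear.head? h k]
    refine ih _ _ _ fun k' j hj => ?_
    by_cases hk : k' = k
    · subst hk
      rw [Function.update_self, Function.update_self, List.getElem?_tail, List.getElem?_tail]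
      exact h _ _ (by simp only [stmtDepth]; omega)
    · rw [Function.update_of_ne hk, Function.update_of_ne hk]
      exact h _ _ (by simp only [stmtDepth]; omega)
  | load a q ih =>
    simp only [TM2.stepAux]
    exact ih _ _ _ h
  | branch f q₁ q₂ ih₁ ih₂ =>
    simp only [TM2.stepAux]
    cases f v
    · exact ih₂ _ _ _ (h.mono (le_max_right _ _))
    · exact ih₁ _ _ _ (h.mono (le_max_left _ _))
  | goto f => exact ⟨rfl, rfl, fun k => h k i (by simp)⟩
  | halt => exact ⟨rfl, rfl, fun k => h k i (by simp)⟩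

lemma length_stepAux_le (q : TM2.Stmt Γ Λ σ) (v : σ) (S : ∀ k, List (Γ k)) (k : K) :
    ((TM2.stepAux q v S).stk k).length ≤ (S k).length + stmtDepth q := by
  induction q generalizing v S with
  | push k' f q ih =>
    simp only [TM2.stepAux, stmtDepth]
    refine (ih _ _).trans ?_
    by_cases hk : k = k'
    · subst hk
      simp; omega
    · rw [Function.update_of_ne hk]; omega
  | peek k' f q ih =>
    simp only [TM2.stepAux, stmtDepth]
    exact (ih _ _).trans (by omega)
  | pop k' f q ih =>
    simp only [TM2.stepAux, stmtDepth]
    refine (ih _ _).trans ?_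
    by_cases hk : k = k'
    · subst hk
      simp; omega
    · rw [Function.update_of_ne hk]; omega
  | load a q ih => exact ih _ _
  | branch f q₁ q₂ ih₁ ih₂ =>
    simp only [TM2.stepAux, stmtDepth]
    cases f v
    · exact (ih₂ _ _).trans (by simp)
    · exact (ih₁ _ _).trans (by simp)
  | goto f => simp [TM2.stepAux]
  | halt => simp [TM2.stepAux]

/-- A statement pushes only finitely many symbols. -/
lemma exists_symbols [Finite σ] (q : TM2.Stmt Γ Λ σ) :
    ∃ R : ∀ k, Set (Γ k), (∀ k, (R k).Finite) ∧
      ∀ v S k, ∀ s ∈ (TM2.stepAux q v S).stk k, s ∈ S k ∨ s ∈ R k := by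
  induction q with
  | push k' f q ih =>
    obtain ⟨R, hR, h⟩ := ih
    refine ⟨Function.update R k' (R k' ∪ Set.range f), fun k => ?_, fun v S k s hs => ?_⟩
    · by_cases hk : k = k'
      · subst hk
        rw [Function.update_self]
        exact (hR k).union (Set.finite_range f)
      · rw [Function.update_of_ne hk]
        exact hR k
    · have := h _ _ k s hs
      by_cases hk : k = k'
      · subst hk
        simp only [Function.update_self, List.mem_cons, Set.mem_union] at this ⊢
        rcases this with (rfl | h) | h
        · exact Or.inr (Or.inr ⟨v, rfl⟩)
        · exact Or.inl h
        · exact Or.inr (Or.inl h)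
      · simpa only [Function.update_of_ne hk] using this
  | peek k' f q ih =>
    obtain ⟨R, hR, h⟩ := ih
    exact ⟨R, hR, fun v S k s hs => h _ _ k s hs⟩
  | pop k' f q ih =>
    obtain ⟨R, hR, h⟩ := ih
    refine ⟨R, hR, fun v S k s hs => ?_⟩
    have := h _ _ k s hs
    by_cases hk : k = k'
    · subst hk
      simp only [Function.update_self] at this
      exact this.imp_left List.mem_of_mem_tail
    · simpa only [Function.update_of_ne hk] using this
  | load a q ih =>
    obtain ⟨R, hR, h⟩ := ih
    exact ⟨R, hR, fun v S k s hs => h _ _ k s hs⟩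
  | branch f q₁ q₂ ih₁ ih₂ =>
    obtain ⟨R₁, hR₁, h₁⟩ := ih₁
    obtain ⟨R₂, hR₂, h₂⟩ := ih₂
    refine ⟨fun k => R₁ k ∪ R₂ k, fun k => (hR₁ k).union (hR₂ k), fun v S k s hs => ?_⟩
    simp only [TM2.stepAux] at hs
    cases hf : f v
    · rw [hf] at hs
      exact (h₂ _ _ k s hs).imp_right Or.inr
    · rw [hf] at hs
      exact (h₁ _ _ k s hs).imp_right Or.inl
  | goto f => exact ⟨fun _ => ∅, fun _ => Set.finite_empty, fun v S k s hs => Or.inl hs⟩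
  | halt => exact ⟨fun _ => ∅, fun _ => Set.finite_empty, fun v S k s hs => Or.inl hs⟩

/-- One step of a machine, where a halted machine stays as it is. -/
def stepTotal (M : Λ → TM2.Stmt Γ Λ σ) (c : TM2.Cfg Γ Λ σ) : TM2.Cfg Γ Λ σ :=
  (TM2.step M c).getD c

lemma stepTotal_of_none (M : Λ → TM2.Stmt Γ Λ σ) {c : TM2.Cfg Γ Λ σ} (h : c.l = none) :
    stepTotal M c = c := by
  obtain ⟨l, v, S⟩ := c
  obtain rfl : l = none := h
  rfl

lemma stepTotal_of_some (M : Λ → TM2.Stmt Γ Λ σ) {c : TM2.Cfg Γ Λ σ} {l : Λ} (h : c.l = some l) :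
    stepTotal M c = TM2.stepAux (M l) c.var c.stk := by
  obtain ⟨l', v, S⟩ := c
  obtain rfl : l' = some l := h
  rfl

/-- The actual number of steps depends on the input, whereas a circuit needs a common one. Since a
halted configuration is fixed, running longer is harmless. -/
lemma iterate_stepTotal (M : Λ → TM2.Stmt Γ Λ σ) {b : TM2.Cfg Γ Λ σ} (hb : b.l = none) :
    ∀ (k : ℕ) (a : TM2.Cfg Γ Λ σ), (flip bind (TM2.step M))^[k] (some a) = some b →
      ∀ T, k ≤ T → (stepTotal M)^[T] a = b := by
  have hn : ∀ k, (flip bind (TM2.step M))^[k] none = none := by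
    intro k
    induction k with
    | zero => rfl
    | succ k ih => rw [Function.iterate_succ_apply]; exact ih
  intro k
  induction k with
  | zero =>
    intro a h T _
    obtain rfl : a = b := by simpa using h
    exact Function.iterate_fixed (stepTotal_of_none M hb) T
  | succ k ih =>
    intro a h T hT
    obtain ⟨T, rfl⟩ : ∃ T', T = T' + 1 := ⟨T - 1, by omega⟩
    rw [Function.iterate_succ_apply] at h ⊢
    change (flip bind (TM2.step M))^[k] (TM2.step M a) = some b at h
    cases ha : TM2.step M a with
    | none => rw [ha, hn] at h; cases h
    | some a' =>
      rw [ha] at h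
      rw [stepTotal, ha]
      exact ih a' h T (by omega)

lemma stepTotal_local (M : Λ → TM2.Stmt Γ Λ σ) (D : ℕ) (hD : ∀ l, stmtDepth (M l) ≤ D)
    {c c' : TM2.Cfg Γ Λ σ} (i : ℕ) (hl : c.l = c'.l) (hv : c.var = c'.var)
    (h : AgreeNear D i c.stk c'.stk) :
    (stepTotal M c).l = (stepTotal M c').l ∧ (stepTotal M c).var = (stepTotal M c').var ∧
      ∀ k, ((stepTotal M c).stk k)[i]? = ((stepTotal M c').stk k)[i]? := by
  cases hc : c.l with
  | none =>
    rw [stepTotal_of_none M hc, stepTotal_of_none M (hl ▸ hc)]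
    exact ⟨hl, hv, fun k => h k i (by omega)⟩
  | some l =>
    rw [stepTotal_of_some M hc, stepTotal_of_some M (hl ▸ hc), ← hv]
    exact stepAux_local _ _ _ _ _ (h.mono (hD l))

lemma length_stepTotal_le (M : Λ → TM2.Stmt Γ Λ σ) (D : ℕ) (hD : ∀ l, stmtDepth (M l) ≤ D)
    (c : TM2.Cfg Γ Λ σ) (k : K) : ((stepTotal M c).stk k).length ≤ (c.stk k).length + D := by
  cases hc : c.l with
  | none => rw [stepTotal_of_none M hc]; omega
  | some l =>
    rw [stepTotal_of_some M hc]
    exact (length_stepAux_le _ _ _ _).trans (Nat.add_le_add_left (hD l) _)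

/-! ### Circuits for stack machines -/

variable {X : Type}

open Classical in
/-- Every question about the configuration is answered by a computed function. -/
def Available (L : Set (X → Bool)) (c : X → TM2.Cfg Γ Λ σ) : Prop :=
  (∀ l, (fun x => decide ((c x).l = l)) ∈ L) ∧ (∀ v, (fun x => decide ((c x).var = v)) ∈ L) ∧
    ∀ k (i : ℕ) (γ : Option (Γ k)), (fun x => decide (((c x).stk k)[i]? = γ)) ∈ L

variable [Fintype K] [Fintype Λ] [Fintype σ] (R : ∀ k, Set (Γ k)) [∀ k, Fintype (R k)]

/-- The number of questions about a configuration with stacks of height at most `N`. -/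
def numQuestions (Λ σ : Type) [Fintype Λ] [Fintype σ] (N : ℕ) : ℕ :=
  (Fintype.card Λ + 1) + (Fintype.card σ + N * ∑ k, (Fintype.card (R k) + 1))

omit [DecidableEq K] in
-- Only questions about positions below `N` and symbols in `R` cost gates. Every other question
-- about a stack cell has a constant answer, and constants already lie in `L`.
lemma available_of_local (L : Set (X → Bool)) (hL : ∀ b : Bool, (fun _ => b) ∈ L)
    (c : X → TM2.Cfg Γ Λ σ) (N w : ℕ) (hN : ∀ x k, ((c x).stk k).length ≤ N)
    (hR : ∀ x k, ∀ s ∈ (c x).stk k, s ∈ R k)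
    (h : ∀ i : ℕ, ∃ (J : Type) (_ : Fintype J) (p : J → X → Bool), Fintype.card J ≤ w ∧
      (∀ j, p j ∈ L) ∧ ∀ x y, (∀ j, p j x = p j y) →
        (c x).l = (c y).l ∧ (c x).var = (c y).var ∧ ∀ k, ((c x).stk k)[i]? = ((c y).stk k)[i]?) :
    ∃ L', Reach (numQuestions R Λ σ N * 2 ^ w) L L' ∧ Available L' c := by
  classical
  let Q := Option Λ ⊕ (σ ⊕ (Σ k : K, Fin N × Option (R k)))
  let b : Q → X → Bool := Sum.elim (fun l x => decide ((c x).l = l))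
    (Sum.elim (fun v x => decide ((c x).var = v))
      fun a x => decide (((c x).stk a.1)[a.2.1.1]? = a.2.2.map Subtype.val))
  obtain ⟨L', hr, hm⟩ := Reach.exists_family L hL w b (by
    rintro (l | v | ⟨k, i, γ⟩)
    · obtain ⟨J, hJ, p, h1, h2, h3⟩ := h 0
      refine ⟨J, hJ, p, h1, h2, fun x y hxy => ?_⟩
      simp only [b, Sum.elim_inl, (h3 x y hxy).1]
    · obtain ⟨J, hJ, p, h1, h2, h3⟩ := h 0
      refine ⟨J, hJ, p, h1, h2, fun x y hxy => ?_⟩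
      simp only [b, Sum.elim_inl, Sum.elim_inr, (h3 x y hxy).2.1]
    · obtain ⟨J, hJ, p, h1, h2, h3⟩ := h i
      refine ⟨J, hJ, p, h1, h2, fun x y hxy => ?_⟩
      simp only [b, Sum.elim_inr, (h3 x y hxy).2.2 k]) Finset.univ
  have hcard : (Finset.univ : Finset Q).card = numQuestions R Λ σ N := by
    simp [Q, numQuestions, Finset.mul_sum]
  rw [hcard] at hr
  refine ⟨L', hr, fun l => hm (.inl l) (Finset.mem_univ _),
    fun v => hm (.inr (.inl v)) (Finset.mem_univ _), fun k i γ => ?_⟩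
  by_cases hi : i < N
  · by_cases hγ : ∃ r : Option (R k), γ = r.map Subtype.val
    · obtain ⟨r, rfl⟩ := hγ
      exact hm (.inr (.inr ⟨k, ⟨i, hi⟩, r⟩)) (Finset.mem_univ _)
    · have : (fun x => decide (((c x).stk k)[i]? = γ)) = fun _ => false := by
        funext x
        rw [decide_eq_false_iff_not]
        intro hx
        apply hγ
        cases γ with
        | none => exact ⟨none, rfl⟩
        | some s => exact ⟨some ⟨s, hR x k s (List.mem_of_getElem? hx)⟩, rfl⟩
      rw [this]
      exact hr.subset (hL false)
  · have : (fun x => decide (((c x).stk k)[i]? = γ)) = fun _ => decide (none = γ) := by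
      funext x
      rw [List.getElem?_eq_none ((hN x k).trans (not_lt.1 hi))]
    rw [this]
    exact hr.subset (hL _)

/-- The number of bits that determine a cell after one step. -/
def localWidth (Λ σ : Type) [Fintype Λ] [Fintype σ] (D : ℕ) : ℕ :=
  (Fintype.card Λ + 1) + (Fintype.card σ + (D + (2 * D + 1)) * ∑ k, (Fintype.card (R k) + 1))

/-- By `stepTotal_local`, the data after the step depend on the label, the state, the top `D` cells
and the `2 * D + 1` cells around `i`; the answers to the questions about these are the determining
bits. -/
lemma available_step (M : Λ → TM2.Stmt Γ Λ σ) (D : ℕ) (hD : ∀ l, stmtDepth (M l) ≤ D)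
    (L : Set (X → Bool)) (hL : ∀ b : Bool, (fun _ => b) ∈ L)
    (c : X → TM2.Cfg Γ Λ σ) (N : ℕ) (hN : ∀ x k, ((stepTotal M (c x)).stk k).length ≤ N)
    (hR : ∀ x k, ∀ s ∈ (c x).stk k, s ∈ R k)
    (hR' : ∀ x k, ∀ s ∈ (stepTotal M (c x)).stk k, s ∈ R k) (hc : Available L c) :
    ∃ L', Reach (numQuestions R Λ σ N * 2 ^ localWidth R Λ σ D) L L' ∧
      Available L' fun x => stepTotal M (c x) := by
  classical
  refine available_of_local R L hL _ N _ hN hR' fun i => ?_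
  -- For `i < D` the truncated subtraction sends several `j` to cell `0`. Such repetitions are
  -- harmless, as only surjectivity onto the window is used.
  let pos : Fin D ⊕ Fin (2 * D + 1) → ℕ := Sum.elim (fun j => j) fun j => i + j - D
  refine ⟨Option Λ ⊕ (σ ⊕ (Σ k : K, (Fin D ⊕ Fin (2 * D + 1)) × Option (R k))), inferInstance,
    Sum.elim (fun l x => decide ((c x).l = l)) (Sum.elim (fun v x => decide ((c x).var = v))
      fun a x => decide (((c x).stk a.1)[pos a.2.1]? = a.2.2.map Subtype.val)), ?_, ?_, ?_⟩
  · simp [localWidth, Finset.mul_sum]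
  · rintro (l | v | ⟨k, j, γ⟩)
    · exact hc.1 l
    · exact hc.2.1 v
    · exact hc.2.2 k _ _
  · intro x y hxy
    refine stepTotal_local M D hD i ?_ ?_ ?_
    -- The question whether the label equals that of `c x` is answered positively at `x`, hence at
    -- `y`. The state and the cells are treated alike.
    · have := hxy (.inl (c x).l)
      simp only [Sum.elim_inl, decide_true] at this
      exact (of_decide_eq_true this.symm).symm
    · have := hxy (.inr (.inl (c x).var))
      simp only [Sum.elim_inl, Sum.elim_inr, decide_true] at this
      exact (of_decide_eq_true this.symm).symm
    · intro k j hj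
      obtain ⟨a, ha⟩ : ∃ a, pos a = j := by
        rcases hj with hj | ⟨h1, h2⟩
        · exact ⟨.inl ⟨j, hj⟩, rfl⟩
        · refine ⟨.inr ⟨j + D - i, by omega⟩, ?_⟩
          simp only [pos, Sum.elim_inr]
          omega
      obtain ⟨r, hr⟩ : ∃ r : Option (R k), ((c x).stk k)[j]? = r.map Subtype.val := by
        cases hs : ((c x).stk k)[j]? with
        | none => exact ⟨none, rfl⟩
        | some s => exact ⟨some ⟨s, hR x k s (List.mem_of_getElem? hs)⟩, rfl⟩
      have := hxy (.inr (.inr ⟨k, a, r⟩))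
      simp only [Sum.elim_inr, ha, hr, decide_true] at this
      rw [hr]
      exact (of_decide_eq_true this.symm).symm

/-- The height bound `N` allows for the growth during all remaining steps and stays fixed in the
induction, so every step has the same cost. -/
lemma available_iterate (M : Λ → TM2.Stmt Γ Λ σ) (D : ℕ) (hD : ∀ l, stmtDepth (M l) ≤ D)
    (L : Set (X → Bool)) (hL : ∀ b : Bool, (fun _ => b) ∈ L) (c : X → TM2.Cfg Γ Λ σ) (N : ℕ)
    (T : ℕ) (hN : ∀ x k, ((c x).stk k).length + T * D ≤ N)
    (hR : ∀ x k, ∀ s ∈ (c x).stk k, s ∈ R k)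
    (hR' : ∀ c : TM2.Cfg Γ Λ σ, (∀ k, ∀ s ∈ c.stk k, s ∈ R k) →
      ∀ k, ∀ s ∈ (stepTotal M c).stk k, s ∈ R k) (hc : Available L c) :
    ∃ L', Reach (T * (numQuestions R Λ σ N * 2 ^ localWidth R Λ σ D)) L L' ∧
      Available L' fun x => (stepTotal M)^[T] (c x) := by
  induction T generalizing L c with
  | zero => exact ⟨L, by simpa using Reach.refl L, hc⟩
  | succ T ih =>
    have hlen : ∀ x k, ((stepTotal M (c x)).stk k).length + T * D ≤ N := by
      intro x k
      have h1 := length_stepTotal_le M D hD (c x) k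
      have h2 := hN x k
      rw [add_mul] at h2
      omega
    obtain ⟨L₁, h₁, a₁⟩ := available_step R M D hD L hL c N
      (fun x k => le_of_add_le_left (hlen x k)) hR (fun x => hR' _ (hR x)) hc
    obtain ⟨L₂, h₂, a₂⟩ := ih L₁ (fun b => h₁.subset (hL b)) _ hlen (fun x => hR' _ (hR x)) a₁
    exact ⟨L₂, (h₁.trans h₂).mono (le_of_eq (by ring)), a₂⟩

end StackMachine

/-! ### Polynomial time functions have polynomial size circuits -/

lemma encodeInput_length (d : ℕ → ℕ) (lam : ℕ) (k : Fin lam → Bool) (x : Fin (d lam) → Bool) :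
    (encodeInput d ⟨lam, k, x⟩).length = lam + d lam := by
  simp [encodeInput]

lemma encodeInput_getElem?_local (d : ℕ → ℕ) (lam i : ℕ) :
    ∃ (J : Type) (_ : Fintype J) (p : J → Fin lam ⊕ Fin (d lam)), Fintype.card J ≤ 1 ∧
      ∀ u v : Fin lam ⊕ Fin (d lam) → Bool, (∀ j, u (p j) = v (p j)) →
        (encodeInput d ⟨lam, u ∘ Sum.inl, u ∘ Sum.inr⟩)[i]? =
          (encodeInput d ⟨lam, v ∘ Sum.inl, v ∘ Sum.inr⟩)[i]? := by
  by_cases h1 : i < lam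
  · refine ⟨Unit, inferInstance, fun _ => .inl ⟨i, h1⟩, le_rfl, fun u v h => ?_⟩
    simp only [encodeInput]
    rw [List.getElem?_append_left (by simpa using h1), List.getElem?_append_left (by simpa using h1)]
    simp [h1, h ()]
  · by_cases h2 : i - lam < d lam
    · refine ⟨Unit, inferInstance, fun _ => .inr ⟨i - lam, h2⟩, le_rfl, fun u v h => ?_⟩
      simp only [encodeInput]
      rw [List.getElem?_append_right (by simpa using h1),
        List.getElem?_append_right (by simpa using h1)]
      simp [h2, h ()]
    · refine ⟨Empty, inferInstance, Empty.elim, by simp, fun u v _ => ?_⟩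
      rw [List.getElem?_eq_none, List.getElem?_eq_none] <;> rw [encodeInput_length] <;> omega

/-- The machine is unrolled for as many steps as its time bound allows on inputs of length `lam + d
lam`. The machine is fixed, so the exponent `localWidth` is a constant and only heights and step
counts grow, polynomially. -/
theorem exists_circuit_of_polyTime {d m : ℕ → ℕ} (hd : PolyBounded d) (hm : PolyBounded m)
    {F : ∀ lam, (Fin lam → Bool) → (Fin (d lam) → Bool) → (Fin (m lam) → Bool)}
    (hF : IsPolyTime d m F) :
    ∃ C : ∀ lam, Circuit Gate (Fin lam ⊕ Fin (d lam)) (Fin (m lam)),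
      PolyBounded (fun lam => (C lam).size) ∧
      ∀ lam k x, (C lam).eval gateSem () (basisState (Sum.elim k x)) =
        basisState (F lam k x) := by
  classical
  obtain ⟨⟨⟨tm, inA, outA⟩, time, hout⟩⟩ := hF
  dsimp only at hout
  have := tm.kFin
  have := tm.ΛFin
  have := tm.σFin
  have := tm.Γk₀Fin
  choose R₀ hR₀ hR₁ using fun l => exists_symbols (tm.m l)
  -- Finiteness of the alphabet is at hand for the input stack `k₀`, where all symbols are kept. On
  -- other stacks, which start empty, only the symbols pushed by some statement can occur.
  let R : ∀ k, Set (tm.Γ k) := fun k => (⋃ l, R₀ l k) ∪ {s | k = tm.k₀}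
  have hfin : ∀ k, (R k).Finite := by
    intro k
    refine (Set.finite_iUnion fun l => hR₀ l k).union ?_
    by_cases hk : k = tm.k₀
    · subst hk
      exact Set.toFinite _
    · simp [hk]
  have : ∀ k, Fintype (R k) := fun k => (hfin k).fintype
  obtain ⟨D, hD⟩ : ∃ D, ∀ l, stmtDepth (tm.m l) ≤ D :=
    ⟨Finset.univ.sup fun l => stmtDepth (tm.m l), fun l => Finset.le_sup (f := fun l => stmtDepth (tm.m l)) (Finset.mem_univ l)⟩
  have hR' : ∀ c : Turing.TM2.Cfg tm.Γ tm.Λ tm.σ, (∀ k, ∀ s ∈ c.stk k, s ∈ R k) →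
      ∀ k, ∀ s ∈ (stepTotal tm.m c).stk k, s ∈ R k := by
    intro c hc k s hs
    cases hl : c.l with
    | none => rw [stepTotal_of_none _ hl] at hs; exact hc k s hs
    | some l =>
      rw [stepTotal_of_some _ hl] at hs
      rcases hR₁ l _ _ k s hs with h | h
      · exact hc k s h
      · exact Or.inl (Set.mem_iUnion.2 ⟨l, h⟩)
  let T : ℕ → ℕ := fun lam => time.eval (lam + d lam)
  let N : ℕ → ℕ := fun lam => (lam + d lam) + T lam * D
  let q : ℕ → ℕ := fun lam => numQuestions R tm.Λ tm.σ (N lam) * 2 ^ 1 +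
    T lam * (numQuestions R tm.Λ tm.σ (N lam) * 2 ^ localWidth R tm.Λ tm.σ D)
  have key : ∀ lam, ∃ L, Reach (q lam) (baseFunctions (Fin lam ⊕ Fin (d lam))) L ∧
      ∀ j, (fun u : Fin lam ⊕ Fin (d lam) → Bool => F lam (u ∘ Sum.inl) (u ∘ Sum.inr) j) ∈ L := by
    intro lam
    let inp : (Fin lam ⊕ Fin (d lam) → Bool) → List (tm.Γ tm.k₀) := fun u =>
      (encodeInput d ⟨lam, u ∘ Sum.inl, u ∘ Sum.inr⟩).map inA.invFun
    let c : (Fin lam ⊕ Fin (d lam) → Bool) → Turing.TM2.Cfg tm.Γ tm.Λ tm.σ :=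
      fun u => Turing.initList tm (inp u)
    have hc₀ : ∀ u, (c u).stk tm.k₀ = inp u := fun u => by simp [c, Turing.initList]
    have hc₁ : ∀ u k, k ≠ tm.k₀ → (c u).stk k = [] := fun u k hk => by simp [c, Turing.initList, hk]
    have hlen : ∀ u k, ((c u).stk k).length ≤ lam + d lam := by
      intro u k
      by_cases hk : k = tm.k₀
      · subst hk
        rw [hc₀, List.length_map, encodeInput_length]
      · rw [hc₁ u k hk]
        simp
    have hRc : ∀ u k, ∀ s ∈ (c u).stk k, s ∈ R k := by
      intro u k s hs
      by_cases hk : k = tm.k₀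
      · exact Or.inr hk
      · rw [hc₁ u k hk] at hs
        simp at hs
    have hL : ∀ b : Bool, (fun _ => b) ∈ baseFunctions (Fin lam ⊕ Fin (d lam)) :=
      fun b => Or.inl ⟨b, rfl⟩
    -- Initially the label and the state are constant and a cell shows at most one input bit, whence
    -- the width `1`.
    obtain ⟨L₁, h₁, a₁⟩ := available_of_local R _ hL c (N lam) 1
      (fun u k => (hlen u k).trans (Nat.le_add_right _ _)) hRc (fun i => by
        obtain ⟨J, hJ, p, hp, h⟩ := encodeInput_getElem?_local d lam i
        refine ⟨J, hJ, fun j u => u (p j), hp, fun j => Or.inr ⟨p j, rfl⟩, fun u v huv => ?_⟩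
        refine ⟨rfl, rfl, fun k => ?_⟩
        by_cases hk : k = tm.k₀
        · subst hk
          rw [hc₀, hc₀, List.getElem?_map, List.getElem?_map, h u v huv]
        · rw [hc₁ u k hk, hc₁ v k hk])
    obtain ⟨L₂, h₂, a₂⟩ := available_iterate R tm.m D hD L₁ (fun b => h₁.subset (hL b)) c (N lam)
      (T lam) (fun u k => Nat.add_le_add_right (hlen u k) _) hRc hR' a₁
    refine ⟨L₂, h₁.trans h₂, fun j => ?_⟩
    -- Output bit `j` is the answer to the question whether cell `j` of the output stack encodes
    -- `true`.
    convert a₂.2.2 tm.k₁ j (some (outA.invFun true)) using 1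
    funext u
    have hrun := hout ⟨lam, u ∘ Sum.inl, u ∘ Sum.inr⟩
    have hfinal : (stepTotal tm.m)^[T lam] (c u) = Turing.haltList tm
        ((List.ofFn (F lam (u ∘ Sum.inl) (u ∘ Sum.inr))).map outA.invFun) := by
      refine iterate_stepTotal tm.m rfl hrun.steps _ hrun.evals_in_steps _ ?_
      exact hrun.steps_le_m.trans_eq
        (congrArg (fun l => time.eval l) (encodeInput_length d lam _ _))
    beta_reduce
    rw [hfinal]
    have hst : (Turing.haltList tm
        ((List.ofFn (F lam (u ∘ Sum.inl) (u ∘ Sum.inr))).map outA.invFun)).stk tm.k₁ =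
        (List.ofFn (F lam (u ∘ Sum.inl) (u ∘ Sum.inr))).map outA.invFun := by
      simp [Turing.haltList]
    rw [hst, List.getElem?_map, List.getElem?_ofFn]
    simp
  have hq : PolyBounded q := by
    have hT : PolyBounded T := PolyBounded.eval time (PolyBounded.id.add hd)
    have hN : PolyBounded N := (PolyBounded.id.add hd).add (hT.mul (PolyBounded.const D))
    have hQ : PolyBounded fun lam => numQuestions R tm.Λ tm.σ (N lam) :=
      (PolyBounded.const _).add ((PolyBounded.const _).add (hN.mul (PolyBounded.const _)))
    exact (hQ.mul (PolyBounded.const _)).add (hT.mul (hQ.mul (PolyBounded.const _)))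
  choose L hL hmem using key
  choose C hsize hC using fun lam => exists_circuit_of_reach (hL lam)
    (fun u => F lam (u ∘ Sum.inl) (u ∘ Sum.inr)) (hmem lam)
  refine ⟨C, ?_, fun lam k x => hC lam _⟩
  refine PolyBounded.mono ?_ hsize
  simp only [Fintype.card_sum, Fintype.card_fin]
  exact ((hq.add (PolyBounded.const 1)).mul (((PolyBounded.const 6).mul
    (((PolyBounded.id.add hd).add (PolyBounded.const 2)).add hq)).add (PolyBounded.const 16))).add
    ((PolyBounded.const 3).mul hm)

/-! ### Families of registers -/

section Families

variable {J ι κ : Type} [Fintype J] [DecidableEq J] [Fintype ι] [DecidableEq ι]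

/-- The tensor product of a family of states. -/
def tensorFam (ρ : J → Op ι) : Op (J × ι) :=
  Matrix.of fun u v => ∏ i, ρ i (fun j => u (i, j)) (fun j => v (i, j))

omit [DecidableEq J] [Fintype ι] [DecidableEq ι] in
lemma tensorFam_apply (ρ : J → Op ι) (u v : J × ι → Bool) :
    tensorFam ρ u v = ∏ i, ρ i (fun j => u (i, j)) (fun j => v (i, j)) := rfl

lemma sum_prod_curry {R : Type*} [CommSemiring R] (f : J → (ι → Bool) → R) :
    ∑ w : J × ι → Bool, ∏ i, f i (fun j => w (i, j)) = ∏ i, ∑ w, f i w := by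
  rw [Finset.prod_univ_sum, Fintype.piFinset_univ]
  exact Fintype.sum_equiv (Equiv.curry J ι Bool) _ _ fun _ => rfl

lemma trace_tensorFam (ρ : J → Op ι) : (tensorFam ρ).trace = ∏ i, (ρ i).trace :=
  sum_prod_curry fun i w => ρ i w w

omit [DecidableEq ι] [Fintype ι] in
lemma tensorPow_eq_tensorFam (t : ℕ) (ρ : Op ι) : tensorPow t ρ = tensorFam fun _ : Fin t => ρ := rfl

/-- Separate the last member of a family of registers. -/
def peelLast (m : ℕ) (ν : Type) : Fin (m + 1) × ν ≃ ν ⊕ (Fin m × ν) where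
  toFun p := Fin.lastCases (motive := fun _ => ν ⊕ (Fin m × ν)) (.inl p.2)
    (fun j => .inr (j, p.2)) p.1
  invFun := Sum.elim (fun a => (Fin.last m, a)) fun p => (p.1.castSucc, p.2)
  left_inv := by
    rintro ⟨i, a⟩
    refine Fin.lastCases ?_ (fun j => ?_) i <;> simp
  right_inv := by
    rintro (a | ⟨j, a⟩) <;> simp

omit [Fintype ι] [DecidableEq ι] in
lemma rename_peelLast {m : ℕ} (ρ : Fin (m + 1) → Op ι) :
    rename (peelLast m ι) (tensorFam ρ) =
      tensor (ρ (Fin.last m)) (tensorFam fun j => ρ j.castSucc) := by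
  ext u v
  simp only [rename_apply, tensorFam_apply, tensor_apply, Fin.prod_univ_castSucc]
  rw [mul_comm]
  simp [peelLast, Function.comp_def]

/-- Move the last of three registers next to the first one. -/
def rightComm (α β γ : Type) : (α ⊕ β) ⊕ γ ≃ (α ⊕ γ) ⊕ β :=
  ((Equiv.sumAssoc α β γ).trans ((Equiv.refl α).sumCongr (Equiv.sumComm β γ))).trans
    (Equiv.sumAssoc α γ β).symm

lemma rename_rightComm {α β γ : Type} (ρ : Op α) (σ : Op β) (τ : Op γ) :
    rename (rightComm α β γ) (tensor (tensor ρ σ) τ) = tensor (tensor ρ τ) σ := by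
  rw [rightComm, rename_trans, rename_trans, rename_sumAssoc, rename_sumCongr, rename_sumComm,
    rename_sumAssoc_symm, rename_refl]

end Families

/-! ### Measuring and recording a query -/

section Measure

variable {ι η ν χ : Type} [Fintype ι] [DecidableEq ι] [Fintype η] [DecidableEq η]
  [Fintype ν] [DecidableEq ν] [Fintype χ] [DecidableEq χ]

/-- Measure the register `x` and keep the outcome in a new register. -/
def measureCircuit (x : χ ↪ ι) : Circuit Gate ι (ι ⊕ χ) :=
  (copyCircuit (Sum.elim x x : χ ⊕ χ → ι)).withOutput
    ((Function.Embedding.refl ι).sumMap Function.Embedding.inl)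

/-- Two copies of `x` are made and one of them is traced out. This destroys the coherence between
different values of `x`, and the other copy is the recorded outcome. -/
lemma eval_measureCircuit (x : χ ↪ ι) (ρ : Op ι) :
    (measureCircuit x).eval gateSem () ρ = ∑ s, tensor (proj x s ρ) (basisState s) := by
  rw [measureCircuit, Circuit.eval_withOutput]
  ext u v
  rw [keep_eq_sum_equiv _ (Equiv.sumAssoc ι χ χ) (by rintro (i | i) <;> rfl)]
  have h1 : ∀ (u : ι ⊕ χ → Bool) (z : χ → Bool), (Sum.elim u z ∘ (Equiv.sumAssoc ι χ χ).symm) =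
      Sum.elim (u ∘ Sum.inl) (Sum.elim (u ∘ Sum.inr) z) := by
    intro u z
    funext i
    rcases i with i | i | i <;> rfl
  have h2 : ∀ (u : ι ⊕ χ → Bool) (z : χ → Bool),
      Sum.elim (u ∘ Sum.inr) z = (u ∘ Sum.inl) ∘ Sum.elim x x ↔
        u ∘ Sum.inr = u ∘ Sum.inl ∘ x ∧ z = u ∘ Sum.inl ∘ x := by
    intro u z
    constructor
    · intro h
      exact ⟨congr_arg (fun f => f ∘ Sum.inl) h, congr_arg (fun f => f ∘ Sum.inr) h⟩
    · rintro ⟨h, h'⟩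
      rw [h, h']
      funext i; rcases i with i | i <;> rfl
  simp only [h1, eval_copyCircuit, Sum.elim_comp_inl, Sum.elim_comp_inr, ← Function.comp_assoc, h2]
  rw [Matrix.sum_apply]
  refine Finset.sum_congr rfl fun s _ => ?_
  simp only [tensor_apply, proj_apply, basisState_apply, Function.comp_assoc]
  by_cases hs : u ∘ Sum.inl ∘ x = s ∧ v ∘ Sum.inl ∘ x = s
  · obtain ⟨rfl, hv⟩ := hs
    simp only [hv, and_true, mul_ite, mul_one, mul_zero, if_true]
    congr 1
    simp only [eq_comm]
  · rw [if_neg hs, zero_mul, if_neg]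
    rintro ⟨⟨-, h⟩, -, h'⟩
    exact hs ⟨h.symm, h'.symm⟩

omit [DecidableEq ι] [DecidableEq χ] in
lemma size_measureCircuit (x : χ ↪ ι) :
    (measureCircuit x).size = 6 * Fintype.card χ + 2 * Fintype.card ι := by
  rw [measureCircuit, Circuit.size_withOutput, size_copyCircuit, Fintype.card_sum]
  ring

lemma replace_basisState (y : ν ↪ ι) (s : ν → Bool) (h : ι → Bool) :
    replace y (basisState s) (basisState h) = basisState (Function.extend y s h) := by
  rw [← keep_answerWires, tensor_basisState, keep_basisState]
  congr 1
  have := elim_comp_swapFun y h s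
  funext i
  exact congr_fun this (.inl i)

/-- Measure the register `x` and write the outcome to the register `r` of the history. -/
def recordCircuit (x : χ ↪ ι) (r : χ ↪ η) : Circuit Gate (ι ⊕ η) (ι ⊕ η) :=
  Circuit.comp gateSem
    (((measureCircuit x).onLeft gateSem η).withOutput
      ((rightComm ι η χ).trans (Equiv.refl _)).toEmbedding)
    ((Circuit.discard gateSem ((Function.Embedding.refl ι).sumMap (answerWires r))).withInput
      (Equiv.sumAssoc ι η χ).toEmbedding)

lemma eval_recordCircuit (x : χ ↪ ι) (r : χ ↪ η) (σ : Op ι) (h : η → Bool) :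
    (recordCircuit x r).eval gateSem () (tensor σ (basisState h)) =
      ∑ s, tensor (proj x s σ) (basisState (Function.extend r s h)) := by
  rw [recordCircuit, Circuit.eval_comp, Circuit.eval_withOutput, Circuit.eval_onLeft,
    eval_measureCircuit, tensor_sum_left, keep_equiv, map_sum, map_sum]
  refine Finset.sum_congr rfl fun s _ => ?_
  have h1 : rename ((rightComm ι η χ).trans (Equiv.refl _)).symm
      (tensor (tensor (proj x s σ) (basisState s)) (basisState h)) =
      tensor (tensor (proj x s σ) (basisState h)) (basisState s) := by
    rw [← rename_rightComm (proj x s σ) (basisState s) (basisState h)]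
    rfl
  rw [h1, Circuit.eval_withInput, Circuit.eval_discard, load_equiv, rename_sumAssoc,
    keep_sumMap_tensor, keep_answerWires, replace_basisState]

omit [DecidableEq ι] [DecidableEq χ] [DecidableEq η] in
lemma size_recordCircuit (x : χ ↪ ι) (r : χ ↪ η) :
    (recordCircuit x r).size ≤
      4 * Fintype.card ι + 4 * Fintype.card η + 8 * Fintype.card χ := by
  refine (Circuit.size_comp _ _ _).trans ?_
  rw [Circuit.size_withOutput, Circuit.size_onLeft, size_measureCircuit, Circuit.size_withInput,
    Circuit.size_discard]
  simp only [Fintype.card_sum]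
  omega

end Measure

/-! ### Controlled replacement of a register -/

section Control

variable {ι η ν κ : Type} [Fintype ι] [DecidableEq ι] [Fintype η] [DecidableEq η]
  [Fintype ν] [DecidableEq ν] [Fintype κ] [DecidableEq κ]

/-- The gates of a controlled swap of two wires. -/
def cswapOps (c p q : κ) (hpq : p ≠ q) (hcp : c ≠ p) (hcq : c ≠ q) : List (Gate κ) :=
  [.cnot q p hpq.symm, .toffoli c p q hcp hcq hpq, .cnot q p hpq.symm]

/-- A swap is a product of three CNOT gates. Controlling the middle one suffices, because the outer
two cancel when it is absent. -/
lemma fold_cswapOps (c p q : κ) (hpq : p ≠ q) (hcp : c ≠ p) (hcq : c ≠ q) (ρ : Op κ) :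
    gateSem.fold () (cswapOps c p q hpq hcp hcq) ρ =
      ρ.submatrix (fun v => if v c then v ∘ Equiv.swap p q else v)
        (fun v => if v c then v ∘ Equiv.swap p q else v) := by
  change Gate.apply _ (Gate.apply _ (Gate.apply _ ρ)) = _
  rw [Gate.apply_cnot, Gate.apply_cnot, Gate.apply_toffoli, submatrix_submatrix,
    submatrix_submatrix, ← Function.comp_assoc]
  have : ((fun v : κ → Bool => Function.update v p (xor (v p) (v q))) ∘
      fun v => Function.update v q (xor (v q) (v c && v p))) ∘
      (fun v => Function.update v p (xor (v p) (v q))) =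
      fun v => if v c then v ∘ Equiv.swap p q else v := by
    funext v i
    simp only [Function.comp_apply, Function.update_self, Function.update_of_ne hpq,
      Function.update_of_ne hpq.symm, Function.update_of_ne hcp]
    by_cases hp : i = p
    · subst hp
      rw [Function.update_self]
      cases h : v c <;> cases h1 : v i <;> cases h2 : v q <;> simp [h1, h2]
    · rw [Function.update_of_ne hp]
      by_cases hq : i = q
      · subst hq
        rw [Function.update_self]
        cases h : v c <;> cases h1 : v i <;> cases h2 : v p <;> simp [h1, h2]
      · rw [Function.update_of_ne hq, Function.update_of_ne hp]
        cases h : v c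
        · simp
        · simp [Equiv.swap_apply_of_ne_of_ne hp hq]
  rw [this]

/-- Exchange the wires `y j` of the left part with the wires `j` of the right part, for the `j` in
a list. -/
def swapOn (y : ν ↪ ι) : List ν → ι ⊕ ν → ι ⊕ ν
  | [] => id
  | j :: l => swapOn y l ∘ Equiv.swap (Sum.inl (y j)) (Sum.inr j)

omit [Fintype ι] [Fintype ν] in
-- For distinct `j` the transpositions move disjoint pairs of wires, so each pair is exchanged
-- exactly when its `j` is listed.
lemma swapOn_spec (y : ν ↪ ι) (l : List ν) (hl : l.Nodup) :
    (∀ j ∈ l, swapOn y l (.inr j) = .inl (y j) ∧ swapOn y l (.inl (y j)) = .inr j) ∧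
      (∀ j ∉ l, swapOn y l (.inr j) = .inr j ∧ swapOn y l (.inl (y j)) = .inl (y j)) ∧
      ∀ i, (∀ j, y j ≠ i) → swapOn y l (.inl i) = .inl i := by
  induction l with
  | nil => simp [swapOn]
  | cons k l ih =>
    rw [List.nodup_cons] at hl
    obtain ⟨h1, h2, h3⟩ := ih hl.2
    refine ⟨fun j hj => ?_, fun j hj => ?_, fun i hi => ?_⟩
    · by_cases hjk : j = k
      · subst hjk
        simp only [swapOn, Function.comp_apply, Equiv.swap_apply_right, Equiv.swap_apply_left]
        exact ⟨(h2 j hl.1).2, (h2 j hl.1).1⟩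
      · have hj' : j ∈ l := (List.mem_cons.1 hj).resolve_left hjk
        simp only [swapOn, Function.comp_apply]
        rw [Equiv.swap_apply_of_ne_of_ne (by simp) (by simpa using hjk),
          Equiv.swap_apply_of_ne_of_ne (by simpa using hjk) (by simp)]
        exact h1 j hj'
    · rw [List.mem_cons, not_or] at hj
      simp only [swapOn, Function.comp_apply]
      rw [Equiv.swap_apply_of_ne_of_ne (by simp) (by simpa using hj.1),
        Equiv.swap_apply_of_ne_of_ne (by simpa using hj.1) (by simp)]
      exact h2 j hj.2
    · simp only [swapOn, Function.comp_apply]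
      rw [Equiv.swap_apply_of_ne_of_ne (by simpa using (hi k).symm) (by simp)]
      exact h3 i hi

omit [Fintype ι] in
lemma swapOn_univ (y : ν ↪ ι) : swapOn y Finset.univ.toList = swapFun y := by
  obtain ⟨h1, -, h3⟩ := swapOn_spec y Finset.univ.toList (Finset.nodup_toList _)
  funext i
  rcases i with i | j
  · by_cases h : ∃ j, y j = i
    · obtain ⟨j, rfl⟩ := h
      rw [(h1 j (by simp)).2]
      simp [swapFun, y.injective.extend_apply]
    · rw [h3 i (by push Not at h; exact h)]
      simp [swapFun, Function.extend_apply' _ _ _ h]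
  · rw [(h1 j (by simp)).1]
    rfl

/-- The gates of a controlled swap of registers. -/
def controlOps (y : ν ↪ ι) (c : κ) (l : List ν) : List (Gate ((ι ⊕ ν) ⊕ κ)) :=
  l.flatMap fun j => cswapOps (.inr c) (.inl (.inl (y j))) (.inl (.inr j)) (by simp) (by simp)
    (by simp)

lemma fold_controlOps (y : ν ↪ ι) (c : κ) (l : List ν) (ρ : Op ((ι ⊕ ν) ⊕ κ)) :
    gateSem.fold () (controlOps y c l) ρ =
      ρ.submatrix (fun v => if v (.inr c) then Sum.elim (v ∘ Sum.inl ∘ swapOn y l) (v ∘ Sum.inr)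
        else v) (fun v => if v (.inr c) then Sum.elim (v ∘ Sum.inl ∘ swapOn y l) (v ∘ Sum.inr)
        else v) := by
  induction l generalizing ρ with
  | nil =>
    have : (fun v : (ι ⊕ ν) ⊕ κ → Bool => if v (.inr c) then
        Sum.elim (v ∘ Sum.inl ∘ swapOn y []) (v ∘ Sum.inr) else v) = id := by
      funext v i
      rcases i with i | i <;> simp [swapOn]
    rw [this]
    rfl
  | cons j l ih =>
    rw [controlOps, List.flatMap_cons, Sem.fold_append, fold_cswapOps]
    change gateSem.fold () (controlOps y c l) _ = _
    rw [ih, submatrix_submatrix]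
    have : ((fun v : (ι ⊕ ν) ⊕ κ → Bool => if v (.inr c) then
          v ∘ Equiv.swap (Sum.inl (Sum.inl (y j))) (Sum.inl (Sum.inr j)) else v) ∘
        fun v => if v (.inr c) then Sum.elim (v ∘ Sum.inl ∘ swapOn y l) (v ∘ Sum.inr) else v) =
        fun v => if v (.inr c) then Sum.elim (v ∘ Sum.inl ∘ swapOn y (j :: l)) (v ∘ Sum.inr)
          else v := by
      funext v
      rw [Function.comp_apply]
      cases h : v (.inr c)
      · simp [h]
      · simp only [if_true, Sum.elim_inr, Function.comp_apply, h]
        funext i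
        rcases i with i | i
        · have : Equiv.swap (Sum.inl (Sum.inl (y j))) (Sum.inl (Sum.inr j)) (Sum.inl i) =
              (Sum.inl (Equiv.swap (Sum.inl (y j)) (Sum.inr j) i) : (ι ⊕ ν) ⊕ κ) := by
            simp only [Equiv.swap_apply_def, Sum.inl.injEq]
            split_ifs <;> rfl
          simp [this, swapOn]
        · rw [Function.comp_apply, Equiv.swap_apply_of_ne_of_ne (by simp) (by simp)]
          rfl
    rw [this]

/-- Exchange two registers if a control wire is set. -/
def controlCircuit (ι : Type) [Fintype ι] (y : ν ↪ ι) (η : Type) [Fintype η] :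
    Circuit Gate ((ι ⊕ ν) ⊕ (η ⊕ Unit)) (ι ⊕ η) :=
  Circuit.ofWires gateSem _ (Function.Embedding.refl _)
    (controlOps y (Sum.inr () : η ⊕ Unit) Finset.univ.toList)
    (Function.Embedding.inl.sumMap Function.Embedding.inl)

/-- The flag and the right register of the exchange are discarded at the end. When the flag is off,
this discards `τ` itself and contributes its trace, which explains the hypothesis `hτ`. -/
lemma eval_controlCircuit (y : ν ↪ ι) (σ : Op ι) (τ : Op ν) (hτ : τ.trace = 1) (h : η → Bool)
    (b : Bool) :
    (controlCircuit ι y η).eval gateSem ()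
        (tensor (tensor σ τ) (basisState (Sum.elim h fun _ => b))) =
      tensor (if b then replace y τ σ else σ) (basisState h) := by
  rw [controlCircuit, Circuit.eval_ofWires, load_refl, fold_controlOps, swapOn_univ]
  have h1 : (tensor (tensor σ τ) (basisState (Sum.elim h fun _ : Unit => b))).submatrix
      (fun v => if v (.inr (.inr ())) then Sum.elim (v ∘ Sum.inl ∘ swapFun y) (v ∘ Sum.inr) else v)
      (fun v => if v (.inr (.inr ())) then Sum.elim (v ∘ Sum.inl ∘ swapFun y) (v ∘ Sum.inr) else v)
      = tensor (if b then rename (swapWires y).symm (tensor σ τ) else tensor σ τ)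
        (basisState (Sum.elim h fun _ => b)) := by
    ext u v
    have hr : ∀ u : (ι ⊕ ν) ⊕ (η ⊕ Unit) → Bool, (if u (.inr (.inr ())) then
        Sum.elim (u ∘ Sum.inl ∘ swapFun y) (u ∘ Sum.inr) else u) ∘ Sum.inr = u ∘ Sum.inr := by
      intro u
      split_ifs <;> rfl
    rw [submatrix_apply, tensor_apply, tensor_apply (if b then _ else _), hr, hr, basisState_apply]
    -- On the support of the basis state both indices carry the flag `b`, so rows and columns
    -- undergo the same substitution; elsewhere both sides vanish.
    by_cases hw : (Sum.elim h fun _ => b) = u ∘ Sum.inr ∧ (Sum.elim h fun _ => b) = v ∘ Sum.inr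
    · have hu : u (.inr (.inr ())) = b := (congr_fun hw.1 (.inr ())).symm
      have hv : v (.inr (.inr ())) = b := (congr_fun hw.2 (.inr ())).symm
      rw [hu, hv]
      cases b <;> rfl
    · rw [if_neg hw, mul_zero, mul_zero]
  rw [h1, keep_sumMap_sumMap_tensor, keep_basisState]
  congr 1
  cases b
  · simp only [Bool.false_eq_true, if_false]
    rw [keep_inl_tensor, hτ, one_smul]
  · simp only [if_true]
    rw [← keep_equiv, ← keep_trans]
    exact keep_answerWires y σ τ

omit [DecidableEq ι] [DecidableEq η] [DecidableEq ν] in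
lemma size_controlCircuit (y : ν ↪ ι) :
    (controlCircuit ι y η).size =
      5 * Fintype.card ν + 2 * Fintype.card ι + 2 * Fintype.card η + 2 := by
  rw [controlCircuit, Circuit.size_ofWires]
  simp [controlOps, cswapOps, List.length_flatMap]
  ring

/-- Replace the register `y` by the last register if a flag computed from the history is set. -/
def condReplace (y : ν ↪ ι) (B : Circuit Gate η (η ⊕ Unit)) :
    Circuit Gate ((ι ⊕ η) ⊕ ν) (ι ⊕ η) :=
  Circuit.comp gateSem
    ((B.onRight gateSem (ι ⊕ ν)).withInput (rightComm ι η ν).toEmbedding)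
    (controlCircuit ι y η)

lemma eval_condReplace (y : ν ↪ ι) (B : Circuit Gate η (η ⊕ Unit)) (h : η → Bool) (b : Bool)
    (hB : B.eval gateSem () (basisState h) = basisState (Sum.elim h fun _ => b))
    (σ : Op ι) (τ : Op ν) (hτ : τ.trace = 1) :
    (condReplace y B).eval gateSem () (tensor (tensor σ (basisState h)) τ) =
      tensor (if b then replace y τ σ else σ) (basisState h) := by
  rw [condReplace, Circuit.eval_comp, Circuit.eval_withInput, load_equiv, rename_rightComm,
    Circuit.eval_onRight, hB, eval_controlCircuit _ _ _ hτ]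

omit [DecidableEq ι] [DecidableEq ν] [DecidableEq η] in
lemma size_condReplace (y : ν ↪ ι) (B : Circuit Gate η (η ⊕ Unit)) :
    (condReplace y B).size ≤
      B.size + (7 * Fintype.card ν + 4 * Fintype.card ι + 2 * Fintype.card η + 2) := by
  refine (Circuit.size_comp _ _ _).trans ?_
  rw [Circuit.size_withInput, Circuit.size_onRight, size_controlCircuit, Fintype.card_sum]
  omega

/-- Replace the register `y` by each register of a family in turn, if the corresponding flag is
set. -/
def selectAnswer (y : ν ↪ ι) : (m : ℕ) → (Fin m → Bool) → (Fin m → Op ν) → Op ι → Op ι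
  | 0, _, _, σ => σ
  | m + 1, b, φ, σ => selectAnswer y m (fun j => b j.castSucc) (fun j => φ j.castSucc)
      (if b (Fin.last m) then replace y (φ (Fin.last m)) σ else σ)

omit [Fintype ι] [DecidableEq ι] in
/-- The first flag that is set decides. -/
lemma selectAnswer_eq (y : ν ↪ ι) (m : ℕ) (b : Fin m → Bool) (φ : Fin m → Op ν)
    (hφ : ∀ j, (φ j).trace = 1) (c : Fin m) (hc : b c = true) (hlt : ∀ j < c, b j = false)
    (σ : Op ι) : selectAnswer y m b φ σ = replace y (φ c) σ := by
  have hno : ∀ (m : ℕ) (b : Fin m → Bool) (φ : Fin m → Op ν) (σ : Op ι), (∀ j, b j = false) →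
      selectAnswer y m b φ σ = σ := by
    intro m
    induction m with
    | zero => intros; rfl
    | succ m ih =>
      intro b φ σ hb
      rw [selectAnswer, ih _ _ _ fun j => hb _, hb]
      rfl
  induction m generalizing σ with
  | zero => exact c.elim0
  | succ m ih =>
    rw [selectAnswer]
    -- The members are processed from the last to the first. If `c` is the last one, nothing happens
    -- afterwards; otherwise whatever the last member did is overwritten by member `c`.
    induction c using Fin.lastCases with
    | last =>
      rw [hno _ _ _ _ fun j => hlt _ (Fin.castSucc_lt_last j), hc]
      rfl
    | cast c =>
      rw [ih _ _ (fun j => hφ _) c hc fun j hj => hlt _ (Fin.castSucc_lt_castSucc_iff.2 hj)]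
      split_ifs
      · rw [replace_replace _ _ _ (hφ _)]
      · rfl

/-- The circuit that performs `selectAnswer`. -/
def selectCircuit (y : ν ↪ ι) : (m : ℕ) → (Fin m → Circuit Gate η (η ⊕ Unit)) →
    Circuit Gate ((ι ⊕ η) ⊕ (Fin m × ν)) (ι ⊕ η)
  | 0, _ => Circuit.discard gateSem Function.Embedding.inl
  | m + 1, B => (Circuit.comp gateSem
      ((condReplace y (B (Fin.last m))).onLeft gateSem (Fin m × ν))
      (selectCircuit y m fun j => B j.castSucc)).withInput
        (((Equiv.refl (ι ⊕ η)).sumCongr (peelLast m ν)).trans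
          (Equiv.sumAssoc (ι ⊕ η) ν (Fin m × ν)).symm).toEmbedding

lemma eval_selectCircuit (y : ν ↪ ι) (h : η → Bool) (m : ℕ)
    (B : Fin m → Circuit Gate η (η ⊕ Unit)) (b : Fin m → Bool)
    (hB : ∀ j, (B j).eval gateSem () (basisState h) = basisState (Sum.elim h fun _ => b j))
    (φ : Fin m → Op ν) (hφ : ∀ j, (φ j).trace = 1) (σ : Op ι) :
    (selectCircuit y m B).eval gateSem () (tensor (tensor σ (basisState h)) (tensorFam φ)) =
      tensor (selectAnswer y m b φ σ) (basisState h) := by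
  induction m generalizing σ with
  | zero =>
    rw [selectCircuit, Circuit.eval_discard, keep_inl_tensor, trace_tensorFam]
    simp [selectAnswer]
  | succ m ih =>
    rw [selectCircuit, Circuit.eval_withInput, load_equiv, rename_trans, rename_sumCongr,
      rename_refl, rename_peelLast, rename_sumAssoc_symm, Circuit.eval_comp, Circuit.eval_onLeft,
      eval_condReplace _ _ _ _ (hB _) _ _ (hφ _),
      ih (fun j => B j.castSucc) (fun j => b j.castSucc) (fun j => hB _) (fun j => φ j.castSucc)
        (fun j => hφ _)]
    rfl

omit [DecidableEq ι] [DecidableEq ν] [DecidableEq η] in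
lemma size_selectCircuit (y : ν ↪ ι) (m s : ℕ) (B : Fin m → Circuit Gate η (η ⊕ Unit))
    (hB : ∀ j, (B j).size ≤ s) (M : ℕ) (hM : m ≤ M) :
    (selectCircuit y m B).size ≤
      m * (s + (7 * Fintype.card ν + 4 * Fintype.card ι + 2 * Fintype.card η + 2) +
        2 * (M * Fintype.card ν)) + 2 * (Fintype.card ι + Fintype.card η) := by
  induction m with
  | zero =>
    rw [selectCircuit, Circuit.size_discard]
    simp
  | succ m ih =>
    rw [selectCircuit, Circuit.size_withInput]
    refine (Circuit.size_comp _ _ _).trans ?_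
    rw [Circuit.size_onLeft]
    have h1 := size_condReplace y (B (Fin.last m))
    have h2 := hB (Fin.last m)
    have h3 := ih (fun j => B j.castSucc) (fun j => hB _) (by omega)
    have h4 : m * Fintype.card ν ≤ M * Fintype.card ν := Nat.mul_le_mul_right _ (by omega)
    rw [Fintype.card_prod, Fintype.card_fin, add_mul]
    omega

end Control

/-! ### Comparing records -/

section Records

variable {t d : ℕ}

/-- The register of the history that holds the record number `i`. -/
def recordReg (d : ℕ) (i : Fin t) : Fin d ↪ Fin t × Fin d :=
  ⟨fun l => (i, l), fun _ _ h => (Prod.mk.inj h).2⟩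

/-- The records `i` and `j` agree. -/
def sameRecord (i j : Fin t) (h : Fin t × Fin d → Bool) : Bool :=
  decide (∀ l, h (j, l) = h (i, l))

/-- A bound for the size of a circuit that compares two records. -/
def compareCost (t d : ℕ) : ℕ :=
  (d * 8 + 1) * (6 * (t * d + 2 + d * 8) + 16) + 3 * (t * d + 1)

/-- Equality is accumulated bit by bit. Each extension is determined by three bits, the verdict so
far and the two bits to be compared, and so costs at most `2 ^ 3 = 8` gates. -/
lemma exists_compareCircuit (i j : Fin t) :
    ∃ B : Circuit Gate (Fin t × Fin d) ((Fin t × Fin d) ⊕ Unit), B.size ≤ compareCost t d ∧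
      ∀ h, B.eval gateSem () (basisState h) =
        basisState (Sum.elim h fun _ => sameRecord i j h) := by
  have key : ∀ l ≤ d, ∃ L, Reach (l * 8) (baseFunctions (Fin t × Fin d)) L ∧
      (fun h : Fin t × Fin d → Bool =>
        decide (∀ l' : Fin d, (l' : ℕ) < l → h (j, l') = h (i, l'))) ∈ L := by
    intro l hl
    induction l with
    | zero =>
      refine ⟨baseFunctions (Fin t × Fin d), by simpa using Reach.refl _, Or.inl ⟨true, ?_⟩⟩
      funext h
      simp
    | succ l ih =>
      obtain ⟨L, hr, hm⟩ := ih (by omega)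
      obtain ⟨L', hr', hm'⟩ := Reach.exists_of_determined L
        (fun b => hr.subset (Or.inl ⟨b, rfl⟩))
        ![fun h : Fin t × Fin d → Bool =>
          decide (∀ l' : Fin d, (l' : ℕ) < l → h (j, l') = h (i, l')),
          fun h => h (j, ⟨l, hl⟩), fun h => h (i, ⟨l, hl⟩)]
        (fun a => by
          fin_cases a
          · exact hm
          · exact hr.subset (Or.inr ⟨_, rfl⟩)
          · exact hr.subset (Or.inr ⟨_, rfl⟩))
        (fun h => decide (∀ l' : Fin d, (l' : ℕ) < l + 1 → h (j, l') = h (i, l')))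
        (fun h h' hh => by
          have h0 := hh 0
          have h1 := hh 1
          have h2 := hh 2
          simp only [Matrix.cons_val_zero, Matrix.cons_val_one, Matrix.cons_val] at h0 h1 h2
          have hs : ∀ h : Fin t × Fin d → Bool,
              (∀ l' : Fin d, (l' : ℕ) < l + 1 → h (j, l') = h (i, l')) ↔
              (∀ l' : Fin d, (l' : ℕ) < l → h (j, l') = h (i, l')) ∧
                h (j, ⟨l, hl⟩) = h (i, ⟨l, hl⟩) := by
            intro h
            constructor
            · exact fun H => ⟨fun l' hl' => H l' (by omega), H ⟨l, hl⟩ (by simp)⟩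
            · rintro ⟨H, H'⟩ l' hl'
              rcases Nat.lt_succ_iff_lt_or_eq.1 hl' with hl' | rfl
              · exact H l' hl'
              · exact H'
          simp only [hs, Bool.decide_and, h0, h1, h2])
      refine ⟨L', (hr.trans hr').mono ?_, hm'⟩
      rw [Fintype.card_fin, add_mul]
      exact le_rfl
  obtain ⟨L, hr, hm⟩ := key d le_rfl
  obtain ⟨B, hs, hB⟩ := exists_circuit_of_reach hr
    (fun h => Sum.elim h fun _ : Unit => sameRecord i j h) (by
      rintro (a | _)
      · exact hr.subset (Or.inr ⟨a, rfl⟩)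
      · convert hm using 2
        simp [sameRecord])
  refine ⟨B, hs.trans (le_of_eq ?_), hB⟩
  simp [compareCost]

/-- A circuit that compares two records. -/
def compareCircuit (i j : Fin t) : Circuit Gate (Fin t × Fin d) ((Fin t × Fin d) ⊕ Unit) :=
  (exists_compareCircuit i j).choose

end Records

/-! ### Lazy sampling -/

section Lazy

variable {d n w : ℕ} (t : ℕ) [NeZero t]

/-- Run a list of instructions, where the answer to a query is the state `φ j` for the first record
`j` that agrees with the query. -/
def lazyEval (φ : Fin t → Op (Fin n)) :
    List (OracleGate d n (Fin w)) → ℕ → (Fin t × Fin d → Bool) → Op (Fin w) → Op (Fin w)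
  | [], _, _, σ => σ
  | .gate g :: l, i, h, σ => lazyEval φ l i h (g.apply σ)
  | .query x y _ :: l, i, h, σ => ∑ s : Fin d → Bool,
      let h' := Function.extend (recordReg d (Fin.ofNat t i)) s h
      lazyEval φ l (i + 1) h' (selectAnswer y t (fun j => sameRecord (Fin.ofNat t i) j h') φ
        (proj x s σ))

/-- Apply a gate. -/
def gateCircuit (g : Gate (Fin w)) : Circuit Gate (Fin w) (Fin w) :=
  Circuit.ofWires gateSem (Fin w) (Function.Embedding.refl _) [g] (Function.Embedding.refl _)

lemma eval_gateCircuit (g : Gate (Fin w)) (σ : Op (Fin w)) :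
    (gateCircuit g).eval gateSem () σ = g.apply σ := by
  rw [gateCircuit, Circuit.eval_ofWires, keep_refl, load_refl]
  rfl

/-- The circuit for one query: record it, and answer it from the registers that are supplied. -/
def queryCircuit (x : Fin d ↪ Fin w) (y : Fin n ↪ Fin w) (i : Fin t) :
    Circuit Gate ((Fin w ⊕ (Fin t × Fin d)) ⊕ (Fin t × Fin n)) (Fin w ⊕ (Fin t × Fin d)) :=
  Circuit.comp gateSem ((recordCircuit x (recordReg d i)).onLeft gateSem (Fin t × Fin n))
    (selectCircuit y t (compareCircuit i))

omit [NeZero t] in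
lemma eval_queryCircuit (x : Fin d ↪ Fin w) (y : Fin n ↪ Fin w) (i : Fin t)
    (φ : Fin t → Op (Fin n)) (hφ : ∀ j, (φ j).trace = 1) (σ : Op (Fin w))
    (h : Fin t × Fin d → Bool) :
    (queryCircuit t x y i).eval gateSem () (tensor (tensor σ (basisState h)) (tensorFam φ)) =
      ∑ s, tensor (selectAnswer y t
        (fun j => sameRecord i j (Function.extend (recordReg d i) s h)) φ (proj x s σ))
        (basisState (Function.extend (recordReg d i) s h)) := by
  rw [queryCircuit, Circuit.eval_comp, Circuit.eval_onLeft, eval_recordCircuit, tensor_sum_left,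
    map_sum]
  refine Finset.sum_congr rfl fun s _ => ?_
  exact eval_selectCircuit y _ t _ _ (fun j => (exists_compareCircuit i j).choose_spec.2 _) φ hφ _

/-- The cost of one query. -/
def queryCost (w d n t : ℕ) : ℕ :=
  4 * w + 4 * (t * d) + 8 * d + 2 * (t * n) +
    (t * (compareCost t d + (7 * n + 4 * w + 2 * (t * d) + 2) + 2 * (t * n)) +
      2 * (w + t * d))

omit [NeZero t] in
lemma size_queryCircuit (x : Fin d ↪ Fin w) (y : Fin n ↪ Fin w) (i : Fin t) :
    (queryCircuit t x y i).size ≤ queryCost w d n t := by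
  refine (Circuit.size_comp _ _ _).trans (Nat.add_le_add ?_ ?_)
  · rw [Circuit.size_onLeft]
    have := size_recordCircuit x (recordReg d i)
    simp only [Fintype.card_prod, Fintype.card_fin] at this ⊢
    omega
  · have := size_selectCircuit y t (compareCost t d) (compareCircuit (d := d) i)
      (fun j => (exists_compareCircuit i j).choose_spec.1) t le_rfl
    simpa only [Fintype.card_prod, Fintype.card_fin] using this

/-- The circuit that performs `lazyEval`, with `r` copies of the possible answers. -/
def lazyCircuit : List (OracleGate d n (Fin w)) → ℕ → (r : ℕ) →
    Circuit Gate ((Fin w ⊕ (Fin t × Fin d)) ⊕ (Fin r × (Fin t × Fin n))) (Fin w)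
  | [], _, _ => Circuit.discard gateSem (Function.Embedding.inl.trans Function.Embedding.inl)
  | .gate g :: l, i, r => Circuit.comp gateSem
      (((gateCircuit g).onLeft gateSem (Fin t × Fin d)).onLeft gateSem (Fin r × (Fin t × Fin n)))
      (lazyCircuit l i r)
  | .query _ _ _ :: _, _, 0 =>
      Circuit.discard gateSem (Function.Embedding.inl.trans Function.Embedding.inl)
  | .query x y _ :: l, i, r + 1 => (Circuit.comp gateSem
      ((queryCircuit t x y (Fin.ofNat t i)).onLeft gateSem (Fin r × (Fin t × Fin n)))
      (lazyCircuit l (i + 1) r)).withInput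
        (((Equiv.refl (Fin w ⊕ (Fin t × Fin d))).sumCongr (peelLast r (Fin t × Fin n))).trans
          (Equiv.sumAssoc _ _ _).symm).toEmbedding

/-- A query uses up one copy of every `φ j`, whichever is selected, so as many families as remaining
instructions suffice. Surplus families are discarded and contribute trace one. -/
lemma eval_lazyCircuit (φ : Fin t → Op (Fin n)) (hφ : ∀ j, (φ j).trace = 1)
    (l : List (OracleGate d n (Fin w))) (i r : ℕ) (hr : l.length ≤ r)
    (h : Fin t × Fin d → Bool) (σ : Op (Fin w)) :
    (lazyCircuit t l i r).eval gateSem ()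
      (tensor (tensor σ (basisState h)) (tensorPow r (tensorFam φ))) = lazyEval t φ l i h σ := by
  induction l generalizing i r h σ with
  | nil =>
    rw [lazyCircuit, Circuit.eval_discard, keep_trans, keep_inl_tensor, tensorPow_eq_tensorFam,
      trace_tensorFam, trace_tensorFam]
    simp only [hφ, Finset.prod_const_one, one_smul]
    rw [keep_inl_tensor, trace_basisState, one_smul]
    rfl
  | cons g l ih =>
    rw [List.length_cons] at hr
    cases g with
    | gate g =>
      rw [lazyCircuit, Circuit.eval_comp, Circuit.eval_onLeft, Circuit.eval_onLeft,
        eval_gateCircuit, ih i r (by omega)]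
      rfl
    | query x y hxy =>
      obtain ⟨r, rfl⟩ : ∃ r', r = r' + 1 := ⟨r - 1, by omega⟩
      rw [lazyCircuit, Circuit.eval_withInput, load_equiv, rename_trans, rename_sumCongr,
        rename_refl, tensorPow_eq_tensorFam, rename_peelLast, rename_sumAssoc_symm,
        Circuit.eval_comp, Circuit.eval_onLeft, eval_queryCircuit t x y _ φ hφ, tensor_sum_left,
        map_sum]
      refine Finset.sum_congr rfl fun s _ => ?_
      exact ih (i + 1) r (by omega) _ _

/-- `M` stays fixed while `r` decreases in the induction, which makes the bound per instruction
uniform. -/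
lemma size_lazyCircuit (l : List (OracleGate d n (Fin w))) (i r M : ℕ) (hr : r ≤ M) :
    (lazyCircuit t l i r).size ≤ l.length * (1 + 2 * w + queryCost w d n t + 2 * (M * (t * n))) +
      2 * (w + t * d + M * (t * n)) := by
  induction l generalizing i r with
  | nil =>
    rw [lazyCircuit, Circuit.size_discard]
    simp only [Fintype.card_sum, Fintype.card_prod, Fintype.card_fin, List.length_nil, zero_mul,
      zero_add]
    gcongr
  | cons g l ih =>
    have hM : r * (t * n) ≤ M * (t * n) := Nat.mul_le_mul_right _ hr
    rw [List.length_cons, add_mul, one_mul]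
    cases g with
    | gate g =>
      rw [lazyCircuit]
      refine (Circuit.size_comp _ _ _).trans ?_
      rw [Circuit.size_onLeft, Circuit.size_onLeft, gateCircuit, Circuit.size_ofWires]
      have h1 := ih i r hr
      have h2 : 2 * (t * d) ≤ queryCost w d n t := by
        rw [queryCost]
        omega
      simp only [Fintype.card_prod, Fintype.card_fin, List.length_singleton]
      omega
    | query x y hxy =>
      cases r with
      | zero =>
        rw [lazyCircuit, Circuit.size_discard]
        simp only [Fintype.card_sum, Fintype.card_prod, Fintype.card_fin, zero_mul]
        omega
      | succ r =>
        rw [lazyCircuit, Circuit.size_withInput]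
        refine (Circuit.size_comp _ _ _).trans ?_
        rw [Circuit.size_onLeft]
        have h1 := ih (i + 1) r (by omega)
        have h2 := size_queryCircuit t x y (Fin.ofNat t i)
        rw [add_mul] at hM
        simp only [Fintype.card_prod, Fintype.card_fin]
        omega

end Lazy

/-! ### Random answers -/

section Reindex

variable {T A B : Type} [MeasurableSpace T] [Fintype A] [Fintype B] (μ : Measure T)
  [IsProbabilityMeasure μ]

/-- On boxes: coordinates outside the range of `e` are unconstrained and contribute total mass one.
This covers both marginals and permutations of independent samples. -/
lemma measurePreserving_comp_embedding (e : B ↪ A) :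
    MeasurePreserving (fun ω : A → T => ω ∘ e) (Measure.pi fun _ => μ) (Measure.pi fun _ => μ) := by
  have hm : Measurable fun ω : A → T => ω ∘ e :=
    measurable_pi_iff.2 fun b => measurable_pi_apply (e b)
  refine ⟨hm, (Measure.pi_eq fun s hs => ?_).symm⟩
  rw [Measure.map_apply hm (MeasurableSet.univ_pi hs)]
  have : (fun ω : A → T => ω ∘ e) ⁻¹' Set.univ.pi s =
      Set.univ.pi (Function.extend e s fun _ => Set.univ) := by
    ext ω
    simp only [Set.mem_preimage, Set.mem_pi, Set.mem_univ, true_imp_iff, Function.comp_apply]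
    constructor
    · intro h a
      by_cases ha : ∃ b, e b = a
      · obtain ⟨b, rfl⟩ := ha
        rw [e.injective.extend_apply]
        exact h b
      · rw [Function.extend_apply' _ _ _ ha]
        trivial
    · intro h b
      have := h (e b)
      rwa [e.injective.extend_apply] at this
  rw [this, Measure.pi_pi]
  refine (Fintype.prod_of_injective e e.injective _ _ (fun a ha => ?_) fun b => ?_).symm
  · rw [Function.extend_apply' _ _ _ ha, measure_univ]
  · rw [e.injective.extend_apply]

lemma integral_comp_embedding [TopologicalSpace T] [BorelSpace T] [SecondCountableTopology T]
    (e : B ↪ A) {f : (B → T) → ℝ} (hf : Continuous f) :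
    ∫ ω : A → T, f (ω ∘ e) ∂(Measure.pi fun _ => μ) = ∫ ω, f ω ∂(Measure.pi fun _ => μ) := by
  have h := measurePreserving_comp_embedding μ e
  rw [← h.map_eq, integral_map h.measurable.aemeasurable hf.aestronglyMeasurable]

end Reindex

/-- The sample spaces are compact, so the continuity lemmas below supply the integrability of the
experiments. -/
lemma integrable_of_continuous {X : Type} [TopologicalSpace X] [CompactSpace X] [MeasurableSpace X]
    [OpensMeasurableSpace X] (μ : Measure X) [IsFiniteMeasure μ] {E : Type} [NormedAddCommGroup E]
    [SecondCountableTopologyEither X E] {f : X → E} (hf : Continuous f) :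
    Integrable f μ :=
  hf.integrable_of_hasCompactSupport (HasCompactSupport.of_compactSpace f)

/-! ### Continuous dependence of the experiments on the samples -/

section Continuity

variable {X ι ν χ : Type} [TopologicalSpace X] [Fintype ι] [DecidableEq ι] [Fintype ν]
  [DecidableEq ν] [Fintype χ]

omit [Fintype ι] [DecidableEq ι] in
lemma continuous_op {f : X → Op ι} (h : ∀ u v, Continuous fun x => f x u v) : Continuous f :=
  continuous_pi fun u => continuous_pi fun v => h u v

omit [Fintype ι] [DecidableEq ι] in
lemma continuous_op_apply {f : X → Op ι} (h : Continuous f) (u v : ι → Bool) :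
    Continuous fun x => f x u v :=
  (continuous_apply v).comp ((continuous_apply u).comp h)

omit [DecidableEq ι] in
lemma continuous_linear_op {κ : Type} [Fintype κ] (L : Op ι →ₗ[ℂ] Op κ) :
    Continuous L :=
  LinearMap.continuous_of_finiteDimensional L

omit [Fintype ι] [DecidableEq ι] in
lemma continuous_replace (y : ν ↪ ι) {τ : X → Op ν} {σ : X → Op ι} (hτ : Continuous τ)
    (hσ : Continuous σ) : Continuous fun x => replace y (τ x) (σ x) :=
  continuous_op fun _ _ => (continuous_op_apply hτ _ _).mul
    (continuous_finsetSum _ fun _ _ => continuous_op_apply hσ _ _)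

omit [Fintype ι] [DecidableEq ι] in
lemma continuous_selectAnswer (y : ν ↪ ι) (m : ℕ) (b : Fin m → Bool) {φ : X → Fin m → Op ν}
    {σ : X → Op ι} (hφ : ∀ j, Continuous fun x => φ x j) (hσ : Continuous σ) :
    Continuous fun x => selectAnswer y m b (φ x) (σ x) := by
  induction m generalizing σ with
  | zero => exact hσ
  | succ m ih =>
    refine ih (fun j => b j.castSucc) (φ := fun x j => φ x j.castSucc) (fun j => hφ _) ?_
    split_ifs
    · exact continuous_replace y (hφ _) hσ
    · exact hσ

end Continuity

section EvalContinuity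

variable {X : Type} [TopologicalSpace X] {d n w : ℕ}

lemma continuous_fold (l : List (OracleGate d n (Fin w))) {O : X → (Fin d → Bool) → Op (Fin n)}
    {σ : X → Op (Fin w)} (hO : ∀ s, Continuous fun x => O x s) (hσ : Continuous σ) :
    Continuous fun x => (oracleSem d n).fold (O x) l (σ x) := by
  induction l generalizing σ with
  | nil => exact hσ
  | cons g l ih =>
    simp only [Sem.fold_cons]
    refine ih ?_
    cases g with
    | gate g => exact (continuous_linear_op (Gate.act g)).comp hσ
    | query x y hxy =>
      change Continuous fun z => answerQuery (O z) x y (σ z)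
      simp only [answerQuery_eq_sum _ x y hxy]
      exact continuous_finsetSum _ fun s _ => continuous_replace y (hO s)
        ((continuous_linear_op _).comp hσ)

lemma continuous_lazyEval (t : ℕ) [NeZero t] (l : List (OracleGate d n (Fin w))) (i : ℕ)
    (h : Fin t × Fin d → Bool) {φ : X → Fin t → Op (Fin n)} {σ : X → Op (Fin w)}
    (hφ : ∀ j, Continuous fun x => φ x j) (hσ : Continuous σ) :
    Continuous fun x => lazyEval t (φ x) l i h (σ x) := by
  induction l generalizing σ i h with
  | nil => exact hσ
  | cons g l ih =>
    cases g with
    | gate g => exact ih i h ((continuous_linear_op (Gate.act g)).comp hσ)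
    | query x y hxy =>
      exact continuous_finsetSum _ fun s _ => ih _ _
        (continuous_selectAnswer y t _ hφ ((continuous_linear_op _).comp hσ))

end EvalContinuity

/-! ### Equivalence of lazy and eager sampling -/

section Sampling

variable {T : Type} [TopologicalSpace T] [CompactSpace T] [SecondCountableTopology T]
  [MeasurableSpace T] [BorelSpace T] (μ : Measure T) [IsProbabilityMeasure μ] {d n w : ℕ}
  (t : ℕ) [NeZero t]

/-- After the first `i` queries, recorded in `h`, the answer to the query `s` is the sample number
`pos s`: the one of the first record of `s`, and a new one if there is none. -/
def Positions (i : ℕ) (h : Fin t × Fin d → Bool)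
    (pos : (Fin d → Bool) → Fin t ⊕ (Fin d → Bool)) : Prop :=
  ∀ s, (pos s = .inr s ∧ ∀ j : Fin t, (j : ℕ) < i → (fun l => h (j, l)) ≠ s) ∨
    ∃ j : Fin t, pos s = .inl j ∧ (j : ℕ) < i ∧ (fun l => h (j, l)) = s ∧
      ∀ j' < j, (fun l => h (j', l)) ≠ s

/-- Both experiments live on one family of independent samples: `inl j` is the supply of the lazy
sampler and `inr s` is the sample attached to the string `s`. When query number `k` asks for a new
string `s`, the transposition of `inl k` and `inr s` preserves the product measure and leaves
unchanged everything the state has depended on so far. Up to this transposition the oracle reads its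
answer from the supply as well. For a repeated string, the first matching record and `pos` already
point to the same sample. -/
lemma integral_lazyEval {st : T → Op (Fin n)} (hst : Continuous st) (htr : ∀ θ, (st θ).trace = 1)
    (ℓ : Op (Fin w) →+ ℝ) (hℓ : Continuous ℓ) (l : List (OracleGate d n (Fin w))) (i : ℕ)
    (hi : i + l.length ≤ t) (h : Fin t × Fin d → Bool)
    (pos : (Fin d → Bool) → Fin t ⊕ (Fin d → Bool)) (hpos : Positions t i h pos)
    (σ : (Fin t ⊕ (Fin d → Bool) → T) → Op (Fin w)) (hσ : Continuous σ)
    (hdep : ∀ ω ω' : Fin t ⊕ (Fin d → Bool) → T,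
      (∀ j : Fin t, (j : ℕ) < i → ω (.inl j) = ω' (.inl j)) → σ ω = σ ω') :
    ∫ ω, ℓ (lazyEval t (fun j => st (ω (.inl j))) l i h (σ ω)) ∂(Measure.pi fun _ => μ) =
      ∫ ω, ℓ ((oracleSem d n).fold (fun s => st (ω (pos s))) l (σ ω)) ∂(Measure.pi fun _ => μ) := by
  have hcont : ∀ a : Fin t ⊕ (Fin d → Bool), Continuous fun ω : Fin t ⊕ (Fin d → Bool) → T =>
      st (ω a) := fun a => hst.comp (continuous_apply a)
  induction l generalizing i h pos σ with
  | nil => rfl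
  | cons g l ih =>
    rw [List.length_cons] at hi
    cases g with
    | gate g =>
      exact ih i (by omega) h pos hpos (fun ω => g.apply (σ ω))
        ((continuous_linear_op (Gate.act g)).comp hσ) fun ω ω' hω => by rw [hdep ω ω' hω]
    | query x y hxy =>
      have hproj : ∀ s, Continuous fun ω => proj x s (σ ω) := fun s =>
        (continuous_linear_op _).comp hσ
      have hL : ∀ ω, ℓ (lazyEval t (fun j => st (ω (.inl j))) (.query x y hxy :: l) i h (σ ω)) =
          ∑ s, ℓ (lazyEval t (fun j => st (ω (.inl j))) l (i + 1)
            (Function.extend (recordReg d (Fin.ofNat t i)) s h)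
            (selectAnswer y t (fun j => sameRecord (Fin.ofNat t i) j
              (Function.extend (recordReg d (Fin.ofNat t i)) s h)) (fun j => st (ω (.inl j)))
              (proj x s (σ ω)))) := fun ω => map_sum ℓ _ _
      have hR : ∀ ω, ℓ ((oracleSem d n).fold (fun s => st (ω (pos s))) (.query x y hxy :: l)
          (σ ω)) = ∑ s, ℓ ((oracleSem d n).fold (fun s => st (ω (pos s))) l
            (replace y (st (ω (pos s))) (proj x s (σ ω)))) := by
        intro ω
        rw [Sem.fold_cons, ← map_sum ℓ, ← map_sum]
        congr 2
        exact answerQuery_eq_sum (fun s => st (ω (pos s))) x y hxy (σ ω)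
      simp only [hL, hR]
      rw [integral_finsetSum, integral_finsetSum]
      rotate_left
      · intro s _
        exact integrable_of_continuous _ (hℓ.comp (continuous_fold l (fun s => hcont _)
          (continuous_replace y (hcont _) (hproj s))))
      · intro s _
        exact integrable_of_continuous _ (hℓ.comp (continuous_lazyEval t l _ _ (fun j => hcont _)
          (continuous_selectAnswer y t _ (fun j => hcont _) (hproj s))))
      refine Finset.sum_congr rfl fun s _ => ?_
      -- The bound `hi` keeps the query number below `t`, so `Fin.ofNat` does not wrap around and no
      -- earlier record is overwritten.
      obtain ⟨k, rfl⟩ : ∃ k : Fin t, i = k := ⟨⟨i, by omega⟩, rfl⟩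
      rw [Fin.ofNat_val_eq_self]
      set h' := Function.extend (recordReg d k) s h with hh'
      have hk : (fun l => h' (k, l)) = s := by
        funext l
        exact (recordReg d k).injective.extend_apply _ _ l
      have hne : ∀ j, j ≠ k → (fun l => h' (j, l)) = fun l => h (j, l) := by
        intro j hj
        funext l
        exact extend_off _ _ _ fun m hm => hj (Prod.mk.inj hm).1.symm
      have hflag : ∀ j, sameRecord k j h' = decide ((fun l => h' (j, l)) = s) := by
        intro j
        rw [← hk, sameRecord]
        simp only [funext_iff]
      have hdep' : ∀ ω ω' : Fin t ⊕ (Fin d → Bool) → T,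
          (∀ j : Fin t, (j : ℕ) < k + 1 → ω (.inl j) = ω' (.inl j)) →
          proj x s (σ ω) = proj x s (σ ω') :=
        fun ω ω' hω => by rw [hdep ω ω' fun j hj => hω j (by omega)]
      rcases hpos s with ⟨hs, hnew⟩ | ⟨c, hs, hck, hc, hfirst⟩
      · have hsel : ∀ ω : Fin t ⊕ (Fin d → Bool) → T,
            selectAnswer y t (fun j => sameRecord k j h') (fun j => st (ω (.inl j)))
              (proj x s (σ ω)) = replace y (st (ω (.inl k))) (proj x s (σ ω)) := by
          intro ω
          -- Record `k` has just received `s`, so the search ends at `k` at the latest; accidental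
          -- matches with blank records after `k` have no influence.
          refine selectAnswer_eq y t _ _ (fun j => htr _) k ?_ (fun j hj => ?_) _
          · simp [hflag, hk]
          · rw [hflag, hne j hj.ne, decide_eq_false_iff_not]
            exact hnew j hj
        simp only [hsel]
        rw [ih (k + 1) (by omega) h' (Function.update pos s (.inl k)) ?_
          (fun ω => replace y (st (ω (.inl k))) (proj x s (σ ω)))
          (continuous_replace y (hcont _) (hproj s))
          (fun ω ω' hω => by rw [hdep' ω ω' hω, hω k (by omega)])]
        -- The induction hypothesis concerns an oracle that reads the answer to `s` from `inl k`;
        -- the transposition turns it back into the oracle given by `pos`.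
        · refine (integral_comp_embedding μ (Equiv.swap (Sum.inl k) (Sum.inr s)).toEmbedding
            (f := fun ω => ℓ ((oracleSem d n).fold
              (fun s' => st (ω (Function.update pos s (Sum.inl k) s'))) l
              (replace y (st (ω (Sum.inl k))) (proj x s (σ ω)))))
            (hℓ.comp (continuous_fold l (fun s' => hcont _)
              (continuous_replace y (hcont _) (hproj s))))).symm.trans ?_
          refine integral_congr_ae (Filter.Eventually.of_forall fun ω => ?_)
          have h1 : ∀ s', Equiv.swap (Sum.inl k) (Sum.inr s)
              (Function.update pos s (.inl k) s') = pos s' := by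
            intro s'
            by_cases hss : s' = s
            · subst hss
              rw [Function.update_self, Equiv.swap_apply_left, hs]
            · rw [Function.update_of_ne hss]
              rcases hpos s' with ⟨hs', -⟩ | ⟨c, hs', hck, -⟩
              · rw [hs', Equiv.swap_apply_of_ne_of_ne (by simp) (by simpa using hss)]
              · rw [hs', Equiv.swap_apply_of_ne_of_ne _ (by simp)]
                rintro ⟨⟩
                exact lt_irrefl _ hck
          -- So far the state depends only on supply samples with number below `k`, which the
          -- transposition fixes.
          have h2 : σ (ω ∘ Equiv.swap (Sum.inl k) (Sum.inr s)) = σ ω := by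
            refine hdep _ _ fun j hj => ?_
            rw [Function.comp_apply, Equiv.swap_apply_of_ne_of_ne _ (by simp)]
            rintro ⟨⟩
            exact lt_irrefl _ hj
          simp only [Equiv.coe_toEmbedding, Function.comp_apply, h1, h2, Equiv.swap_apply_left, hs]
        · intro s'
          by_cases hss : s' = s
          · subst hss
            refine Or.inr ⟨k, Function.update_self .., by omega, hk, fun j hj => ?_⟩
            rw [hne j hj.ne]
            exact hnew j hj
          · rw [Function.update_of_ne hss]
            rcases hpos s' with ⟨hs', hn⟩ | ⟨c, hs', hck, hc, hf⟩
            · refine Or.inl ⟨hs', fun j hj => ?_⟩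
              by_cases hjk : j = k
              · rw [hjk, hk]
                exact Ne.symm hss
              · rw [hne j hjk]
                exact hn j (by have := Fin.val_ne_of_ne hjk; omega)
            · refine Or.inr ⟨c, hs', by omega, ?_, fun j hj => ?_⟩
              · rw [hne c (Fin.ne_of_lt hck), hc]
              · rw [hne j (Fin.ne_of_lt (lt_trans hj hck))]
                exact hf j hj
      · have hsel : ∀ ω : Fin t ⊕ (Fin d → Bool) → T,
            selectAnswer y t (fun j => sameRecord k j h') (fun j => st (ω (.inl j)))
              (proj x s (σ ω)) = replace y (st (ω (.inl c))) (proj x s (σ ω)) := by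
          intro ω
          refine selectAnswer_eq y t _ _ (fun j => htr _) c ?_ (fun j hj => ?_) _
          · rw [hflag, hne c (Fin.ne_of_lt hck), hc]
            simp
          · rw [hflag, hne j (Fin.ne_of_lt (lt_trans hj hck)), decide_eq_false_iff_not]
            exact hfirst j hj
        simp only [hsel, hs]
        refine ih (k + 1) (by omega) h' pos ?_ (fun ω => replace y (st (ω (.inl c)))
          (proj x s (σ ω))) (continuous_replace y (hcont _) (hproj s))
          (fun ω ω' hω => by rw [hdep' ω ω' hω, hω c (by omega)])
        intro s'
        rcases hpos s' with ⟨hs', hn⟩ | ⟨c', hs', hck', hc', hf⟩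
        · refine Or.inl ⟨hs', fun j hj => ?_⟩
          by_cases hjk : j = k
          · rw [hjk, hk]
            -- Record `k` holds `s`, whose position is `inl c`, so a string still located at its own
            -- `inr` position differs from it.
            rintro rfl
            rw [hs] at hs'
            cases hs'
          · rw [hne j hjk]
            exact hn j (by have := Fin.val_ne_of_ne hjk; omega)
        · refine Or.inr ⟨c', hs', by omega, ?_, fun j hj => ?_⟩
          · rw [hne c' (Fin.ne_of_lt hck'), hc']
          · rw [hne j (Fin.ne_of_lt (lt_trans hj hck'))]
            exact hf j hj

/-- A random oracle may be sampled lazily. -/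
lemma integral_oracle_eq_integral_lazyEval {st : T → Op (Fin n)} (hst : Continuous st)
    (htr : ∀ θ, (st θ).trace = 1) (ℓ : Op (Fin w) →+ ℝ) (hℓ : Continuous ℓ)
    (l : List (OracleGate d n (Fin w))) (hl : l.length ≤ t) (h : Fin t × Fin d → Bool)
    (σ : Op (Fin w)) :
    ∫ θ : (Fin d → Bool) → T, ℓ ((oracleSem d n).fold (fun s => st (θ s)) l σ)
        ∂(Measure.pi fun _ => μ) =
      ∫ ω : Fin t → T, ℓ (lazyEval t (fun j => st (ω j)) l 0 h σ) ∂(Measure.pi fun _ => μ) := by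
  have h1 := integral_lazyEval μ t hst htr ℓ hℓ l 0 (by omega) h Sum.inr
    (fun s => Or.inl ⟨rfl, fun j hj => absurd hj (Nat.not_lt_zero _)⟩) (fun _ => σ)
    continuous_const fun _ _ _ => rfl
  -- The eager and the lazy experiment use the `inr` and the `inl` samples respectively, so each is
  -- an integral against a marginal of the joint family.
  refine (integral_comp_embedding μ (Function.Embedding.inr : _ ↪ Fin t ⊕ (Fin d → Bool))
    (f := fun θ => ℓ ((oracleSem d n).fold (fun s => st (θ s)) l σ)) (hℓ.comp (continuous_fold l
      (fun s => hst.comp (continuous_apply s)) continuous_const))).symm.trans (h1.symm.trans ?_)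
  exact integral_comp_embedding μ (Function.Embedding.inl : _ ↪ Fin t ⊕ (Fin d → Bool))
    (f := fun ω => ℓ (lazyEval t (fun j => st (ω j)) l 0 h σ)) (hℓ.comp (continuous_lazyEval t l 0 h
      (fun s => hst.comp (continuous_apply s)) continuous_const))

end Sampling

/-! ### Density matrices -/

section Density

variable {J ι κ : Type} [Fintype J] [DecidableEq J] [Fintype ι] [DecidableEq ι] [Fintype κ]
  [DecidableEq κ]

open scoped MatrixOrder in
lemma exists_eq_conjTranspose_mul_self {ρ : Op ι} (h : ρ.PosSemidef) : ∃ B : Op ι, ρ = Bᴴ * B :=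
  CStarAlgebra.nonneg_iff_eq_star_mul_self.mp h.nonneg

/-- Factor each member as `Bᴴ * B`; the tensor product of these factors then exhibits the product as
a positive semidefinite matrix. -/
lemma IsDensity.tensorFam {ρ : J → Op ι} (h : ∀ j, IsDensity (ρ j)) : IsDensity (tensorFam ρ) := by
  refine ⟨?_, ?_⟩
  · choose B hB using fun j => exists_eq_conjTranspose_mul_self (h j).1
    have : PRFS.tensorFam ρ = (PRFS.tensorFam B)ᴴ * PRFS.tensorFam B := by
      ext u v
      simp only [tensorFam_apply, mul_apply, conjTranspose_apply, star_prod,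
        ← Finset.prod_mul_distrib]
      rw [sum_prod_curry fun i w =>
        star (B i w fun j => u (i, j)) * B i w fun j => v (i, j)]
      refine Finset.prod_congr rfl fun i _ => ?_
      rw [hB]
      rfl
    rw [this]
    exact posSemidef_conjTranspose_mul_self _
  · rw [trace_tensorFam]
    exact Finset.prod_eq_one fun i _ => (h i).2

lemma IsDensity.rename {ρ : Op ι} (h : IsDensity ρ) (E : ι ≃ κ) : IsDensity (PRFS.rename E ρ) :=
  ⟨h.1.submatrix _, by rw [trace_rename, h.2]⟩

lemma IsDensity.tensor {ρ : Op ι} {σ : Op κ} (h : IsDensity ρ) (h' : IsDensity σ) :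
    IsDensity (PRFS.tensor ρ σ) :=
  ⟨(h.1.kronecker h'.1).submatrix
    fun u : ι ⊕ κ → Bool => (fun i => u (.inl i), fun j => u (.inr j)), by
    rw [trace_tensor, h.2, h'.2, one_mul]⟩

lemma isDensity_pureState {ψ : EuclideanSpace ℂ (ι → Bool)} (h : ‖ψ‖ = 1) :
    IsDensity (pureState ψ) := by
  refine ⟨posSemidef_vecMulVec_self_star _, ?_⟩
  have h1 := EuclideanSpace.norm_sq_eq ψ
  rw [h, one_pow] at h1
  rw [trace]
  simp only [diag_apply, pureState, of_apply]
  have h2 : ∀ u, ψ u * star (ψ u) = ((‖ψ u‖ ^ 2 : ℝ) : ℂ) := fun u => by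
    rw [Complex.star_def, Complex.mul_conj, Complex.normSq_eq_norm_sq]
  simp only [h2, ← Complex.ofReal_sum, ← h1, Complex.ofReal_one]

end Density

/-! ### Expectations of states -/

section Moment

variable {T : Type} [MeasurableSpace T] (μ : Measure T) {ι κ : Type} [Fintype ι] [DecidableEq ι]
  [Fintype κ] [DecidableEq κ]

/-- The expectation of a random operator. -/
def meanOp (X : T → Op ι) : Op ι := Matrix.of fun u v => ∫ θ, X θ u v ∂μ

lemma integral_linear {X : T → Op ι} (hX : ∀ u v, Integrable (fun θ => X θ u v) μ)
    (L : Op ι →ₗ[ℂ] ℂ) : Integrable (fun θ => L (X θ)) μ ∧ ∫ θ, L (X θ) ∂μ = L (meanOp μ X) := by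
  have h : ∀ Y : Op ι, L Y = ∑ u, ∑ v, Y u v * L (single u v 1) := by
    intro Y
    conv_lhs => rw [matrix_eq_sum_single Y]
    simp only [map_sum]
    refine Finset.sum_congr rfl fun u _ => Finset.sum_congr rfl fun v _ => ?_
    rw [← smul_eq_mul, ← map_smul, smul_single, smul_eq_mul, mul_one]
  have hi : ∀ u v, Integrable (fun θ => X θ u v * L (single u v 1)) μ :=
    fun u v => (hX u v).mul_const _
  rw [show (fun θ => L (X θ)) = _ from funext fun θ => h (X θ), h (meanOp μ X)]
  refine ⟨integrable_finsetSum _ fun u _ => integrable_finsetSum _ fun v _ => hi u v, ?_⟩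
  rw [integral_finsetSum _ fun u _ => integrable_finsetSum _ fun v _ => hi u v]
  refine Finset.sum_congr rfl fun u _ => ?_
  rw [integral_finsetSum _ fun v _ => hi u v]
  exact Finset.sum_congr rfl fun v _ => integral_mul_const _ _

/-- The acceptance probability is the real part of a matrix entry, hence additive and real-linear: a
fixed circuit on a random input sees only the mean input. -/
lemma integral_prOne {X : T → Op ι} (hX : ∀ u v, Integrable (fun θ => X θ u v) μ)
    (L : Op ι →ₗ[ℂ] Op (Fin 1)) : ∫ θ, prOne (L (X θ)) ∂μ = prOne (L (meanOp μ X)) := by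
  obtain ⟨h1, h2⟩ := integral_linear μ hX
    ((Matrix.entryLinearMap ℂ ℂ (fun _ => true) (fun _ => true)) ∘ₗ L)
  have := integral_re h1
  rw [h2] at this
  exact this

/-- Hermitian symmetry, nonnegativity of quadratic forms and the trace all pass through the
integral. This makes the moment operators admissible as advice. -/
lemma isDensity_meanOp [IsProbabilityMeasure μ] {X : T → Op ι}
    (hX : ∀ u v, Integrable (fun θ => X θ u v) μ) (h : ∀ θ, IsDensity (X θ)) :
    IsDensity (meanOp μ X) := by
  refine ⟨.of_dotProduct_mulVec_nonneg ?_ fun x => ?_, ?_⟩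
  · ext u v
    rw [conjTranspose_apply, meanOp, of_apply, of_apply, Complex.star_def, ← integral_conj]
    exact integral_congr_ae (Filter.Eventually.of_forall fun θ => (h θ).1.1.apply u v)
  · have h1 := (integral_linear μ hX ((dotProductBilin ℂ ℂ (star x)) ∘ₗ ((mulVecBilin ℂ ℂ).flip x))).2
    have h2 : 0 ≤ ∫ θ, star x ⬝ᵥ X θ *ᵥ x ∂μ :=
      integral_nonneg fun θ => (h θ).1.dotProduct_mulVec_nonneg x
    exact h2.trans_eq h1
  · have h1 := (integral_linear μ hX (traceLinearMap _ ℂ ℂ)).2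
    simp only [traceLinearMap_apply, fun θ => (h θ).2] at h1
    rw [← h1]
    simp

end Moment

/-! ### Moments of independent samples -/

section Moment

variable {J T ι κ : Type} [Fintype J] [MeasurableSpace T] (μ : Measure T) [SigmaFinite μ]

lemma meanOp_tensorFam (X : T → Op ι) :
    meanOp (Measure.pi fun _ : J => μ) (fun ω : J → T => tensorFam fun j => X (ω j)) =
      tensorFam fun _ => meanOp μ X := by
  ext u v
  exact integral_fintype_prod_eq_prod
    (fun i θ => X θ (fun j => u (i, j)) (fun j => v (i, j)))

lemma integrable_tensorFam {X : T → Op ι} (hX : ∀ u v, Integrable (fun θ => X θ u v) μ)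
    (u v : J × ι → Bool) :
    Integrable (fun ω : J → T => tensorFam (fun j => X (ω j)) u v) (Measure.pi fun _ => μ) :=
  Integrable.fintype_prod (f := fun i θ => X θ (fun j => u (i, j)) (fun j => v (i, j)))
    fun _ => hX _ _

end Moment

/-! ### The hybrid argument -/

lemma rename_symm_rename {α β : Type} (E : α ≃ β) (ρ : Op α) :
    rename E.symm (rename E ρ) = ρ := by
  rw [← rename_trans, Equiv.self_trans_symm, rename_refl]

/-- The map `τ ↦ τ ⊗ ρ`. -/
def tensorLeft {α β : Type} (ρ : Op β) : Op α →ₗ[ℂ] Op (α ⊕ β) where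
  toFun τ := tensor τ ρ
  map_add' τ τ' := by
    ext u v
    exact add_mul _ _ _
  map_smul' c τ := by
    ext u v
    exact mul_assoc _ _ _

/-! ### Oracle experiments run on a supply of samples -/

section Collect

variable {d n a : ℕ} (t : ℕ) [NeZero t]

/-- Exchange the two indices of a family of families of registers. -/
def swapFamilies (J K ι : Type) : J × (K × ι) ≃ K × (J × ι) where
  toFun p := (p.2.1, (p.1, p.2.2))
  invFun p := (p.2.1, (p.1, p.2.2))
  left_inv _ := rfl
  right_inv _ := rfl

lemma rename_swapFamilies {J K ι : Type} [Fintype J] [Fintype K] (ρ : K → Op ι) :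
    rename (swapFamilies K J ι) (tensorFam fun j => tensorFam fun _ : J => ρ j) =
      tensorFam fun _ : J => tensorFam ρ := by
  ext u v
  exact Finset.prod_comm

/-- The inputs of `lazyCircuit`, when the history is empty. -/
def collectInput (A : Circuit (OracleGate d n) (Fin a) (Fin 1)) :
    (Fin t × (Fin t × Fin n)) ⊕ Fin a ↪
      (Fin A.width ⊕ (Fin t × Fin d)) ⊕ (Fin t × (Fin t × Fin n)) :=
  ((swapFamilies _ _ _).sumCongr (Equiv.refl (Fin a))).toEmbedding.trans
    (((Function.Embedding.refl _).sumMap (A.inp.trans Function.Embedding.inl)).trans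
      (Equiv.sumComm _ _).toEmbedding)

/-- Run an oracle circuit, with the answers to the queries taken from a supply of `t` families
of `t` copies of a state. -/
def collectCircuit (A : Circuit (OracleGate d n) (Fin a) (Fin 1)) :
    Circuit Gate ((Fin t × (Fin t × Fin n)) ⊕ Fin a) (Fin 1) :=
  ((lazyCircuit t A.ops 0 t).withInput (collectInput t A)).withOutput A.out

/-- The supply groups the copies by sample, whereas `lazyCircuit` expects families with one copy of
every sample; `swapFamilies` mediates between the two orders. -/
lemma eval_collectCircuit (A : Circuit (OracleGate d n) (Fin a) (Fin 1)) (hA : A.ops.length ≤ t)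
    (φ : Fin t → Op (Fin n)) (hφ : ∀ j, (φ j).trace = 1) (ρ : Op (Fin a)) :
    (collectCircuit t A).eval gateSem () (tensor (tensorFam fun j => tensorPow t (φ j)) ρ) =
      keep A.out (lazyEval t φ A.ops 0 (fun _ => false) (load A.inp ρ)) := by
  rw [collectCircuit, Circuit.eval_withOutput, Circuit.eval_withInput, collectInput, load_trans,
    load_equiv, rename_sumCongr, rename_refl, load_trans, load_sumMap_tensor,
    load_equiv, rename_sumComm, load_trans, load_inl, ← eval_lazyCircuit t φ hφ A.ops 0 t hA]
  simp only [tensorPow_eq_tensorFam, rename_swapFamilies]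

/-- A bound for the size of `collectCircuit`. -/
def collectCost (d n t s : ℕ) : ℕ :=
  s * (1 + 2 * s + queryCost s d n t + 2 * (t * (t * n))) + 2 * (s + t * d + t * (t * n))

lemma size_collectCircuit (A : Circuit (OracleGate d n) (Fin a) (Fin 1)) :
    (collectCircuit t A).size ≤ collectCost d n t A.size := by
  rw [collectCircuit, Circuit.size_withOutput, Circuit.size_withInput]
  refine (size_lazyCircuit t A.ops 0 t t le_rfl).trans ?_
  have h1 : A.ops.length ≤ A.size := by rw [Circuit.size]; omega
  have h2 : A.width ≤ A.size := by rw [Circuit.size]; omega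
  have h3 : queryCost A.width d n t ≤ queryCost A.size d n t := by
    rw [queryCost, queryCost]
    gcongr
  rw [collectCost]
  gcongr

variable {T : Type} [TopologicalSpace T] [CompactSpace T] [SecondCountableTopology T]
  [MeasurableSpace T] [BorelSpace T] (μ : Measure T) [IsProbabilityMeasure μ]

omit [CompactSpace T] [SecondCountableTopology T] [MeasurableSpace T] [BorelSpace T] in
lemma continuous_tensorPow {st : T → Op (Fin n)} (hst : Continuous st) (m : ℕ) :
    Continuous fun θ => tensorPow m (st θ) :=
  continuous_op fun u v => continuous_finsetProd Finset.univ fun i _ =>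
    continuous_op_apply hst (fun j => u (i, j)) (fun j => v (i, j))

/-- Lazy sampling removes the oracle, linearity moves the expectation to the input, and independence
turns the mean of the product into the product of the means. -/
lemma integral_runWith {st : T → Op (Fin n)} (hst : Continuous st) (htr : ∀ θ, (st θ).trace = 1)
    (A : Circuit (OracleGate d n) (Fin a) (Fin 1)) (hA : A.ops.length ≤ t) (ρ : Op (Fin a)) :
    ∫ θ : (Fin d → Bool) → T, prOne (A.runWith (fun s => st (θ s)) ρ)
        ∂(Measure.pi fun _ => μ) =
      prOne ((collectCircuit t A).run
        (tensor (tensorFam fun _ => meanOp μ fun θ => tensorPow t (st θ)) ρ)) := by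
  have h1 := integral_oracle_eq_integral_lazyEval μ t hst htr
    (AddMonoidHom.mk' (fun σ => prOne (keep A.out σ)) fun σ τ => by
      have := map_add (keepₗ A.out) σ τ
      rw [show keep A.out (σ + τ) = keep A.out σ + keep A.out τ from this]
      rfl)
    (Complex.continuous_re.comp
      (continuous_op_apply (continuous_linear_op (keepₗ A.out)) _ _)) A.ops hA (fun _ => false)
    (load A.inp ρ)
  have h2 : ∀ θ : (Fin d → Bool) → T, A.runWith (fun s => st (θ s)) ρ =
      keep A.out ((oracleSem d n).fold (fun s => st (θ s)) A.ops (load A.inp ρ)) := fun θ => by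
    rw [Circuit.runWith_eq_eval, Circuit.eval_apply]
  have hX : ∀ u v, Integrable (fun θ => tensorPow t (st θ) u v) μ := fun u v =>
    integrable_of_continuous μ (continuous_op_apply (continuous_tensorPow hst t) u v)
  have h3 := integral_prOne (Measure.pi fun _ : Fin t => μ) (integrable_tensorFam μ hX)
    ((collectCircuit t A).eval gateSem () ∘ₗ tensorLeft ρ)
  rw [meanOp_tensorFam μ fun θ => tensorPow t (st θ)] at h3
  simp only [h2, Circuit.run_eq_eval]
  refine h1.trans (Eq.trans ?_ h3)
  refine integral_congr_ae (Filter.Eventually.of_forall fun ω => ?_)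
  exact (congr_arg prOne (eval_collectCircuit t A hA _ (fun j => htr _) ρ)).symm

end Collect

/-! ### Replacing one sample at a time -/

section Hybrid

variable {J ν : Type} [Fintype J] [DecidableEq J]

/-- Separate a member of a family of registers. -/
def splitFamily (i : J) (ν : Type) : J × ν ≃ ν ⊕ ({j // j ≠ i} × ν) where
  toFun p := if h : p.1 = i then .inl p.2 else .inr (⟨p.1, h⟩, p.2)
  invFun := Sum.elim (fun a => (i, a)) fun p => (p.1.1, p.2)
  left_inv := by
    rintro ⟨j, a⟩
    by_cases h : j = i
    · simp [h]
    · simp [h]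
  right_inv := by
    rintro (a | ⟨⟨j, hj⟩, a⟩)
    · simp
    · simp [hj]

lemma rename_splitFamily (i : J) (ρ : J → Op ν) :
    rename (splitFamily i ν) (tensorFam ρ) = tensor (ρ i) (tensorFam fun j : {j // j ≠ i} => ρ j) := by
  ext u v
  simp only [rename_apply, tensorFam_apply, tensor_apply]
  rw [Fintype.prod_eq_mul_prod_subtype_ne _ i]
  congr 1
  · simp [splitFamily, Function.comp_def]
  · refine Finset.prod_congr rfl fun j _ => ?_
    simp [splitFamily, j.2]

variable {n a t : ℕ} [Fintype ν] [DecidableEq ν]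

/-- Give a circuit that acts on a family of registers the states of all members but one as
advice. -/
def isolate (B : Circuit Gate ((Fin t × ν) ⊕ Fin a) (Fin 1)) (i : Fin t) :
    Circuit Gate (ν ⊕ Fin (Fintype.card (({j // j ≠ i} × ν) ⊕ Fin a))) (Fin 1) :=
  B.withInput ((((Equiv.refl ν).sumCongr (Fintype.equivFin _).symm).trans
    (Equiv.sumAssoc _ _ _).symm).trans
      ((splitFamily i ν).symm.sumCongr (Equiv.refl (Fin a)))).toEmbedding

/-- The advice for `isolate`. -/
def isolateAdvice (i : Fin t) (M : Fin t → Op ν) (ρ : Op (Fin a)) :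
    Op (Fin (Fintype.card (({j // j ≠ i} × ν) ⊕ Fin a))) :=
  rename (Fintype.equivFin _) (tensor (tensorFam fun j : {j // j ≠ i} => M j) ρ)

lemma run_isolate (B : Circuit Gate ((Fin t × ν) ⊕ Fin a) (Fin 1)) (i : Fin t) (M : Fin t → Op ν)
    (ρ : Op (Fin a)) : (isolate B i).run (tensor (M i) (isolateAdvice i M ρ)) =
      B.run (tensor (tensorFam M) ρ) := by
  rw [isolate, Circuit.run_eq_eval, Circuit.run_eq_eval, Circuit.eval_withInput, load_equiv,
    rename_trans, rename_trans, rename_sumCongr, rename_refl, isolateAdvice, rename_symm_rename,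
    rename_sumAssoc_symm, rename_sumCongr, rename_refl, ← rename_splitFamily,
    rename_symm_rename]

/-- Replacing a state in all members of a family is noticed at most as often as the most noticeable
replacement in a single member, times the size of the family. -/
lemma exists_hybrid (B : Circuit Gate ((Fin t × ν) ⊕ Fin a) (Fin 1)) {ρ : Op (Fin a)}
    (hρ : IsDensity ρ) {M₀ M₁ : Op ν} (h₀ : IsDensity M₀) (h₁ : IsDensity M₁) (ht : t ≠ 0) :
    ∃ (b : ℕ) (D : Circuit Gate (ν ⊕ Fin b) (Fin 1)) (σ : Op (Fin b)), IsDensity σ ∧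
      D.size = B.size ∧
      |prOne (B.run (tensor (tensorFam fun _ => M₀) ρ)) -
          prOne (B.run (tensor (tensorFam fun _ => M₁) ρ))| ≤
        t * |prOne (D.run (tensor M₀ σ)) - prOne (D.run (tensor M₁ σ))| := by
  -- In hybrid number `i`, the members below `i` have already been replaced.
  set M : ℕ → Fin t → Op ν := fun i j => if (j : ℕ) < i then M₁ else M₀ with hM
  set p : ℕ → ℝ := fun i => prOne (B.run (tensor (tensorFam (M i)) ρ)) with hp
  have hd : ∀ i j, IsDensity (M i j) := by
    intro i j
    simp only [hM]
    split_ifs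
    · exact h₁
    · exact h₀
  have hstep : ∀ i : Fin t, p i - p (i + 1) =
      prOne ((isolate B i).run (tensor M₀ (isolateAdvice i (M i) ρ))) -
        prOne ((isolate B i).run (tensor M₁ (isolateAdvice i (M i) ρ))) := by
    intro i
    -- Consecutive hybrids differ only in member `i`, which the advice leaves out.
    have h1 : isolateAdvice i (M i) ρ = isolateAdvice i (M (i + 1)) ρ := by
      have : ∀ j : {j // j ≠ i}, M i j = M (i + 1) j := by
        rintro ⟨j, hj⟩
        have : (j : ℕ) < i ↔ (j : ℕ) < i + 1 := by
          have := Fin.val_ne_of_ne hj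
          omega
        simp only [hM, this]
      simp only [isolateAdvice, this]
    have h2 : M i i = M₀ := if_neg (lt_irrefl _)
    have h3 : M (i + 1) i = M₁ := if_pos (Nat.lt_succ_self _)
    conv_rhs => rw [← h2, run_isolate, h1, ← h3, run_isolate]
  -- The largest of the `t` telescoping differences is selected; only its existence is needed, since
  -- the distinguisher may be non-uniform.
  obtain ⟨i, hi, hmax⟩ := Finset.exists_max_image (Finset.range t) (fun i => |p i - p (i + 1)|)
    ⟨0, Finset.mem_range.2 (Nat.pos_of_ne_zero ht)⟩
  rw [Finset.mem_range] at hi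
  refine ⟨_, isolate B ⟨i, hi⟩, isolateAdvice ⟨i, hi⟩ (M i) ρ,
    ((IsDensity.tensorFam fun j => hd _ _).tensor hρ).rename _, Circuit.size_withInput _ _, ?_⟩
  rw [← hstep ⟨i, hi⟩]
  have h0 : M 0 = fun _ => M₀ := by
    funext j
    exact if_neg (Nat.not_lt_zero _)
  have ht' : M t = fun _ => M₁ := by
    funext j
    exact if_pos j.2
  rw [← h0, ← ht']
  change |p 0 - p t| ≤ t * |p i - p (i + 1)|
  rw [← Finset.sum_range_sub' p t]
  refine (Finset.abs_sum_le_sum_abs _ _).trans ((Finset.sum_le_card_nsmul _ _ _ hmax).trans ?_)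
  rw [Finset.card_range, nsmul_eq_mul]

end Hybrid

/-! ### Uniform and Haar random choices -/

section Uniform

/-- The uniform probability measure on a finite type. -/
def uniformMeasure (Y : Type) [Fintype Y] [MeasurableSpace Y] : Measure Y :=
  (Fintype.card Y : ENNReal)⁻¹ • Measure.count

variable {X Y : Type} [Fintype X] [Fintype Y] [MeasurableSpace Y] [MeasurableSingletonClass Y]

lemma uniformMeasure_singleton (y : Y) : uniformMeasure Y {y} = (Fintype.card Y : ENNReal)⁻¹ := by
  simp [uniformMeasure]

instance [Nonempty Y] : IsProbabilityMeasure (uniformMeasure Y) := by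
  refine ⟨?_⟩
  simp only [uniformMeasure, Measure.smul_apply, smul_eq_mul, Measure.count_univ,
    ENat.card_eq_coe_fintype_card]
  exact ENNReal.inv_mul_cancel (by simp) (by simp)

lemma integral_eq_uniformAvg (ν : Measure Y) [IsFiniteMeasure ν]
    (h : ∀ y, ν {y} = (Fintype.card Y : ENNReal)⁻¹) (f : Y → ℝ) :
    ∫ y, f y ∂ν = uniformAvg f := by
  rw [integral_fintype .of_finite, uniformAvg, Finset.sum_div]
  refine Finset.sum_congr rfl fun y _ => ?_
  rw [Measure.real, h, ENNReal.toReal_inv, ENNReal.toReal_natCast, smul_eq_mul, div_eq_inv_mul]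

lemma integral_uniformMeasure [Nonempty Y] (f : Y → ℝ) :
    ∫ y, f y ∂(uniformMeasure Y) = uniformAvg f :=
  integral_eq_uniformAvg _ uniformMeasure_singleton f

lemma integral_pi_uniformMeasure [DecidableEq X] [Nonempty Y] (f : (X → Y) → ℝ) :
    ∫ y, f y ∂(Measure.pi fun _ : X => uniformMeasure Y) = uniformAvg f := by
  refine integral_eq_uniformAvg _ (fun y => ?_) f
  rw [Measure.pi_singleton]
  simp only [uniformMeasure_singleton, Finset.prod_const, Finset.card_univ, Fintype.card_fun,
    Nat.cast_pow, ENNReal.inv_pow]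

end Uniform

instance (n : ℕ) : IsProbabilityMeasure (haarState n) := by
  refine ⟨?_⟩
  rw [haarState, Measure.smul_apply, smul_eq_mul]
  refine ENNReal.inv_mul_cancel ?_ (measure_ne_top _ _)
  rw [Measure.toSphere_apply_univ]
  refine mul_ne_zero ?_ (Metric.measure_ball_pos _ _ one_pos).ne'
  exact_mod_cast Module.finrank_pos.ne'

lemma continuous_pureState (n : ℕ) : Continuous fun θ : PureStates n => pureState θ.1 := by
  refine continuous_op fun u v => ?_
  have h : ∀ u, Continuous fun θ : PureStates n => θ.1 u := fun u => by fun_prop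
  exact (h u).mul (h v).star

/-! ### From oracle distinguishers to distinguishers of tensor powers -/

section Distinguisher

variable {d n a : ℕ} (t : ℕ) [NeZero t]
variable {T₀ : Type} [TopologicalSpace T₀] [CompactSpace T₀] [SecondCountableTopology T₀]
  [MeasurableSpace T₀] [BorelSpace T₀] (μ₀ : Measure T₀) [IsProbabilityMeasure μ₀]
variable {T₁ : Type} [TopologicalSpace T₁] [CompactSpace T₁] [SecondCountableTopology T₁]
  [MeasurableSpace T₁] [BorelSpace T₁] (μ₁ : Measure T₁) [IsProbabilityMeasure μ₁]

/-- A distinguisher of two random oracles yields a distinguisher of tensor powers of the two random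
states. -/
lemma exists_distinguisher {st₀ : T₀ → Op (Fin n)} (hst₀ : Continuous st₀)
    (hd₀ : ∀ θ, IsDensity (st₀ θ)) {st₁ : T₁ → Op (Fin n)} (hst₁ : Continuous st₁)
    (hd₁ : ∀ θ, IsDensity (st₁ θ)) (A : Circuit (OracleGate d n) (Fin a) (Fin 1))
    (hA : A.ops.length ≤ t) {ρ : Op (Fin a)} (hρ : IsDensity ρ) :
    ∃ (b : ℕ) (D : Circuit Gate ((Fin t × Fin n) ⊕ Fin b) (Fin 1)) (σ : Op (Fin b)), IsDensity σ ∧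
      D.size ≤ collectCost d n t A.size ∧
      |∫ θ : (Fin d → Bool) → T₀, prOne (A.runWith (fun s => st₀ (θ s)) ρ)
            ∂(Measure.pi fun _ => μ₀) -
          ∫ θ : (Fin d → Bool) → T₁, prOne (A.runWith (fun s => st₁ (θ s)) ρ)
            ∂(Measure.pi fun _ => μ₁)| ≤
        t * |∫ θ, prOne (D.run (tensor (tensorPow t (st₀ θ)) σ)) ∂μ₀ -
          ∫ θ, prOne (D.run (tensor (tensorPow t (st₁ θ)) σ)) ∂μ₁| := by
  have hi : ∀ {T : Type} [TopologicalSpace T] [CompactSpace T] [SecondCountableTopology T]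
      [MeasurableSpace T] [BorelSpace T] (μ : Measure T) [IsProbabilityMeasure μ]
      {st : T → Op (Fin n)}, Continuous st →
      ∀ u v, Integrable (fun θ => tensorPow t (st θ) u v) μ := fun μ _ _ hst u v =>
    integrable_of_continuous μ (continuous_op_apply (continuous_tensorPow hst t) u v)
  have hdens : ∀ {σ : Op (Fin n)}, IsDensity σ → IsDensity (tensorPow t σ) := fun h =>
    IsDensity.tensorFam fun _ => h
  obtain ⟨b, D, σ, hσ, hs, hD⟩ := exists_hybrid (collectCircuit t A) hρ
    (isDensity_meanOp μ₀ (hi μ₀ hst₀) fun θ => hdens (hd₀ θ))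
    (isDensity_meanOp μ₁ (hi μ₁ hst₁) fun θ => hdens (hd₁ θ)) (NeZero.ne t)
  refine ⟨b, D, σ, hσ, hs.trans_le (size_collectCircuit t A), ?_⟩
  rw [integral_runWith t μ₀ hst₀ (fun θ => (hd₀ θ).2) A hA,
    integral_runWith t μ₁ hst₁ (fun θ => (hd₁ θ).2) A hA]
  refine hD.trans_eq ?_
  simp only [Circuit.run_eq_eval]
  have h0 := integral_prOne μ₀ (hi μ₀ hst₀) (D.eval gateSem () ∘ₗ tensorLeft σ)
  have h1 := integral_prOne μ₁ (hi μ₁ hst₁) (D.eval gateSem () ∘ₗ tensorLeft σ)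
  exact congr_arg₂ (fun x y : ℝ => (t : ℝ) * |x - y|) h0.symm h1.symm

end Distinguisher

/-! ### Negligible functions -/

lemma Indistinguishable.trans {p q r : ℕ → ℝ} (h : Indistinguishable p q)
    (h' : Indistinguishable q r) : Indistinguishable p r := by
  obtain ⟨ε, hε, he⟩ := h
  obtain ⟨ε', hε', he'⟩ := h'
  exact ⟨ε + ε', hε.add hε', fun lam => (abs_sub_le _ _ _).trans (add_le_add (he lam) (he' lam))⟩

lemma Indistinguishable.of_le_mul {p q p' q' : ℕ → ℝ} (h : Indistinguishable p q)
    (t : Polynomial ℕ) (ht : ∀ lam, |p' lam - q' lam| ≤ (t.eval lam : ℕ) * |p lam - q lam|) :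
    Indistinguishable p' q' := by
  obtain ⟨ε, hε, he⟩ := h
  refine ⟨fun lam => ε lam * (t.map (Nat.castRingHom ℝ)).eval (lam : ℝ), hε.mul_polynomial _,
    fun lam => (ht lam).trans ?_⟩
  beta_reduce
  rw [Polynomial.eval_natCast_map, eq_natCast, mul_comm]
  exact mul_le_mul_of_nonneg_right (he lam) (Nat.cast_nonneg _)

lemma polyBounded_collectCost {d n t s : ℕ → ℕ} (hd : PolyBounded d) (hn : PolyBounded n)
    (ht : PolyBounded t) (hs : PolyBounded s) :
    PolyBounded fun lam => collectCost (d lam) (n lam) (t lam) (s lam) := by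
  have c : ∀ k, PolyBounded fun _ => k := PolyBounded.const
  have htd := ht.mul hd
  have htn := ht.mul hn
  have hcomp : PolyBounded fun lam => compareCost (t lam) (d lam) :=
    (((hd.mul (c 8)).add (c 1)).mul (((c 6).mul ((htd.add (c 2)).add (hd.mul (c 8)))).add
      (c 16))).add ((c 3).mul (htd.add (c 1)))
  have hq : PolyBounded fun lam => queryCost (s lam) (d lam) (n lam) (t lam) :=
    (((((c 4).mul hs).add ((c 4).mul htd)).add ((c 8).mul hd)).add ((c 2).mul htn)).add
      ((ht.mul ((hcomp.add (((((c 7).mul hn).add ((c 4).mul hs)).add ((c 2).mul htd)).add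
        (c 2))).add ((c 2).mul htn))).add ((c 2).mul (hs.add htd)))
  exact (hs.mul ((((c 1).add ((c 2).mul hs)).add hq).add ((c 2).mul (ht.mul htn)))).add
    ((c 2).mul ((hs.add htd).add (ht.mul htn)))

/-! ### The composition of a pseudorandom function and a pseudorandom state generator -/

section Composition

variable {d n : ℕ → ℕ} {F : ∀ lam, (Fin lam → Bool) → (Fin (d lam) → Bool) → (Fin lam → Bool)}
  {g : ∀ lam, (Fin lam → Bool) → Op (Fin (n lam))}

lemma exists_circuit_comp (hd : PolyBounded d) (hF : IsPolyTime d (fun lam => lam) F)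
    (hg : IsPRS n g) : ∃ C : ∀ lam, Circuit Gate (Fin lam ⊕ Fin (d lam)) (Fin (n lam)),
      PolyBounded (fun lam => (C lam).size) ∧
        ∀ lam k x, (C lam).run (basisState (Sum.elim k x)) = g lam (F lam k x) := by
  obtain ⟨C, hC, hC'⟩ := exists_circuit_of_polyTime hd PolyBounded.id hF
  obtain ⟨D, hD, hD'⟩ := hg.qpt
  refine ⟨fun lam => Circuit.comp gateSem (C lam) (D lam),
    (hC.add hD).mono fun lam => Circuit.size_comp _ _ _, fun lam k x => ?_⟩
  rw [Circuit.run_eq_eval, Circuit.eval_comp, hC', ← Circuit.run_eq_eval, hD']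

/-- Replace a pseudorandom function by a random one. -/
lemma indistinguishable_randomFunction (hF : IsPostQuantumPRF d (fun lam => lam) F)
    (hg : IsPRS n g) (a : ℕ → ℕ)
    (A : ∀ lam, Circuit (OracleGate (d lam) (n lam)) (Fin (a lam)) (Fin 1))
    (ρ : ∀ lam, Op (Fin (a lam))) (hA : PolyBounded fun lam => (A lam).size)
    (hρ : ∀ lam, IsDensity (ρ lam)) :
    Indistinguishable
      (fun lam => uniformAvg fun k : Fin lam → Bool =>
        prOne ((A lam).runWith (fun x => g lam (F lam k x)) (ρ lam)))
      (fun lam => uniformAvg fun f : (Fin (d lam) → Bool) → (Fin lam → Bool) =>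
        prOne ((A lam).runWith (fun x => g lam (f x)) (ρ lam))) := by
  obtain ⟨D, hD, hD'⟩ := hg.qpt
  have c : ∀ k, PolyBounded fun _ => k := PolyBounded.const
  have := hF.secure a (fun lam => simulateCircuit (D lam) (A lam)) ρ
    (((hA.mul (((c 1).add ((c 6).mul hA)).add ((c 5).mul hD))).add ((c 2).mul hA)).mono
      fun lam => size_simulateCircuit _ _) hρ
  simpa only [runWith_simulateCircuit, hD'] using this

/-- Replace pseudorandom states by Haar random ones. -/
lemma indistinguishable_haarFamily (hd : PolyBounded d) (hg : IsPRS n g) (a : ℕ → ℕ)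
    (A : ∀ lam, Circuit (OracleGate (d lam) (n lam)) (Fin (a lam)) (Fin 1))
    (ρ : ∀ lam, Op (Fin (a lam))) (hA : PolyBounded fun lam => (A lam).size)
    (hρ : ∀ lam, IsDensity (ρ lam)) :
    Indistinguishable
      (fun lam => uniformAvg fun f : (Fin (d lam) → Bool) → (Fin lam → Bool) =>
        prOne ((A lam).runWith (fun x => g lam (f x)) (ρ lam)))
      (fun lam => ∫ θ : (Fin (d lam) → Bool) → PureStates (n lam),
        prOne ((A lam).runWith (fun x => pureState (θ x).1) (ρ lam))
          ∂(haarFamily (d lam) (n lam))) := by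
  obtain ⟨D, hD, -⟩ := hg.qpt
  -- The output qubits count towards the size of the circuits of `g`, so `n` needs no separate
  -- hypothesis.
  have hn : PolyBounded n := hD.mono fun lam => by simpa using (D lam).card_out_le
  obtain ⟨p, hp⟩ := id hA
  have hpure : ∀ {m : ℕ} (θ : PureStates m), IsDensity (pureState θ.1) := fun θ =>
    isDensity_pureState (by simp)
  have hgd : ∀ lam k, IsDensity (g lam k) := fun lam k => by
    obtain ⟨ψ, hψ⟩ := hg.stateGeneration lam k
    rw [hψ]
    exact hpure ψ
  -- Passing from `p` to `p + 1` makes the supply nonempty while still bounding the number of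
  -- instructions.
  have hne : ∀ lam, NeZero ((p + 1).eval lam) := fun lam => ⟨by simp⟩
  have hops : ∀ lam, (A lam).ops.length ≤ (p + 1).eval lam := fun lam => by
    have := hp lam
    simp only [Circuit.size] at this
    rw [Polynomial.eval_add]
    omega
  -- Uniform keys form a finite, hence compact, discrete probability space, so `g` at a random key
  -- and a Haar state are two instances of the same setting.
  choose b B σ hσ hsize hB using fun lam => exists_distinguisher ((p + 1).eval lam)
    (uniformMeasure (Fin lam → Bool)) (haarState (n lam)) (st₀ := g lam)
    continuous_of_discreteTopology (hgd lam) (continuous_pureState (n lam)) hpure (A lam)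
    (hops lam) (hρ lam)
  have h := hg.pseudorandom (p + 1) b B σ
    ((polyBounded_collectCost hd hn ⟨p + 1, fun _ => le_rfl⟩ hA).mono hsize) hσ
  refine h.of_le_mul (p + 1) fun lam => ?_
  have := hB lam
  rwa [integral_uniformMeasure, integral_pi_uniformMeasure] at this

end Composition

end PRFS

end

theorem mainTheorem7 (d n : ℕ → ℕ) (hd : PRFS.PolyBounded d)
    (F : ∀ lam, (Fin lam → Bool) → (Fin (d lam) → Bool) → (Fin lam → Bool))
    (g : ∀ lam, (Fin lam → Bool) → Matrix (Fin (n lam) → Bool) (Fin (n lam) → Bool) ℂ)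
    (hF : PRFS.IsPostQuantumPRF d (fun lam => lam) F) (hg : PRFS.IsPRS n g) :
    PRFS.IsAPRFS d n (fun lam k x => g lam (F lam k x)) := by
  exact ⟨PRFS.exists_circuit_comp hd hF.polyTime hg, fun a A ρ hA hρ =>
    (PRFS.indistinguishable_randomFunction hF hg a A ρ hA hρ).trans
      (PRFS.indistinguishable_haarFamily hd hg a A ρ hA hρ)⟩
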